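/- Let $G=(V,E)$ be a finite simple graph (the seating graph) with $n$ vertices (seats), let $\mathcal A=\{1,\dots,n\}$ be a set of $n$ agents, and let every agent $a$ have a preference function $p_a:\mathcal A\setminus\{a\}\to\mathbb R$. An arrangement is a bijection $\pi:\mathcal A\to V$, and the utility of agent $a$ in it is $U_a(\pi)=\sum_{v\in N_G(\pi(a))}p_a(\pi^{-1}(v))$. Agent $a$ envies agent $b$ in $\pi$ if $U_a(\pi)<U_a(\pi')$, where $\pi'$ is obtained from $\pi$ by swapping the positions of $a$ and $b$. The arrangement $\pi$ is envy-free if no agent envies another agent, and stable if no two agents envy each other. A partition of $\mathcal A$ into $k$ (possibly empty) classes is a class partition for $(p_a)_{a\in\mathcal A}$ if 1. for every class $K$ there is a function $p_K:\mathcal A\to\mathbb R$ with $p_a(b)=p_K(b)$ for all $a\in K$ and all $b\neq a$, and 2. $p_a(b)=p_a(c)$ for every agent $a$ and all agents $b,c\neq a$ that belong to the same class. The machine model is a random access machine with memory cells for natural numbers and memory cells for real numbers. Memory accesses, tests, additions and truncated subtractions of natural numbers, and additions, subtractions and comparisons of real numbers cost one step each; a multiplication, division or remainder of natural numbers is charged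 the bit lengths of its operands in addition. No other operations on real numbers, and no real constant other than $0$, are available. Theorem. For all natural numbers $k,d,t$ there are a program and a polynomial $B$ (both depending only on $k,d,t$) such that for every $n\ge 0$, every seating graph $G$ on $n$ seats of maximum degree at most $d$ and treewidth at most $t$, and all preferences $(p_a)_{a\in\mathcal A}$ with a class partition into $k$ classes, the program, given $n$, the adjacency matrix of $G$, the matrix of preferences and the class of each agent, halts after at most $B(n)$ steps and outputs the number of stable arrangements. The same holds for the number of envy-free arrangements. -/

import Mathlib

/-! ### Seating arrangements -/

namespace Seating

variable {A V : Type*}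

/-- An arrangement of the agents `A` on the seats `V` is a bijection `π : A ≃ V`. The utility of
agent `a` is the sum of `p a b` over the agents `b` sitting next to `a`. The value `p a a` is never
used, since a seat is not its own neighbour. -/
noncomputable def utility [Fintype V] (G : SimpleGraph V) [DecidableRel G.Adj]
    (p : A → A → ℝ) (π : A ≃ V) (a : A) : ℝ :=
  ∑ v ∈ G.neighborFinset (π a), p a (π.symm v)

/-- The arrangement obtained from `π` by swapping the positions of `a` and `b`. -/
def swapped [DecidableEq A] (π : A ≃ V) (a b : A) : A ≃ V := (Equiv.swap a b).trans π

/-- Agent `a` envies agent `b` in the arrangement `π`. -/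
def Envies [DecidableEq A] [Fintype V] (G : SimpleGraph V) [DecidableRel G.Adj]
    (p : A → A → ℝ) (π : A ≃ V) (a b : A) : Prop :=
  utility G p π a < utility G p (swapped π a b) a

/-- No agent envies another agent. -/
def IsEnvyFree [DecidableEq A] [Fintype V] (G : SimpleGraph V) [DecidableRel G.Adj]
    (p : A → A → ℝ) (π : A ≃ V) : Prop :=
  ∀ a b, ¬ Envies G p π a b

/-- No two agents envy each other. -/
def IsStable [DecidableEq A] [Fintype V] (G : SimpleGraph V) [DecidableRel G.Adj]
    (p : A → A → ℝ) (π : A ≃ V) : Prop :=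
  ∀ a b, ¬ (Envies G p π a b ∧ Envies G p π b a)

/-- The number of stable arrangements. -/
noncomputable def numStable [DecidableEq A] [Fintype V] (G : SimpleGraph V) [DecidableRel G.Adj]
    (p : A → A → ℝ) : ℕ :=
  Nat.card {π : A ≃ V // IsStable G p π}

/-- The number of envy-free arrangements. -/
noncomputable def numEnvyFree [DecidableEq A] [Fintype V] (G : SimpleGraph V) [DecidableRel G.Adj]
    (p : A → A → ℝ) : ℕ :=
  Nat.card {π : A ≃ V // IsEnvyFree G p π}

/-- The fibres of `K : A → Fin k` partition the agents into `k` classes of the preference profile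
`p`: the members of a class share a common preference function, and no agent distinguishes between
other agents of the same class. The irrelevant values `p a a` are not constrained. -/
structure IsClassPartition {k : ℕ} (p : A → A → ℝ) (K : A → Fin k) : Prop where
  common : ∀ i : Fin k, ∃ q : A → ℝ, ∀ a, K a = i → ∀ b, b ≠ a → p a b = q b
  indistinguishable : ∀ a b c, b ≠ a → c ≠ a → K b = K c → p a b = p a c

end Seating

/-! ### Treewidth -/

/-- A tree decomposition of a graph. -/
structure TreeDecomposition {V : Type*} (G : SimpleGraph V) where
  Node : Type
  finite_node : Finite Node
  tree : SimpleGraph Node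
  isTree : tree.IsTree
  bag : Node → Set V
  exists_mem_bag : ∀ a, ∃ u, a ∈ bag u
  exists_edge_bag : ∀ a b, G.Adj a b → ∃ u, a ∈ bag u ∧ b ∈ bag u
  connected_bag : ∀ a, (tree.induce {u | a ∈ bag u}).Connected

/-- The width of a tree decomposition: the largest size of a bag, minus one. -/
noncomputable def TreeDecomposition.width {V : Type*} {G : SimpleGraph V}
    (T : TreeDecomposition G) : ℕ∞ :=
  (⨆ u, (T.bag u).encard) - 1

/-- The treewidth of a graph: the least width of a tree decomposition. -/
noncomputable def treewidth {V : Type*} (G : SimpleGraph V) : ℕ∞ :=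
  ⨅ T : TreeDecomposition G, T.width

/-! ### The machine model

A random access machine, programmed by structured programs. Its memory consists of two kinds of
cells, those holding natural numbers and those holding real numbers, arranged in banks; a program
names the banks by literals and computes the indices within a bank. Memory accesses, tests,
additions and subtractions of natural numbers cost one step; multiplications and divisions of
natural numbers are charged the bit lengths of their operands as well, so that the bit length of
every natural number in memory grows at most linearly with the cost. On real numbers the machine
can only add, subtract and compare, at one step each; the only real constant is `0`, and real
numbers influence natural numbers only through comparisons. -/

namespace RAM

/-- The contents of the memory: `nat x i` is the cell with index `i` of bank `x`. -/
structure Memory where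
  nat : ℕ → ℕ → ℕ
  real : ℕ → ℕ → ℝ

/-- Expressions for natural numbers. -/
inductive NExpr : Type
  | lit (c : ℕ)
  | get (x : ℕ) (i : NExpr)
  | add (e f : NExpr)
  | sub (e f : NExpr)
  | mul (e f : NExpr)
  | div (e f : NExpr)
  | mod (e f : NExpr)

/-- The value of an expression. Subtraction is truncated, a quotient by `0` is `0`, and a remainder
modulo `0` is the dividend. -/
def NExpr.eval (m : Memory) : NExpr → ℕ
  | .lit c => c
  | .get x i => m.nat x (i.eval m)
  | .add e f => e.eval m + f.eval m
  | .sub e f => e.eval m - f.eval m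
  | .mul e f => e.eval m * f.eval m
  | .div e f => e.eval m / f.eval m
  | .mod e f => e.eval m % f.eval m

/-- The number of steps needed to evaluate an expression. -/
def NExpr.cost (m : Memory) : NExpr → ℕ
  | .lit _ => 1
  | .get _ i => i.cost m + 1
  | .add e f => e.cost m + f.cost m + 1
  | .sub e f => e.cost m + f.cost m + 1
  | .mul e f => e.cost m + f.cost m + ((e.eval m).size + (f.eval m).size + 1)
  | .div e f => e.cost m + f.cost m + ((e.eval m).size + (f.eval m).size + 1)
  | .mod e f => e.cost m + f.cost m + ((e.eval m).size + (f.eval m).size + 1)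

/-- Expressions for real numbers. -/
inductive RExpr : Type
  | zero
  | get (x : ℕ) (i : NExpr)
  | add (r s : RExpr)
  | sub (r s : RExpr)

/-- The value of an expression. -/
noncomputable def RExpr.eval (m : Memory) : RExpr → ℝ
  | .zero => 0
  | .get x i => m.real x (i.eval m)
  | .add r s => r.eval m + s.eval m
  | .sub r s => r.eval m - s.eval m

/-- The number of steps needed to evaluate an expression. -/
def RExpr.cost (m : Memory) : RExpr → ℕ
  | .zero => 1
  | .get _ i => i.cost m + 1
  | .add r s => r.cost m + s.cost m + 1
  | .sub r s => r.cost m + s.cost m + 1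

/-- Programs. -/
inductive Prog : Type
  /-- do nothing -/
  | skip
  /-- write the value of `e` to the cell with index `i` of the natural number bank `x` -/
  | setNat (x : ℕ) (i e : NExpr)
  /-- write the value of `r` to the cell with index `i` of the real number bank `x` -/
  | setReal (x : ℕ) (i : NExpr) (r : RExpr)
  /-- run `p` if `r < s`, and `q` otherwise -/
  | ifLT (r s : RExpr) (p q : Prog)
  /-- run `p` if `e` is not zero, and `q` otherwise -/
  | ifNZ (e : NExpr) (p q : Prog)
  /-- run `p`, then `q` -/
  | seq (p q : Prog)
  /-- run `p` as long as `e` is not zero -/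
  | loop (e : NExpr) (p : Prog)

/-- Write a natural number to memory. -/
def Memory.writeNat (m : Memory) (x i v : ℕ) : Memory where
  nat := Function.update m.nat x (Function.update (m.nat x) i v)
  real := m.real

/-- Write a real number to memory. -/
noncomputable def Memory.writeReal (m : Memory) (x i : ℕ) (v : ℝ) : Memory where
  nat := m.nat
  real := Function.update m.real x (Function.update (m.real x) i v)

/-- `Exec p m T m'`: started with memory `m`, the program `p` halts after `T` steps with
memory `m'`. -/
inductive Exec : Prog → Memory → ℕ → Memory → Prop
  | skip (m : Memory) : Exec .skip m 1 m
  | setNat (x : ℕ) (i e : NExpr) (m : Memory) :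
      Exec (.setNat x i e) m (i.cost m + e.cost m + 1) (m.writeNat x (i.eval m) (e.eval m))
  | setReal (x : ℕ) (i : NExpr) (r : RExpr) (m : Memory) :
      Exec (.setReal x i r) m (i.cost m + r.cost m + 1) (m.writeReal x (i.eval m) (r.eval m))
  | ifLT_true {r s : RExpr} {p q : Prog} {m m' : Memory} {T : ℕ} :
      r.eval m < s.eval m → Exec p m T m' →
      Exec (.ifLT r s p q) m (r.cost m + s.cost m + 1 + T) m'
  | ifLT_false {r s : RExpr} {p q : Prog} {m m' : Memory} {T : ℕ} :
      ¬ r.eval m < s.eval m → Exec q m T m' →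
      Exec (.ifLT r s p q) m (r.cost m + s.cost m + 1 + T) m'
  | ifNZ_true {e : NExpr} {p q : Prog} {m m' : Memory} {T : ℕ} :
      e.eval m ≠ 0 → Exec p m T m' → Exec (.ifNZ e p q) m (e.cost m + 1 + T) m'
  | ifNZ_false {e : NExpr} {p q : Prog} {m m' : Memory} {T : ℕ} :
      e.eval m = 0 → Exec q m T m' → Exec (.ifNZ e p q) m (e.cost m + 1 + T) m'
  | seq {p q : Prog} {m m' m'' : Memory} {T U : ℕ} :
      Exec p m T m' → Exec q m' U m'' → Exec (.seq p q) m (T + U) m''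
  | loop_stop {e : NExpr} {p : Prog} {m : Memory} :
      e.eval m = 0 → Exec (.loop e p) m (e.cost m + 1) m
  | loop_step {e : NExpr} {p : Prog} {m m' m'' : Memory} {T U : ℕ} :
      e.eval m ≠ 0 → Exec p m T m' → Exec (.loop e p) m' U m'' →
      Exec (.loop e p) m (e.cost m + 1 + T + U) m''

/-- Started with memory `m`, the program `p` halts after at most `B` steps and leaves the result `r`
in the cell with index `0` of the natural number bank `0`. -/
def Prog.Returns (p : Prog) (m : Memory) (r B : ℕ) : Prop :=
  ∃ (T : ℕ) (m' : Memory), Exec p m T m' ∧ T ≤ B ∧ m'.nat 0 0 = r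

end RAM

namespace Seating

/-- The input for `n` agents, a seating graph `G` on `n` seats, preferences `p` and classes `K`. The
natural number banks `0`, `1`, `2` hold the number `n`, the adjacency matrix of `G` (row by row) and
the class of each agent; the real number bank `0` holds the matrix of preferences (row by row). All
other cells hold `0`. -/
noncomputable def input {n k : ℕ} (G : SimpleGraph (Fin n)) [DecidableRel G.Adj]
    (p : Fin n → Fin n → ℝ) (K : Fin n → Fin k) : RAM.Memory where
  nat
    | 0, 0 => n
    | 1, i => if h : i < n * n then
        (if G.Adj (Fin.divNat ⟨i, h⟩) (Fin.modNat ⟨i, h⟩) then 1 else 0) else 0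
    | 2, i => if h : i < n then (K ⟨i, h⟩ : ℕ) else 0
    | _, _ => 0
  real
    | 0, i => if h : i < n * n then p (Fin.divNat ⟨i, h⟩) (Fin.modNat ⟨i, h⟩) else 0
    | _, _ => 0

end Seating

/-!
Suppose first that the preference of an agent for another agent depends only on the classes of the
two agents. Whether an arrangement is stable or envy-free then depends only on the assignment of
classes to the seats that it induces, and the number of arrangements that induce a given assignment
is a product of factorials (`card_perm_of_comp_symm`). A class partition does not quite have this
property: if a class has only two members, then their preferences for each other may differ. But the
property holds after the first agent of each class has been made a class of its own
(`Seating.pref_eq`), which only doubles the number of classes.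

Given an assignment of classes, the label of a seat lists the class of this seat and the classes of
its at most `d` neighbours; there is a constant number of labels. Whether the agent on a seat `u`
envies the agent on a seat `v` depends only on the labels of `u` and `v` and on whether `u` and `v`
are adjacent (`Seating.envies_iff`). Hence stability depends only on how many seats have each label
and how many adjacent pairs of seats have each pair of labels: a pair of labels occurs on nonadjacent
seats if and only if the number of all pairs with these labels exceeds the number of the adjacent and
equal ones (`Seating.goodCode_iff`). There are polynomially many values of these statistics, and it
suffices to count the assignments of classes with each value.

The generating function of the statistics is a partition function: a sum, over all labellings of the
seats, of a product of weights of single seats and of adjacent pairs of seats, where the weights also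
enforce that the labels are consistent (`Seating.val_eq_generating`). The statistics are encoded by a
number, the exponent, and a large power of two is substituted for the variable, so that the
coefficients are the digits of the value of the function (`Seating.dig_partitionFn`).

Partition functions of graphs of treewidth at most `t` are computed by dynamic programming, without
constructing a tree decomposition. The table has an entry for each set of at most `t + 1` labelled
vertices, the boundary, and each component of the graph without the boundary; it contains the value
of the component, as soon as this is known. A component is solved by moving one of its vertices into
the boundary, in the place of a vertex that is not adjacent to the component. The value is then the
sum, over the labels of this vertex, of products of values of smaller components
(`val_eq_sum`, `val_eq_prod`). All ways to solve a component give the same value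
(`Seating.sound_compTable`). If the treewidth is at most `t`, then all components that matter are
solved (`Seating.compEntry_ne_zero`): if the neighbours of a component belong to a common bag, then
they belong to a common bag that contains a vertex of the component as well
(`TreeDecomposition.exists_bag`), and this vertex can be moved.

For the running time, `RAM.PT` expresses that a function of the input and of some variables is
computable in polynomial time. The class of these functions is closed under arithmetic, comparisons,
and sums, products and quantifiers of polynomial length. Tables are stored as the digits of a number
(`RAM.PT.tab`), so that loops with one numerical accumulator are sufficient. All functions above are
defined by expressions of this kind, and their computability follows their definitions.
-/

namespace RAM

/-! ### Polynomial bounds -/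

/-- The function `B` is given by a polynomial with natural coefficients. -/
def IsPoly (B : ℕ → ℕ) : Prop := ∃ q : Polynomial ℕ, ∀ L, q.eval L = B L

namespace IsPoly

variable {A B : ℕ → ℕ}

lemma const (c : ℕ) : IsPoly fun _ => c := ⟨Polynomial.C c, by simp⟩

lemma id : IsPoly fun L => L := ⟨Polynomial.X, by simp⟩

lemma add : IsPoly A → IsPoly B → IsPoly fun L => A L + B L
  | ⟨q, hq⟩, ⟨s, hs⟩ => ⟨q + s, fun L => by simp [hq, hs]⟩

lemma mul : IsPoly A → IsPoly B → IsPoly fun L => A L * B L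
  | ⟨q, hq⟩, ⟨s, hs⟩ => ⟨q * s, fun L => by simp [hq, hs]⟩

lemma comp : IsPoly A → IsPoly B → IsPoly fun L => A (B L)
  | ⟨q, hq⟩, ⟨s, hs⟩ => ⟨q.comp s, fun L => by simp [hq, hs, Polynomial.eval_comp]⟩

lemma pow (hA : IsPoly A) (c : ℕ) : IsPoly fun L => A L ^ c := by
  obtain ⟨q, hq⟩ := hA
  exact ⟨q ^ c, fun L => by simp [hq]⟩

lemma monotone : IsPoly B → Monotone B := by
  rintro ⟨q, hq⟩ a b hab
  rw [← hq, ← hq, Polynomial.eval_eq_sum, Polynomial.eval_eq_sum]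
  exact Finset.sum_le_sum fun i _ => Nat.mul_le_mul_left _ (Nat.pow_le_pow_left hab i)

end IsPoly

/-! ### Running programs in a part of the memory -/

/-- The memories `m` and `m'` agree in all banks below `r`. -/
def Same (r : ℕ) (m m' : Memory) : Prop :=
  ∀ x < r, m'.nat x = m.nat x ∧ m'.real x = m.real x

/-- Started with memory `m`, the program `P` halts after at most `B` steps, changes no bank below
`r`, and establishes `Q`. -/
def Runs (r : ℕ) (P : Prog) (m : Memory) (B : ℕ) (Q : Memory → Prop) : Prop :=
  ∃ T m', Exec P m T m' ∧ T ≤ B ∧ Same r m m' ∧ Q m'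

lemma Same.refl (r : ℕ) (m : Memory) : Same r m m := fun _ _ => ⟨rfl, rfl⟩

lemma Same.trans {r : ℕ} {m m' m'' : Memory} (h : Same r m m') (h' : Same r m' m'') :
    Same r m m'' :=
  fun x hx => ⟨(h' x hx).1.trans (h x hx).1, (h' x hx).2.trans (h x hx).2⟩

lemma Same.mono {r s : ℕ} {m m' : Memory} (h : Same s m m') (hrs : r ≤ s) : Same r m m' :=
  fun x hx => h x (hx.trans_le hrs)

namespace Runs

variable {r s B B' : ℕ} {P P' : Prog} {m : Memory} {Q Q' : Memory → Prop}

lemma mono (h : Runs r P m B Q) (hB : B ≤ B') (hQ : ∀ m', Same r m m' → Q m' → Q' m') :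
    Runs r P m B' Q' := by
  obtain ⟨T, m', h1, h2, h3, h4⟩ := h
  exact ⟨T, m', h1, h2.trans hB, h3, hQ m' h3 h4⟩

lemma mono_bank (h : Runs s P m B Q) (hrs : r ≤ s) :
    Runs r P m B fun m' => Same s m m' ∧ Q m' := by
  obtain ⟨T, m', h1, h2, h3, h4⟩ := h
  exact ⟨T, m', h1, h2, h3.mono hrs, h3, h4⟩

lemma seq (h : Runs r P m B Q) (h' : ∀ m', Same r m m' → Q m' → Runs r P' m' B' Q') :
    Runs r (.seq P P') m (B + B') Q' := by
  obtain ⟨T, m', h1, h2, h3, h4⟩ := h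
  obtain ⟨U, m'', k1, k2, k3, k4⟩ := h' m' h3 h4
  exact ⟨T + U, m'', .seq h1 k1, by lia, h3.trans k3, k4⟩

lemma setNat {x : ℕ} {e : NExpr} (hx : r ≤ x) (hQ : Q (m.writeNat x 0 (e.eval m)))
    (hB : e.cost m + 2 ≤ B) : Runs r (.setNat x (.lit 0) e) m B Q := by
  refine ⟨_, _, .setNat x (.lit 0) e m, ?_, fun y hy => ⟨?_, rfl⟩, hQ⟩
  · simp only [NExpr.cost]
    lia
  · exact Function.update_of_ne (by lia) ..

lemma setReal {x : ℕ} {e : RExpr} (hx : r ≤ x) (hQ : Q (m.writeReal x 0 (e.eval m)))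
    (hB : e.cost m + 2 ≤ B) : Runs r (.setReal x (.lit 0) e) m B Q := by
  refine ⟨_, _, .setReal x (.lit 0) e m, ?_, fun y hy => ⟨rfl, ?_⟩, hQ⟩
  · simp only [NExpr.cost]
    lia
  · exact Function.update_of_ne (by lia) ..

end Runs

lemma Memory.writeNat_same (m : Memory) (x i v : ℕ) : (m.writeNat x i v).nat x i = v := by
  simp [Memory.writeNat]

lemma Memory.writeReal_same (m : Memory) (x i : ℕ) (v : ℝ) : (m.writeReal x i v).real x i = v := by
  simp [Memory.writeReal]

lemma Memory.writeNat_of_ne (m : Memory) {x y : ℕ} (i v : ℕ) (h : y ≠ x) :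
    (m.writeNat x i v).nat y = m.nat y :=
  Function.update_of_ne h ..

/-! ### Functions computable in polynomial time -/

/-- A type of valuations: every `γ : Γ` comes with an input memory and with values of the variables
in `Idx`. -/
class Ctx (Γ : Type) where
  Idx : Type
  mem : Γ → Memory
  var : Idx → Γ → ℕ

variable {Γ : Type} [Ctx Γ]

/-- A context is extended by one more variable, which takes the place `none`. -/
instance : Ctx (Γ × ℕ) where
  Idx := Option (Ctx.Idx Γ)
  mem γ := Ctx.mem γ.1
  var
    | none, γ => γ.2
    | some i, γ => Ctx.var i γ.1

/-- The first cell of the input and the sizes of all numbers in the input banks and in the variables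
are at most `L`. -/
structure Bd (γ : Γ) (L : ℕ) : Prop where
  le : (Ctx.mem γ).nat 0 0 ≤ L
  mem : ∀ x < 3, ∀ i, ((Ctx.mem γ).nat x i).size ≤ L
  var : ∀ i, (Ctx.var i γ).size ≤ L

/-- The memory `m` contains the input in the banks below `3`, and the value of the variable `i` in
the first cell of the bank `loc i`. -/
structure Agree (loc : Ctx.Idx Γ → ℕ) (γ : Γ) (m : Memory) : Prop where
  mem : Same 3 (Ctx.mem γ) m
  var : ∀ i, m.nat (loc i) 0 = Ctx.var i γ

lemma Bd.mono {γ : Γ} {L L' : ℕ} (h : Bd γ L) (hL : L ≤ L') : Bd γ L' :=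
  ⟨h.le.trans hL, fun x hx i => (h.mem x hx i).trans hL, fun i => (h.var i).trans hL⟩

lemma Agree.same {loc : Ctx.Idx Γ → ℕ} {γ : Γ} {m m' : Memory} {r : ℕ} (h : Agree loc γ m)
    (hs : Same r m m') (hr : 3 ≤ r) (hloc : ∀ i, loc i < r) : Agree loc γ m' :=
  ⟨h.mem.trans (hs.mono hr), fun i => by rw [(hs _ (hloc i)).1, h.var]⟩

/-- There are programs that establish `Q r`, in polynomial time and without changing the banks below
`r`, for each `r` and each placement of the variables in the banks below `r`. Thus a program can be
used as a subroutine with the banks from `r` on as its working memory; the input banks `0`, `1`, `2`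
are never overwritten. -/
def Establishes (Q : ℕ → Γ → Memory → Prop) : Prop :=
  ∀ (loc : Ctx.Idx Γ → ℕ) (r : ℕ), 3 ≤ r → (∀ i, loc i < r) → ∃ (P : Prog) (B : ℕ → ℕ), IsPoly B ∧
    ∀ (γ : Γ) (L : ℕ) (m : Memory), Bd γ L → Agree loc γ m → Runs r P m (B L) (Q r γ)

/-- The bit length of `f` is polynomially bounded. -/
def PSize (f : Γ → ℕ) : Prop := ∃ S, IsPoly S ∧ ∀ γ L, Bd γ L → (f γ).size ≤ S L

/-- The function `f` is computable in polynomial time. The size of its values is bounded as well,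
since arithmetic operations on these values are charged for it. -/
structure PT (f : Γ → ℕ) : Prop where
  size : PSize f
  establishes : Establishes fun r γ m => m.nat r 0 = f γ

/-- The real function `f` is computable in polynomial time. -/
def PTR (f : Γ → ℝ) : Prop := Establishes fun r γ m => m.real r 0 = f γ

/-- Running two programs and combining their results, which are left in the banks `r` and `r + 1`.
-/
lemma Establishes.seq {Q Q' Q'' : ℕ → Γ → Memory → Prop} (h : Establishes Q) (h' : Establishes Q')
    (P : ℕ → Prog) {C : ℕ → ℕ} (hC : IsPoly C)
    (hP : ∀ r γ L m, Bd γ L → Q r γ m → Q' (r + 1) γ m → Runs r (P r) m (C L) (Q'' r γ))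
    (hQ : ∀ r γ m m', Q r γ m → Same (r + 1) m m' → Q r γ m') : Establishes Q'' := by
  intro loc r hr hloc
  obtain ⟨P₁, B₁, hB₁, h₁⟩ := h loc r hr hloc
  obtain ⟨P₂, B₂, hB₂, h₂⟩ := h' loc (r + 1) (by lia) fun i => (hloc i).trans (by lia)
  refine ⟨.seq P₁ (.seq P₂ (P r)), _, hB₁.add (hB₂.add hC), fun γ L m hb ha => ?_⟩
  refine (h₁ γ L m hb ha).seq fun m₁ hs₁ hq₁ => ?_
  refine ((h₂ γ L m₁ hb (ha.same hs₁ hr hloc)).mono_bank (r := r) (by lia)).seq fun m₂ _ hq₂ => ?_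
  exact hP r γ L m₂ hb (hQ r γ _ _ hq₁ hq₂.1) hq₂.2

lemma nat_of_same {r : ℕ} {m m' : Memory} {a : ℕ} (h : m.nat r 0 = a) (hs : Same (r + 1) m m') :
    m'.nat r 0 = a := by
  rw [(hs r (by lia)).1, h]

lemma real_of_same {r : ℕ} {m m' : Memory} {a : ℝ} (h : m.real r 0 = a) (hs : Same (r + 1) m m') :
    m'.real r 0 = a := by
  rw [(hs r (by lia)).2, h]

namespace PT

variable {f g : Γ → ℕ}

lemma const (c : ℕ) : PT fun _ : Γ => c := by
  refine ⟨⟨_, .const c.size, fun _ _ _ => le_rfl⟩, fun loc r _ _ => ?_⟩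
  refine ⟨.setNat r (.lit 0) (.lit c), _, .const 3, fun γ L m _ _ => ?_⟩
  exact Runs.setNat le_rfl (m.writeNat_same ..) le_rfl

/-- The last variable of the context. -/
lemma snd : PT fun γ : Γ × ℕ => γ.2 := by
  refine ⟨⟨_, .id, fun γ L h => h.var none⟩, fun loc r _ _ => ?_⟩
  refine ⟨.setNat r (.lit 0) (.get (loc none) (.lit 0)), _, .const 4, fun γ L m _ ha => ?_⟩
  refine Runs.setNat le_rfl ((m.writeNat_same ..).trans ?_) le_rfl
  exact ha.var none

/-- A change of contexts that only renames variables. -/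
structure _root_.RAM.Ren {Δ : Type} [Ctx Δ] (π : Δ → Γ) (σ : Ctx.Idx Γ → Ctx.Idx Δ) : Prop where
  mem : ∀ δ, Ctx.mem (π δ) = Ctx.mem δ
  var : ∀ i δ, Ctx.var i (π δ) = Ctx.var (σ i) δ

lemma _root_.RAM.Ren.bd {Δ : Type} [Ctx Δ] {π : Δ → Γ} {σ : Ctx.Idx Γ → Ctx.Idx Δ} (h : Ren π σ)
    {δ : Δ} {L : ℕ} (hb : Bd δ L) : Bd (π δ) L :=
  ⟨by simpa [h.mem] using hb.le, by simpa [h.mem] using hb.mem,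
    fun i => by simpa [h.var] using hb.var (σ i)⟩

lemma _root_.RAM.Establishes.ren {Q : ℕ → Γ → Memory → Prop} (h : Establishes Q) {Δ : Type} [Ctx Δ]
    {π : Δ → Γ} {σ : Ctx.Idx Γ → Ctx.Idx Δ} (hπ : Ren π σ) :
    Establishes fun r (δ : Δ) => Q r (π δ) := by
  intro loc r hr hloc
  obtain ⟨P, B, hB, hP⟩ := h (fun i => loc (σ i)) r hr fun i => hloc _
  refine ⟨P, B, hB, fun δ L m hb ha => hP (π δ) L m (hπ.bd hb) ⟨?_, fun i => ?_⟩⟩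
  · rw [hπ.mem]
    exact ha.mem
  · rw [hπ.var]
    exact ha.var (σ i)

lemma ren (h : PT f) {Δ : Type} [Ctx Δ] {π : Δ → Γ} {σ : Ctx.Idx Γ → Ctx.Idx Δ} (hπ : Ren π σ) :
    PT fun δ => f (π δ) := by
  obtain ⟨⟨S, hS, hf⟩, h⟩ := h
  exact ⟨⟨S, hS, fun δ L hb => hf _ L (hπ.bd hb)⟩, h.ren hπ⟩

lemma _root_.RAM.Ren.fst : Ren (fun γ : Γ × ℕ => γ.1) some := ⟨fun _ => rfl, fun _ _ => rfl⟩

/-- Weakening by an unused last variable. -/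
lemma wk (h : PT f) : PT fun γ : Γ × ℕ => f γ.1 := h.ren .fst

/-- Reading a cell of an input bank. -/
lemma read {x : ℕ} (hx : x < 3) (hf : PT f) : PT fun γ => (Ctx.mem γ).nat x (f γ) := by
  refine ⟨⟨_, .id, fun γ L h => h.mem x hx _⟩, fun loc r hr hloc => ?_⟩
  obtain ⟨P, B, hB, hP⟩ := hf.establishes loc r hr hloc
  refine ⟨.seq P (.setNat r (.lit 0) (.get x (.get r (.lit 0)))), _, hB.add (.const 5),
    fun γ L m hb ha => ?_⟩
  refine (hP γ L m hb ha).seq fun m' hs hq => Runs.setNat le_rfl ((m'.writeNat_same ..).trans ?_)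
    le_rfl
  simp only [NExpr.eval, hq]
  rw [((ha.same hs hr hloc).mem x hx).1]

/-- Closure under the operation `op` of the machine with the meaning `o`. -/
lemma bin (op : NExpr → NExpr → NExpr) {o : ℕ → ℕ → ℕ}
    (heval : ∀ m e e', (op e e').eval m = o (e.eval m) (e'.eval m))
    (hcost : ∀ m e e', (op e e').cost m ≤
      e.cost m + e'.cost m + ((e.eval m).size + (e'.eval m).size + 1))
    (hsize : ∀ a b, (o a b).size ≤ a.size + b.size + 1) (hf : PT f) (hg : PT g) :
    PT fun γ => o (f γ) (g γ) := by
  obtain ⟨⟨S, hS, hSf⟩, hf⟩ := hf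
  obtain ⟨⟨S', hS', hSg⟩, hg⟩ := hg
  have hS2 := (hS.add hS').add (.const 1)
  refine ⟨⟨_, hS2, fun γ L h => ?_⟩, ?_⟩
  · have := hSf γ L h
    have := hSg γ L h
    have := hsize (f γ) (g γ)
    lia
  refine hf.seq hg
    (fun r => .setNat r (.lit 0) (op (.get r (.lit 0)) (.get (r + 1) (.lit 0))))
    (hS2.add (.const 6)) (fun r γ L m hb h1 h2 => ?_) fun r γ m m' h hs => nat_of_same h hs
  refine Runs.setNat le_rfl ((m.writeNat_same ..).trans ?_) ?_
  · simp [heval, NExpr.eval, h1, h2]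
  · refine (Nat.add_le_add_right (hcost ..) 2).trans ?_
    simp only [NExpr.eval, NExpr.cost, h1, h2]
    have := hSf γ L hb
    have := hSg γ L hb
    lia

lemma _root_.RAM.size_mul_le (a b : ℕ) : (a * b).size ≤ a.size + b.size := by
  rw [Nat.size_le, pow_add]
  exact Nat.mul_lt_mul'' (Nat.lt_size_self a) (Nat.lt_size_self b)

lemma _root_.RAM.size_add_le (a b : ℕ) : (a + b).size ≤ a.size + b.size + 1 := by
  rw [Nat.size_le, pow_succ]
  have ha := (Nat.lt_size_self a).trans_le (Nat.pow_le_pow_right (n := 2) (by lia)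
    (Nat.le_add_right a.size b.size))
  have hb := (Nat.lt_size_self b).trans_le (Nat.pow_le_pow_right (n := 2) (by lia)
    (Nat.le_add_left b.size a.size))
  lia

lemma add (hf : PT f) (hg : PT g) : PT fun γ => f γ + g γ :=
  bin .add (fun _ _ _ => rfl) (fun m e e' => by simp only [NExpr.cost]; lia) size_add_le hf hg

lemma sub (hf : PT f) (hg : PT g) : PT fun γ => f γ - g γ :=
  bin .sub (fun _ _ _ => rfl) (fun m e e' => by simp only [NExpr.cost]; lia)
    (fun a b => (Nat.size_le_size (Nat.sub_le a b)).trans (by lia)) hf hg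

lemma mul (hf : PT f) (hg : PT g) : PT fun γ => f γ * g γ :=
  bin .mul (fun _ _ _ => rfl) (fun m e e' => le_rfl)
    (fun a b => (size_mul_le a b).trans (by lia)) hf hg

lemma div (hf : PT f) (hg : PT g) : PT fun γ => f γ / g γ :=
  bin .div (fun _ _ _ => rfl) (fun m e e' => le_rfl)
    (fun a b => (Nat.size_le_size (Nat.div_le_self a b)).trans (by lia)) hf hg

lemma mod (hf : PT f) (hg : PT g) : PT fun γ => f γ % g γ :=
  bin .mod (fun _ _ _ => rfl) (fun m e e' => le_rfl)
    (fun a b => (Nat.size_le_size (Nat.mod_le a b)).trans (by lia)) hf hg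

end PT

/-! ### Real numbers and comparisons -/

namespace PTR

variable {f g : Γ → ℝ}

lemma zero : PTR fun _ : Γ => 0 := fun _ r _ _ =>
  ⟨.setReal r (.lit 0) .zero, _, .const 3, fun _ _ m _ _ =>
    Runs.setReal le_rfl (m.writeReal_same ..) le_rfl⟩

lemma add (hf : PTR f) (hg : PTR g) : PTR fun γ => f γ + g γ := by
  refine Establishes.seq hf hg
    (fun r => .setReal r (.lit 0) (.add (.get r (.lit 0)) (.get (r + 1) (.lit 0)))) (.const 7)
    (fun r γ L m hb h1 h2 => ?_) fun r γ m m' h hs => real_of_same h hs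
  refine Runs.setReal le_rfl ((m.writeReal_same ..).trans ?_) le_rfl
  simp [RExpr.eval, NExpr.eval, h1, h2]

/-- Reading a cell of the real input bank. -/
lemma read {f : Γ → ℕ} (hf : PT f) : PTR fun γ => (Ctx.mem γ).real 0 (f γ) := by
  intro loc r hr hloc
  obtain ⟨P, B, hB, hP⟩ := hf.establishes loc r hr hloc
  refine ⟨.seq P (.setReal r (.lit 0) (.get 0 (.get r (.lit 0)))), _, hB.add (.const 5),
    fun γ L m hb ha => ?_⟩
  refine (hP γ L m hb ha).seq fun m' hs hq => Runs.setReal le_rfl ((m'.writeReal_same ..).trans ?_)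
    le_rfl
  simp only [RExpr.eval, NExpr.eval, hq]
  rw [((ha.same hs hr hloc).mem 0 (by lia)).2]

/-- A sum with a constant number of terms; it is unrolled. -/
lemma sum (c : ℕ) {f : ℕ → Γ → ℝ} (hf : ∀ i, PTR (f i)) :
    PTR fun γ => ∑ i ∈ Finset.range c, f i γ := by
  induction c with
  | zero => simpa using zero
  | succ c ih => simpa only [Finset.sum_range_succ] using ih.add (hf c)

end PTR

/-- The property `P` is decidable in polynomial time. -/
def PTD (P : Γ → Prop) : Prop := PT fun γ => open Classical in if P γ then 1 else 0

lemma PTD.real_lt {f g : Γ → ℝ} (hf : PTR f) (hg : PTR g) : PTD fun γ => f γ < g γ := by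
  refine ⟨⟨_, .const 1, fun γ L _ => ?_⟩, Establishes.seq hf hg
    (fun r => .ifLT (.get r (.lit 0)) (.get (r + 1) (.lit 0)) (.setNat r (.lit 0) (.lit 1))
      (.setNat r (.lit 0) (.lit 0))) (.const 8) (fun r γ L m hb h1 h2 => ?_)
      fun r γ m m' h hs => real_of_same h hs⟩
  · dsimp only
    split_ifs <;> simp
  · by_cases h : f γ < g γ
    · obtain ⟨T, m', k1, k2, k3⟩ : Runs r (.setNat r (.lit 0) (.lit 1)) m 3
        fun m => m.nat r 0 = 1 := Runs.setNat le_rfl (m.writeNat_same ..) le_rfl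
      refine ⟨_, m', .ifLT_true (by simpa [RExpr.eval, NExpr.eval, h1, h2] using h) k1, ?_, ?_⟩
      · simp [RExpr.cost, NExpr.cost]
        lia
      · simpa [h] using k3
    · obtain ⟨T, m', k1, k2, k3⟩ : Runs r (.setNat r (.lit 0) (.lit 0)) m 3
        fun m => m.nat r 0 = 0 := Runs.setNat le_rfl (m.writeNat_same ..) le_rfl
      refine ⟨_, m', .ifLT_false (by simpa [RExpr.eval, NExpr.eval, h1, h2] using h) k1, ?_, ?_⟩
      · simp [RExpr.cost, NExpr.cost]
        lia
      · simpa [h] using k3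

end RAM

namespace RAM

variable {Γ : Type} [Ctx Γ]

/-! ### Bounded iteration -/

/-- The function `f` is computable in polynomial time, and its value is bounded by a polynomial in
the first cell of the input. Such a function can serve as the number of rounds of a loop, and as an
exponent. -/
structure PB (f : Γ → ℕ) : Prop where
  pt : PT f
  bound : ∃ q, IsPoly q ∧ ∀ γ, f γ ≤ q ((Ctx.mem γ).nat 0 0)

lemma PB.exists_bound {f : Γ → ℕ} (h : PB f) : ∃ q, IsPoly q ∧ ∀ γ L, Bd γ L → f γ ≤ q L := by
  obtain ⟨q, hq, hf⟩ := h.bound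
  exact ⟨q, hq, fun γ L hb => (hf γ).trans (hq.monotone hb.le)⟩

/-- The value of an accumulator after `c` rounds; round `i` turns the value `a` into `s i a`. -/
def iter (s : ℕ → ℕ → ℕ) (a : ℕ) : ℕ → ℕ
  | 0 => a
  | c + 1 => s c (iter s a c)

/-- The placement of two additional variables. -/
def loc₂ (loc : Ctx.Idx Γ → ℕ) (x y : ℕ) : Ctx.Idx ((Γ × ℕ) × ℕ) → ℕ
  | none => y
  | some none => x
  | some (some i) => loc i

/-- The body of a loop that applies `P` to the counter in bank `r + 1` and the accumulator in bank
`r`. -/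
def loopBody (P : Prog) (r : ℕ) : Prog :=
  .seq P (.seq (.setNat r (.lit 0) (.get (r + 3) (.lit 0)))
    (.setNat (r + 1) (.lit 0) (.add (.get (r + 1) (.lit 0)) (.lit 1))))

lemma Bd.extend {γ : Γ} {L : ℕ} (h : Bd γ L) (i : ℕ) : Bd (γ, i) (L + i.size) where
  le := h.le.trans (by lia)
  mem x hx j := (h.mem x hx j).trans (by lia)
  var
    | none => Nat.le_add_left i.size L
    | some j => (h.var j).trans (by lia)

lemma Agree.loop {loc : Ctx.Idx Γ → ℕ} {γ : Γ} {m m' : Memory} {r i a : ℕ} (h : Agree loc γ m)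
    (hr : 3 ≤ r) (hloc : ∀ i, loc i < r) (hs : Same r m m') (hi : m'.nat (r + 1) 0 = i)
    (ha : m'.nat r 0 = a) : Agree (loc₂ loc (r + 1) r) ((γ, i), a) m' where
  mem := (h.same hs hr hloc).mem
  var
    | none => ha
    | some none => hi
    | some (some j) => (h.same hs hr hloc).var j

lemma size_le_self (i : ℕ) : i.size ≤ i := Nat.size_le.2 Nat.lt_two_pow_self

lemma Exec.loop_of_eval_eq_zero {e : NExpr} {P : Prog} {m : Memory} (h : e.eval m = 0) :
    Exec (.loop e P) m (e.cost m + 1) m := by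
  constructor
  exact h

/-- A loop that keeps its accumulator, its counter and its number of rounds in the banks `r`, `r +
1` and `r + 2`. The statement concerns the last `j` rounds. -/
lemma runs_loop {loc : Ctx.Idx Γ → ℕ} {γ : Γ} {m₀ : Memory} {r : ℕ} (h : Agree loc γ m₀)
    (hr : 3 ≤ r) (hloc : ∀ i, loc i < r) {s : ℕ → ℕ → ℕ} {a c C : ℕ} {P : Prog}
    (hP : ∀ i < c, ∀ m, Agree (loc₂ loc (r + 1) r) ((γ, i), iter s a i) m →
      Runs (r + 3) P m C fun m' => m'.nat (r + 3) 0 = s i (iter s a i))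
    (j i : ℕ) (hij : i + j = c) (m : Memory) (hs : Same r m₀ m) (hi : m.nat (r + 1) 0 = i)
    (ha : m.nat r 0 = iter s a i) (hc : m.nat (r + 2) 0 = c) :
    Runs r (.loop (.sub (.get (r + 2) (.lit 0)) (.get (r + 1) (.lit 0))) (loopBody P r)) m
      (j * (C + 16) + 6) fun m' => m'.nat r 0 = iter s a c := by
  induction j generalizing i m with
  | zero =>
    refine ⟨_, m, .loop_of_eval_eq_zero ?_, ?_, .refl r m, ?_⟩
    · simp [NExpr.eval, hi, hc]
      lia
    · simp [NExpr.cost]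
    · obtain rfl : i = c := hij
      exact ha
  | succ j ih =>
    have hbody : Runs r (loopBody P r) m (C + (4 + 6)) fun m' =>
        m'.nat (r + 1) 0 = i + 1 ∧ m'.nat r 0 = iter s a (i + 1) ∧ m'.nat (r + 2) 0 = c := by
      refine ((hP i (by lia) m (h.loop hr hloc hs hi ha)).mono_bank (by lia)).seq
        fun m₁ _ hq₁ => ?_
      refine Runs.seq (Q := fun m₂ => m₂ = m₁.writeNat r 0 (s i (iter s a i)))
        (Runs.setNat le_rfl ?_ le_rfl) fun m₂ _ hq₂ => ?_
      · simp [NExpr.eval, hq₁.2]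
      · refine Runs.setNat (by lia) ?_ le_rfl
        simp only [Memory.writeNat_same, NExpr.eval, hq₂]
        refine ⟨?_, ?_, ?_⟩
        · rw [Memory.writeNat_of_ne _ _ _ (by lia), (hq₁.1 _ (by lia)).1, hi]
        · rw [Memory.writeNat_of_ne _ _ _ (by lia), Memory.writeNat_same]
          rfl
        · rw [Memory.writeNat_of_ne _ _ _ (by lia), Memory.writeNat_of_ne _ _ _ (by lia),
            (hq₁.1 _ (by lia)).1, hc]
    obtain ⟨T, m', h1, h2, h3, h4, h5, h6⟩ := hbody
    obtain ⟨U, m'', k1, k2, k3, k4⟩ := ih (i + 1) (by lia) m' (hs.trans h3) h4 h5 h6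
    refine ⟨_, m'', .loop_step ?_ h1 k1, ?_, h3.trans k3, k4⟩
    · simp [NExpr.eval, hi, hc]
      lia
    · simp only [NExpr.cost]
      lia

namespace PT

variable {f g c : Γ → ℕ}

/-- Iteration, provided that the accumulator stays of polynomial size. -/
lemma iter (hc : PB c) (hf : PT f) {s : Γ → ℕ → ℕ → ℕ}
    (hs : PT fun γ : (Γ × ℕ) × ℕ => s γ.1.1 γ.1.2 γ.2) {S : ℕ → ℕ} (hS : IsPoly S)
    (hsize : ∀ γ L, Bd γ L → ∀ i ≤ c γ, (iter (s γ) (f γ) i).size ≤ S L) :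
    PT fun γ => RAM.iter (s γ) (f γ) (c γ) := by
  obtain ⟨q, hq, hcq⟩ := hc.exists_bound
  refine ⟨⟨S, hS, fun γ L hb => hsize γ L hb _ le_rfl⟩, fun loc r hr hloc => ?_⟩
  obtain ⟨Pf, Bf, hBf, hPf⟩ := hf.establishes loc r hr hloc
  obtain ⟨Pc, Bc, hBc, hPc⟩ := hc.pt.establishes loc (r + 2) (by lia)
    fun i => (hloc i).trans (by lia)
  obtain ⟨Ps, Bs, hBs, hPs⟩ := hs.establishes (loc₂ loc (r + 1) r) (r + 3) (by lia) (by
    rintro (_ | _ | i)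
    · exact Nat.lt_add_of_pos_right (by lia)
    · exact Nat.add_lt_add_left (by lia) r
    · exact (hloc i).trans (by lia))
  refine ⟨.seq Pf (.seq Pc (.seq (.setNat (r + 1) (.lit 0) (.lit 0))
    (.loop (.sub (.get (r + 2) (.lit 0)) (.get (r + 1) (.lit 0))) (loopBody Ps r)))), _,
    hBf.add (hBc.add (.add (.const 3) (.add (.mul hq
      (.add (hBs.comp ((IsPoly.id.add hq).add hS)) (.const 16))) (.const 6)))),
    fun γ L m hb ha => ?_⟩
  refine (hPf γ L m hb ha).seq fun m₁ hs₁ hq₁ => ?_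
  refine ((hPc γ L m₁ hb (ha.same hs₁ hr hloc)).mono_bank (r := r) (by lia)).seq
    fun m₂ hs₂ hq₂ => ?_
  refine Runs.seq (Q := fun m₃ => m₃ = m₂.writeNat (r + 1) 0 0)
    (Runs.setNat (by lia) rfl le_rfl) fun m₃ hs₃ hq₃ => ?_
  refine (runs_loop (ha.same (hs₁.trans (hs₂.trans hs₃)) hr hloc) hr hloc (s := s γ) (a := f γ)
    (c := c γ) (C := Bs (L + q L + S L)) (P := Ps) (fun i hi m' ha' => ?_) (c γ) 0 (by lia) m₃
    (.refl _ _) ?_ ?_ ?_).mono ?_ fun _ _ h => h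
  · refine hPs ((γ, i), RAM.iter (s γ) (f γ) i) _ m' (((hb.extend i).extend _).mono ?_) ha'
    have := size_le_self i
    have := hcq γ L hb
    have := hsize γ L hb i hi.le
    lia
  · rw [hq₃, Memory.writeNat_same]
  · rw [hq₃, Memory.writeNat_of_ne _ _ _ (by lia), (hq₂.1 r (by lia)).1, hq₁]
    rfl
  · rw [hq₃, Memory.writeNat_of_ne _ _ _ (by lia), hq₂.2]
  · have := hcq γ L hb
    gcongr

/-- A polynomial bound for the sizes of the values of `g` at all counters, in terms of the size of
the other variables. -/
lemma exists_lt_two_pow {g : Γ × ℕ → ℕ} (hc : PB c) (hg : PSize g) :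
    ∃ S, IsPoly S ∧ ∀ γ L, Bd γ L → ∀ i < c γ, g (γ, i) < 2 ^ S L := by
  obtain ⟨q, hq, hcq⟩ := hc.exists_bound
  obtain ⟨S, hS, hSg⟩ := hg
  refine ⟨_, hS.comp (IsPoly.id.add hq), fun γ L hb i hi => Nat.size_le.1 ?_⟩
  refine hSg _ _ ((hb.extend i).mono ?_)
  have := size_le_self i
  have := hcq γ L hb
  lia

lemma sum {g : Γ → ℕ → ℕ} (hc : PB c) (hg : PT fun γ : Γ × ℕ => g γ.1 γ.2) :
    PT fun γ => ∑ i ∈ Finset.range (c γ), g γ i := by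
  obtain ⟨q, hq, hcq⟩ := hc.exists_bound
  obtain ⟨S, hS, hSg⟩ := exists_lt_two_pow hc hg.size
  have key (γ : Γ) (j : ℕ) :
      ∑ i ∈ Finset.range j, g γ i = RAM.iter (fun i a => a + g γ i) 0 j := by
    induction j with
    | zero => rfl
    | succ j ih => rw [Finset.sum_range_succ, ih, RAM.iter]
  simp only [key]
  refine iter hc (.const 0) (s := fun γ i a => a + g γ i) (snd.add hg.wk) (hq.add hS)
    fun γ L hb j hj => ?_
  rw [← key, Nat.size_le, pow_add]
  calc ∑ i ∈ Finset.range j, g γ i ≤ ∑ i ∈ Finset.range j, 2 ^ S L :=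
        Finset.sum_le_sum fun i hi => (hSg γ L hb i (by simp at hi; lia)).le
    _ = j * 2 ^ S L := by simp
    _ < 2 ^ q L * 2 ^ S L := by
        have := hcq γ L hb
        have : j < 2 ^ q L := (hj.trans this).trans_lt Nat.lt_two_pow_self
        gcongr

lemma prod {g : Γ → ℕ → ℕ} (hc : PB c) (hg : PT fun γ : Γ × ℕ => g γ.1 γ.2) :
    PT fun γ => ∏ i ∈ Finset.range (c γ), g γ i := by
  obtain ⟨q, hq, hcq⟩ := hc.exists_bound
  obtain ⟨S, hS, hSg⟩ := exists_lt_two_pow hc hg.size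
  have key (γ : Γ) (j : ℕ) :
      ∏ i ∈ Finset.range j, g γ i = RAM.iter (fun i a => a * g γ i) 1 j := by
    induction j with
    | zero => rfl
    | succ j ih => rw [Finset.prod_range_succ, ih, RAM.iter]
  simp only [key]
  refine iter hc (.const 1) (s := fun γ i a => a * g γ i) (snd.mul hg.wk)
    ((hS.mul hq).add (.const 1)) fun γ L hb j hj => ?_
  rw [← key, Nat.size_le, pow_succ]
  calc ∏ i ∈ Finset.range j, g γ i ≤ ∏ i ∈ Finset.range j, 2 ^ S L :=
        Finset.prod_le_prod' fun i hi => (hSg γ L hb i (by simp at hi; lia)).le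
    _ = 2 ^ (S L * j) := by simp [pow_mul]
    _ ≤ 2 ^ (S L * q L) := by
        have := hj.trans (hcq γ L hb)
        gcongr
        lia
    _ < _ := by
        have : 0 < 2 ^ (S L * q L) := by positivity
        lia

lemma pow (hf : PT f) (hc : PB c) : PT fun γ => f γ ^ c γ := by
  simpa using prod (g := fun γ _ => f γ) hc hf.wk

end PT

/-! ### Decidable properties -/

namespace PTD

open Classical in
/-- The number `1` if the property `P` holds, and the number `0` otherwise. -/
noncomputable def ind (P : Prop) : ℕ := if P then 1 else 0

variable {P Q : Γ → Prop} {f g c : Γ → ℕ}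

lemma of_iff (hf : PT f) (h : ∀ γ, f γ = ind (P γ)) : PTD P := by
  obtain rfl : f = _ := funext h
  exact hf

lemma const (P : Prop) : PTD fun _ : Γ => P := PT.const _

lemma not (h : PTD P) : PTD fun γ => ¬ P γ :=
  of_iff ((PT.const 1).sub h) fun γ => by by_cases h : P γ <;> simp [ind, h]

lemma and (h : PTD P) (h' : PTD Q) : PTD fun γ => P γ ∧ Q γ :=
  of_iff (PT.mul h h') fun γ => by by_cases h : P γ <;> by_cases h' : Q γ <;> simp [ind, h, h']

lemma or (h : PTD P) (h' : PTD Q) : PTD fun γ => P γ ∨ Q γ := by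
  simpa only [not_and_or, not_not] using (h.not.and h'.not).not

lemma imp (h : PTD P) (h' : PTD Q) : PTD fun γ => P γ → Q γ := by
  simpa only [imp_iff_not_or] using h.not.or h'

lemma lt (hf : PT f) (hg : PT g) : PTD fun γ => f γ < g γ :=
  of_iff ((PT.const 1).sub ((PT.const 1).sub (hg.sub hf))) fun γ => by
    unfold ind
    split_ifs <;> lia

lemma le (hf : PT f) (hg : PT g) : PTD fun γ => f γ ≤ g γ := by
  simpa only [not_lt] using (lt hg hf).not

lemma eq (hf : PT f) (hg : PT g) : PTD fun γ => f γ = g γ := by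
  simpa only [le_antisymm_iff] using (le hf hg).and (le hg hf)

lemma ne (hf : PT f) (hg : PT g) : PTD fun γ => f γ ≠ g γ := (eq hf hg).not

lemma ex {P : Γ → ℕ → Prop} (hc : PB c) (h : PTD fun γ : Γ × ℕ => P γ.1 γ.2) :
    PTD fun γ => ∃ i < c γ, P γ i := by
  have : PTD fun γ => ∑ i ∈ Finset.range (c γ), ind (P γ i) ≠ 0 :=
    ne (PT.sum (g := fun γ i => ind (P γ i)) hc h) (PT.const 0)
  simpa [ind] using this

lemma all {P : Γ → ℕ → Prop} (hc : PB c) (h : PTD fun γ : Γ × ℕ => P γ.1 γ.2) :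
    PTD fun γ => ∀ i < c γ, P γ i := by
  simpa using (ex (P := fun γ i => ¬ P γ i) hc h.not).not

lemma ite {_ : ∀ γ, Decidable (P γ)} (h : PTD P) (hf : PT f) (hg : PT g) :
    PT fun γ => if P γ then f γ else g γ := by
  have h1 : PT fun γ => ind (P γ) := h
  have h2 : PT fun γ => ind (¬ P γ) := h.not
  have h3 := (h1.mul hf).add (h2.mul hg)
  refine cast ?_ h3
  congr with γ
  by_cases h : P γ <;> simp [ind, h]

end PTD

/-! ### Bounded values -/

namespace PB

variable {f g c : Γ → ℕ}

lemma const (c : ℕ) : PB fun _ : Γ => c := ⟨.const c, _, .const c, fun _ => le_rfl⟩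

lemma wk (h : PB f) : PB fun γ : Γ × ℕ => f γ.1 := by
  obtain ⟨h, q, hq, h'⟩ := h
  exact ⟨h.wk, q, hq, fun γ => h' γ.1⟩

lemma of_le (h : PT f) (hg : PB g) (hfg : ∀ γ, f γ ≤ g γ) : PB f := by
  obtain ⟨q, hq, h'⟩ := hg.bound
  exact ⟨h, q, hq, fun γ => (hfg γ).trans (h' γ)⟩

lemma add (hf : PB f) (hg : PB g) : PB fun γ => f γ + g γ := by
  obtain ⟨q, hq, h⟩ := hf.bound
  obtain ⟨q', hq', h'⟩ := hg.bound
  exact ⟨hf.pt.add hg.pt, _, hq.add hq', fun γ => Nat.add_le_add (h γ) (h' γ)⟩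

lemma mul (hf : PB f) (hg : PB g) : PB fun γ => f γ * g γ := by
  obtain ⟨q, hq, h⟩ := hf.bound
  obtain ⟨q', hq', h'⟩ := hg.bound
  exact ⟨hf.pt.mul hg.pt, _, hq.mul hq', fun γ => Nat.mul_le_mul (h γ) (h' γ)⟩

lemma pow (hf : PB f) (c : ℕ) : PB fun γ => f γ ^ c := by
  obtain ⟨q, hq, h⟩ := hf.bound
  exact ⟨hf.pt.pow (.const c), _, hq.pow c, fun γ => Nat.pow_le_pow_left (h γ) c⟩

lemma min (hf : PT f) (hg : PB g) : PB fun γ => min (f γ) (g γ) := by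
  refine of_le ?_ hg fun γ => min_le_right ..
  simpa only [min_def] using PTD.ite (PTD.le hf hg.pt) hf hg.pt

/-- A power whose exponent is bounded by a constant. -/
lemma pow_min (hf : PB f) (hg : PT g) (c : ℕ) : PB fun γ => f γ ^ Min.min (g γ) c := by
  refine of_le (hf.pt.pow (.min hg (.const c))) ((hf.add (.const 1)).pow c) fun γ => ?_
  exact (Nat.pow_le_pow_left (by lia) _).trans (Nat.pow_le_pow_right (by lia) (min_le_right ..))

/-- The number of rounds in which a property holds. -/
lemma count {P : Γ → ℕ → Prop} {_ : ∀ γ i, Decidable (P γ i)} (hc : PB c)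
    (h : PTD fun γ : Γ × ℕ => P γ.1 γ.2) :
    PB fun γ => ∑ i ∈ Finset.range (c γ), if P γ i then 1 else 0 := by
  refine of_le (PT.sum hc (g := fun γ i => if P γ i then 1 else 0)
    (PTD.ite h (.const 1) (.const 0))) hc fun γ => ?_
  simpa using Finset.card_filter_le (Finset.range (c γ)) (P γ)

end PB

/-! ### Tables encoded by numbers -/

/-- The digit with index `i` of `c` in base `b`. The index is cut off at `M`, so that the power of
`b` has a bounded exponent for all indices. -/
def dig (b M c i : ℕ) : ℕ := c / b ^ min i M % b

/-- The number with the digits `f i` for `i < M` in base `b`. -/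
def undig (b M : ℕ) (f : ℕ → ℕ) : ℕ := ∑ i ∈ Finset.range M, f i * b ^ i

lemma undig_lt {b M : ℕ} {f : ℕ → ℕ} (hf : ∀ i < M, f i < b) : undig b M f < b ^ M := by
  induction M with
  | zero => simp [undig]
  | succ M ih =>
    have h := ih fun i hi => hf i (by lia)
    have h' := Nat.mul_le_mul_right (b ^ M) (hf M (by lia))
    rw [undig, Finset.sum_range_succ, ← undig, pow_succ']
    rw [Nat.succ_mul] at h'
    lia

lemma dig_lt {b : ℕ} (M c i : ℕ) (hb : 0 < b) : dig b M c i < b := Nat.mod_lt _ hb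

lemma dig_undig {b M i : ℕ} {f : ℕ → ℕ} (hf : ∀ i < M, f i < b) (hi : i < M) :
    dig b M (undig b M f) i = f i := by
  have hb : 0 < b := by have := hf i hi; lia
  rw [dig, min_eq_left hi.le]
  obtain ⟨j, rfl⟩ : ∃ j, M = i + 1 + j := ⟨M - (i + 1), by lia⟩
  have h : undig b (i + 1 + j) f =
      undig b i f + (f i + undig b j (fun l => f (i + 1 + l)) * b) * b ^ i := by
    simp only [undig, Finset.sum_range_add, Finset.sum_range_succ, Finset.sum_mul, add_mul,
      ← add_assoc]
    congr 1
    exact Finset.sum_congr rfl fun l _ => by ring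
  rw [h, Nat.add_mul_div_right _ _ (by positivity),
    Nat.div_eq_of_lt (undig_lt fun l hl => hf l (by lia)), zero_add, Nat.add_mul_mod_self_right,
    Nat.mod_eq_of_lt (hf i hi)]

/-- The table with `M` entries of `l` bits, after `j` rounds. It starts with zeros, and a round
replaces the table `T` by the entries `s T i`. -/
def tab (l M : ℕ) (s : ℕ → ℕ → ℕ) : ℕ → ℕ
  | 0 => 0
  | j + 1 => undig (2 ^ l) M fun i => s (tab l M s j) i % 2 ^ l

/-- An entry of the table `T` with `M` entries of `l` bits. -/
def entry (l M T i : ℕ) : ℕ := dig (2 ^ l) M T i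

lemma entry_tab_zero (l M : ℕ) (s : ℕ → ℕ → ℕ) (i : ℕ) : entry l M (tab l M s 0) i = 0 := by
  simp [entry, tab, dig]

lemma entry_tab_succ (l M : ℕ) (s : ℕ → ℕ → ℕ) (j : ℕ) {i : ℕ} (hi : i < M) :
    entry l M (tab l M s (j + 1)) i = s (tab l M s j) i % 2 ^ l :=
  dig_undig (fun _ _ => Nat.mod_lt _ (by positivity)) hi

namespace PT

lemma dig {b M c i : Γ → ℕ} (hb : PT b) (hM : PB M) (hc : PT c) (hi : PT i) :
    PT fun γ => dig (b γ) (M γ) (c γ) (i γ) :=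
  (hc.div (hb.pow (.min hi hM))).mod hb

lemma undig {b M : Γ → ℕ} {f : Γ → ℕ → ℕ} (hb : PT b) (hM : PB M)
    (hf : PT fun γ : Γ × ℕ => f γ.1 γ.2) : PT fun γ => undig (b γ) (M γ) (f γ) := by
  have h : PT fun γ => ∑ i ∈ Finset.range (M γ), f γ i * b γ ^ min i (M γ) :=
    sum hM (hf.mul (hb.wk.pow (.min snd hM.wk)))
  refine cast ?_ h
  congr with γ
  refine Finset.sum_congr rfl fun i hi => ?_
  rw [min_eq_left (Finset.mem_range.1 hi).le]

lemma entry {l M T i : Γ → ℕ} (hl : PB l) (hM : PB M) (hT : PT T) (hi : PT i) :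
    PT fun γ => entry (l γ) (M γ) (T γ) (i γ) :=
  dig ((PT.const 2).pow hl) hM hT hi

/-- A table of polynomially many entries of polynomially many bits can be stored in one number. -/
lemma tab {l M c : Γ → ℕ} {s : Γ → ℕ → ℕ → ℕ} (hl : PB l) (hM : PB M) (hc : PB c)
    (hs : PT fun γ : (Γ × ℕ) × ℕ => s γ.1.1 γ.1.2 γ.2) :
    PT fun γ => tab (l γ) (M γ) (s γ) (c γ) := by
  obtain ⟨ql, hql, hlq⟩ := hl.exists_bound
  obtain ⟨qM, hqM, hMq⟩ := hM.exists_bound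
  have key (γ : Γ) (j : ℕ) : RAM.tab (l γ) (M γ) (s γ) j =
      RAM.iter (fun _ T => RAM.undig (2 ^ l γ) (M γ) fun i => s γ T i % 2 ^ l γ) 0 j := by
    induction j with
    | zero => rfl
    | succ j ih => rw [RAM.tab, ih, RAM.iter]
  have hlt (γ : Γ) (j : ℕ) : RAM.tab (l γ) (M γ) (s γ) j < 2 ^ (l γ * M γ) := by
    cases j with
    | zero => exact Nat.pow_pos (by lia)
    | succ j =>
      rw [pow_mul]
      exact undig_lt fun i _ => Nat.mod_lt _ (by positivity)
  simp only [key]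
  have hs' : PT fun γ : ((Γ × ℕ) × ℕ) × ℕ => s γ.1.1.1 γ.1.2 γ.2 :=
    hs.ren (π := fun γ : ((Γ × ℕ) × ℕ) × ℕ => ((γ.1.1.1, γ.1.2), γ.2))
      (σ := fun | none => none | some none => some none | some (some i) => some (some (some i)))
      ⟨fun _ => rfl, by rintro (_ | _ | i) δ <;> rfl⟩
  refine iter hc (.const 0)
    (s := fun γ _ T => RAM.undig (2 ^ l γ) (M γ) fun i => s γ T i % 2 ^ l γ)
    (undig ((PT.const 2).pow hl.wk.wk) hM.wk.wk (hs'.mod ((PT.const 2).pow hl.wk.wk.wk)))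
    (hql.mul hqM) fun γ L hb j _ => ?_
  rw [← key, Nat.size_le]
  exact (hlt γ j).trans_le (Nat.pow_le_pow_right (by lia)
    (Nat.mul_le_mul (hlq γ L hb) (hMq γ L hb)))

end PT

end RAM

/-! ### Connected components of the complement of a separator -/

namespace SimpleGraph

variable {V : Type*} [Fintype V] (G : SimpleGraph V)

open Classical in
/-- The vertices outside `S` that are reached from `v` by a walk outside `S` with fewer than `j`
edges. -/
noncomputable def reach (S : Finset V) (v : V) : ℕ → Finset V
  | 0 => ∅
  | j + 1 => {u | u ∉ S ∧ (u = v ∨ ∃ w ∈ reach S v j, G.Adj w u)}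

/-- The connected component of `v` in the graph without the vertices in `S`; it is empty if
`v ∈ S`. -/
noncomputable def comp (S : Finset V) (v : V) : Finset V := G.reach S v (Fintype.card V)

open Classical in
/-- The neighbours of `C` outside `C`. -/
noncomputable def bdry (C : Finset V) : Finset V := {z | z ∉ C ∧ ∃ w ∈ C, G.Adj w z}

variable {G} {S C X : Finset V} {u v w z : V}

lemma mem_reach_succ {j : ℕ} :
    u ∈ G.reach S v (j + 1) ↔ u ∉ S ∧ (u = v ∨ ∃ w ∈ G.reach S v j, G.Adj w u) := by
  simp [reach]

lemma mem_bdry : z ∈ G.bdry C ↔ z ∉ C ∧ ∃ w ∈ C, G.Adj w z := by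
  simp [bdry]

lemma reach_subset_succ (j : ℕ) : G.reach S v j ⊆ G.reach S v (j + 1) := by
  induction j with
  | zero => simp [reach]
  | succ j ih =>
    intro u hu
    rw [mem_reach_succ] at hu ⊢
    exact ⟨hu.1, hu.2.imp id fun ⟨w, hw, h⟩ => ⟨w, ih hw, h⟩⟩

/-- The sets of reached vertices stabilise, since there are only `Fintype.card V` vertices. -/
lemma reach_card_succ : G.reach S v (Fintype.card V + 1) = G.comp S v := by
  have hmono : Monotone (G.reach S v) := monotone_nat_of_le_succ reach_subset_succ
  have h := Nat.stabilises_of_monotone (f := fun j => (G.reach S v j).card)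
    (b := Fintype.card V) (n := Fintype.card V + 1) (fun a b hab => Finset.card_le_card (hmono hab))
    (fun j => Finset.card_le_univ _) (fun j hj => by
      have := Finset.eq_of_subset_of_card_le (G.reach_subset_succ (S := S) (v := v) j) hj.ge
      have h' : G.reach S v (j + 1) = G.reach S v (j + 2) := by
        rw [reach, this]
        rfl
      exact congrArg Finset.card h') (by lia)
  exact (Finset.eq_of_subset_of_card_le (reach_subset_succ _) h.le).symm

lemma mem_comp : u ∈ G.comp S v ↔ u ∉ S ∧ (u = v ∨ ∃ w ∈ G.comp S v, G.Adj w u) := by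
  rw [← reach_card_succ, mem_reach_succ, reach_card_succ]
  rfl

lemma notMem_of_mem_comp (h : u ∈ G.comp S v) : u ∉ S := (mem_comp.1 h).1

lemma mem_comp_self (hv : v ∉ S) : v ∈ G.comp S v := mem_comp.2 ⟨hv, .inl rfl⟩

lemma mem_comp_of_adj (hw : w ∈ G.comp S v) (h : G.Adj w u) (hu : u ∉ S) : u ∈ G.comp S v :=
  mem_comp.2 ⟨hu, .inr ⟨w, hw, h⟩⟩

lemma comp_induction {P : V → Prop} (h₀ : v ∉ S → P v)
    (h : ∀ w ∈ G.comp S v, P w → ∀ u, G.Adj w u → u ∉ S → P u) (hu : u ∈ G.comp S v) : P u := by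
  suffices ∀ j, ∀ u ∈ G.reach S v j, u ∈ G.comp S v → P u from this _ u hu hu
  intro j
  induction j with
  | zero => simp [reach]
  | succ j ih =>
    intro u hu hu'
    obtain ⟨hS, rfl | ⟨w, hw, hwu⟩⟩ := mem_reach_succ.1 hu
    · exact h₀ hS
    · have hw' : w ∈ G.comp S v := by
        have hmono : Monotone (G.reach S v) := monotone_nat_of_le_succ reach_subset_succ
        rw [← reach_card_succ]
        by_cases hj : j ≤ Fintype.card V + 1
        · exact hmono hj hw
        · have hj' : G.reach S v j = G.comp S v := by
            obtain ⟨i, rfl⟩ : ∃ i, j = Fintype.card V + i := ⟨j - Fintype.card V, by lia⟩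
            clear * -
            induction i with
            | zero => rfl
            | succ i ih =>
              rw [← add_assoc, reach, ih]
              exact reach_card_succ (G := G)
          rw [reach_card_succ, ← hj']
          exact hw
      exact h w hw' (ih w hw hw') u hwu hS

lemma comp_subset (hv : v ∈ X) (hX : G.bdry X ⊆ S) : G.comp S v ⊆ X := fun u hu =>
  comp_induction (P := (· ∈ X)) (fun _ => hv) (fun w _ hw u hwu hu => by
    by_contra h
    exact hu (hX (mem_bdry.2 ⟨h, w, hw, hwu⟩))) hu

lemma bdry_comp_subset : G.bdry (G.comp S v) ⊆ S := fun z hz => by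
  obtain ⟨hz, w, hw, hwz⟩ := mem_bdry.1 hz
  by_contra h
  exact hz (mem_comp_of_adj hw hwz h)

lemma comp_subset_of_mem (hu : u ∈ G.comp S v) : G.comp S u ⊆ G.comp S v :=
  comp_subset hu bdry_comp_subset

lemma mem_comp_symm (hu : u ∈ G.comp S v) : v ∈ G.comp S u :=
  comp_induction (P := fun u => v ∈ G.comp S u) mem_comp_self (fun w hw hvw u hwu hu => by
    have : w ∈ G.comp S u := mem_comp_of_adj (mem_comp_self hu) hwu.symm (notMem_of_mem_comp hw)
    exact comp_subset_of_mem this hvw) hu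

/-- The boundary of a component of a set `X` that is separated by `S` belongs to the boundary
of `X`. -/
lemma bdry_comp_subset_bdry (hv : v ∈ X) (hX : G.bdry X ⊆ S) (hXS : Disjoint X S) :
    G.bdry (G.comp S v) ⊆ G.bdry X := fun z hz => by
  obtain ⟨h, w, hw, hwz⟩ := mem_bdry.1 hz
  refine mem_bdry.2 ⟨fun hzX => ?_, w, comp_subset hv hX hw, hwz⟩
  exact Finset.disjoint_left.1 hXS hzX (bdry_comp_subset hz)

end SimpleGraph

/-! ### Subtrees of a tree -/

namespace SimpleGraph

variable {N : Type*} {T : SimpleGraph N}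

/-- There is a walk from `x` to `y` inside `s`. -/
def Joined (T : SimpleGraph N) (s : Set N) (x y : N) : Prop :=
  ∃ p : T.Walk x y, ∀ z ∈ p.support, z ∈ s

lemma Joined.trans {s : Set N} {x y z : N} (h : T.Joined s x y) (h' : T.Joined s y z) :
    T.Joined s x z := by
  obtain ⟨p, hp⟩ := h
  obtain ⟨q, hq⟩ := h'
  exact ⟨p.append q, fun a ha => ((Walk.mem_support_append_iff ..).1 ha).elim (hp a) (hq a)⟩

lemma Joined.symm {s : Set N} {x y : N} (h : T.Joined s x y) : T.Joined s y x := by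
  obtain ⟨p, hp⟩ := h
  exact ⟨p.reverse, by simpa using hp⟩

lemma Joined.mono {s s' : Set N} {x y : N} (h : T.Joined s x y) (hs : s ⊆ s') : T.Joined s' x y :=
  h.imp fun _ hp z hz => hs (hp z hz)

lemma Connected.joined {s : Set N} (h : (T.induce s).Connected) {x y : N} (hx : x ∈ s)
    (hy : y ∈ s) : T.Joined s x y := by
  obtain ⟨p⟩ := h.preconnected ⟨x, hx⟩ ⟨y, hy⟩
  refine ⟨p.map (Embedding.induce s).toHom, fun z hz => ?_⟩
  obtain ⟨a, -, rfl⟩ := List.mem_map.1 ((Walk.support_map ..) ▸ hz)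
  exact a.2

/-- A subtree `A` of a tree has a gate with respect to each node `u`: every connected set that
contains `u` and meets `A` contains the gate. -/
lemma IsTree.exists_gate (hT : T.IsTree) {A : Set N} (hA : A.Nonempty)
    (hA' : ∀ x ∈ A, ∀ y ∈ A, T.Joined A x y) (u : N) :
    ∃ g ∈ A, ∀ s : Set N, ∀ x ∈ A, T.Joined s u x → g ∈ s := by
  classical
  obtain ⟨g, hg, hmin⟩ := WellFounded.has_min (measure (T.dist u)).wf A hA
  refine ⟨g, hg, fun s x hx hs => ?_⟩
  obtain ⟨p, hp⟩ := hT.connected.exists_walk_length_eq_dist u g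
  have hpA : ∀ z ∈ p.support, z ∈ A → z = g := fun z hz hzA => by
    by_contra hne
    refine hmin z hzA ((T.dist_le (p.takeUntil z hz)).trans_lt ?_)
    rw [← hp]
    exact p.length_takeUntil_lt_length hz hne
  obtain ⟨q, hq⟩ := hA' g hg x hx
  obtain ⟨r, hr⟩ := hs
  have hpath : (p.append q.bypass).IsPath := by
    rw [Walk.isPath_def, Walk.support_append]
    have hq' := q.bypass_isPath.support_nodup
    rw [← Walk.cons_tail_support, List.nodup_cons] at hq'
    refine (p.isPath_of_length_eq_dist hp).support_nodup.append hq'.2 fun z hz hz' => ?_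
    have hzA := hq z (q.support_bypass_subset_support (List.mem_of_mem_tail hz'))
    rw [hpA z hz hzA] at hz'
    exact hq'.1 hz'
  have h : p.append q.bypass = r.bypass := congrArg Subtype.val
    ((hT.isAcyclic.subsingleton_path u x).elim ⟨_, hpath⟩ ⟨_, r.bypass_isPath⟩)
  refine hr g (r.support_bypass_subset_support ?_)
  rw [← h]
  exact (Walk.mem_support_append_iff ..).2 (.inl p.end_mem_support)

end SimpleGraph

namespace TreeDecomposition

variable {V : Type*} [Fintype V] {G : SimpleGraph V}

/-- If the neighbours of a component `C` belong to a bag, then they belong to a bag that contains a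
vertex of `C`, too: the nodes whose bags meet `C` form a subtree, and its gate is such a node. -/
lemma exists_bag (T : TreeDecomposition G) {S : Finset V} {v : V} (hv : v ∉ S) {u : T.Node}
    (hu : ∀ z ∈ G.bdry (G.comp S v), z ∈ T.bag u) :
    ∃ g, ∃ w ∈ G.comp S v, w ∈ T.bag g ∧ ∀ z ∈ G.bdry (G.comp S v), z ∈ T.bag g := by
  set C := G.comp S v
  let A : Set T.Node := {x | ∃ w ∈ C, w ∈ T.bag x}
  have hbag (a : V) {x y : T.Node} (hx : a ∈ T.bag x) (hy : a ∈ T.bag y) :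
      T.tree.Joined {x | a ∈ T.bag x} x y := (T.connected_bag a).joined hx hy
  have hsub (a : V) (ha : a ∈ C) : {x | a ∈ T.bag x} ⊆ A := fun x hx => ⟨a, ha, hx⟩
  obtain ⟨x₀, hx₀⟩ := T.exists_mem_bag v
  have hjoin : ∀ w ∈ C, ∀ x, w ∈ T.bag x → T.tree.Joined A x₀ x := fun w hw =>
    SimpleGraph.comp_induction (P := fun w => ∀ x, w ∈ T.bag x → T.tree.Joined A x₀ x)
      (fun _ x hx => (hbag v hx₀ hx).mono (hsub v (SimpleGraph.mem_comp_self hv)))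
      (fun a ha hP b hab hb x hx => by
        obtain ⟨y, hya, hyb⟩ := T.exists_edge_bag a b hab
        exact (hP y hya).trans
          ((hbag b hyb hx).mono (hsub b (SimpleGraph.mem_comp_of_adj ha hab hb)))) hw
  obtain ⟨g, ⟨w, hw, hwg⟩, hg⟩ := T.isTree.exists_gate (A := A)
    ⟨x₀, v, SimpleGraph.mem_comp_self hv, hx₀⟩ (fun x ⟨a, ha, hax⟩ y ⟨b, hb, hby⟩ =>
      (hjoin a ha x hax).symm.trans (hjoin b hb y hby)) u
  refine ⟨g, w, hw, hwg, fun z hz => ?_⟩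
  obtain ⟨-, a, ha, haz⟩ := SimpleGraph.mem_bdry.1 hz
  obtain ⟨y, hya, hyz⟩ := T.exists_edge_bag a z haz
  exact hg {x | z ∈ T.bag x} y ⟨a, ha, hya⟩ (hbag z (hu z hz) hyz)

end TreeDecomposition

/-- A graph of treewidth at most `t` has a tree decomposition with bags of size at most `t + 1`. -/
lemma exists_treeDecomposition {V : Type*} {G : SimpleGraph V} {t : ℕ} (h : treewidth G ≤ t) :
    ∃ T : TreeDecomposition G, ∀ u, (T.bag u).encard ≤ t + 1 := by
  have h' : treewidth G < (t + 1 : ℕ) := h.trans_lt (by exact_mod_cast Nat.lt_succ_self t)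
  obtain ⟨T, hT⟩ := iInf_lt_iff.1 h'
  have hT' : T.width ≤ t := by
    rw [Nat.cast_add, Nat.cast_one] at hT
    exact Order.le_of_lt_add_one hT
  exact ⟨T, fun u => (le_iSup (fun u => (T.bag u).encard) u).trans (tsub_le_iff_right.1 hT')⟩

/-! ### Partition functions -/

section PartitionFunction

variable {V : Type*} [Fintype V] [DecidableEq V] {G : SimpleGraph V}
  (Φ : V → V → ℕ → ℕ → ℕ) (D : ℕ)

/-- The labellings that coincide with `lam` outside `C` and have labels less than `D` in `C`. -/
def labellings (C : Finset V) (lam : V → ℕ) : Finset (V → ℕ) :=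
  Fintype.piFinset fun u => if u ∈ C then Finset.range D else {lam u}

/-- The sum over all labellings of `C`, with `lam` as the labelling of the other vertices, of the
product of the weights of all pairs of vertices that meet `C`. -/
def val (C : Finset V) (lam : V → ℕ) : ℕ :=
  ∑ l ∈ labellings D C lam, ∏ u, ∏ v, if u ∈ C ∨ v ∈ C then Φ u v (l u) (l v) else 1

/-- The contribution of a vertex `w` of `C` with label `x`. -/
def wt (C : Finset V) (lam : V → ℕ) (w : V) (x : ℕ) : ℕ :=
  Φ w w x x * ∏ u, if u ∈ C then 1 else Φ w u x (lam u) * Φ u w (lam u) x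

lemma val_empty (lam : V → ℕ) : val Φ D ∅ lam = 1 := by
  simp [val, labellings]

/-- The recursion of the dynamic program: the label of one vertex of `C` is fixed. -/
lemma val_eq_sum {C : Finset V} {w : V} (hw : w ∈ C) (lam : V → ℕ) :
    val Φ D C lam = ∑ x ∈ Finset.range D,
      wt Φ C lam w x * val Φ D (C.erase w) (Function.update lam w x) := by
  have hfib (x : ℕ) (hx : x ∈ Finset.range D) : (labellings D C lam).filter (fun l => l w = x) =
      labellings D (C.erase w) (Function.update lam w x) := by
    ext l
    simp only [labellings, Finset.mem_filter, Fintype.mem_piFinset]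
    constructor
    · rintro ⟨h, hl⟩ u
      by_cases hu : u = w
      · subst hu
        simp [hl]
      · simpa [hu] using h u
    · intro h
      have hl : l w = x := by simpa using h w
      refine ⟨fun u => ?_, hl⟩
      by_cases hu : u = w
      · subst hu
        simpa [hw, hl] using hx
      · simpa [hu] using h u
  rw [val, ← Finset.sum_fiberwise_of_maps_to (t := Finset.range D) (g := fun l => l w)
    (fun l hl => by simpa [hw] using Fintype.mem_piFinset.1 hl w)]
  refine Finset.sum_congr rfl fun x hx => ?_
  rw [hfib x hx, val, Finset.mul_sum]
  refine Finset.sum_congr rfl fun l hl => ?_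
  have hl' (u : V) (hu : u ∉ C) : l u = lam u := by
    have hne : u ≠ w := fun h => hu (h ▸ hw)
    simpa [hu, hne] using Fintype.mem_piFinset.1 hl u
  have hlw : l w = x := by simpa using Fintype.mem_piFinset.1 hl w
  -- each pair is either a pair of the smaller set, or the pair `(w, w)`, or a pair that joins `w`
  -- and a vertex outside `C`
  have hsplit (u v : V) : (if u ∈ C ∨ v ∈ C then Φ u v (l u) (l v) else 1) =
      ((if u = w then if v = w then Φ w w x x else 1 else 1) *
        ((if u = w then if v ∈ C then 1 else Φ w v x (lam v) else 1) *
          (if v = w then if u ∈ C then 1 else Φ u w (lam u) x else 1))) *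
      if u ∈ C.erase w ∨ v ∈ C.erase w then Φ u v (l u) (l v) else 1 := by
    have h1 := hl' u
    have h2 := hl' v
    by_cases hu : u = w <;> by_cases hv : v = w <;> by_cases huC : u ∈ C <;>
      by_cases hvC : v ∈ C <;> simp_all
  simp only [hsplit, Finset.prod_mul_distrib]
  congr 1
  simp only [wt, Finset.prod_ite_irrel, Finset.prod_const_one, Finset.prod_ite_eq',
    Finset.mem_univ, if_true]
  congr 1
  rw [← Finset.prod_mul_distrib]
  exact Finset.prod_congr rfl fun u _ => by split_ifs <;> simp

variable {Φ} {D} (hΦ : ∀ u v, u ≠ v → ¬ G.Adj u v → ∀ x y, Φ u v x y = 1)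
include hΦ

lemma wt_congr {C C' : Finset V} {lam lam' : V → ℕ} {w : V} (hw : w ∈ C) (hw' : w ∈ C')
    (hC : ∀ u, G.Adj w u → (u ∈ C ↔ u ∈ C')) (h : ∀ u ∈ G.bdry C, lam u = lam' u) (x : ℕ) :
    wt Φ C lam w x = wt Φ C' lam' w x := by
  unfold wt
  congr 1
  refine Finset.prod_congr rfl fun u _ => ?_
  by_cases hwu : G.Adj w u
  · by_cases hu : u ∈ C
    · simp [hu, (hC u hwu).1 hu]
    · simp [hu, mt (hC u hwu).2 hu, h u (SimpleGraph.mem_bdry.2 ⟨hu, w, hw, hwu⟩)]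
  · by_cases hu : u = w
    · simp [hu, hw, hw']
    · have h1 := hΦ w u (Ne.symm hu) hwu
      have h2 := hΦ u w hu (fun h => hwu h.symm)
      simp [h1, h2]

/-- If only adjacent vertices interact, then the value of `C` depends only on the labels of the
neighbours of `C`. -/
lemma val_congr (C : Finset V) {lam lam' : V → ℕ} (h : ∀ u ∈ G.bdry C, lam u = lam' u) :
    val Φ D C lam = val Φ D C lam' := by
  induction C using Finset.strongInduction generalizing lam lam' with
  | H C ih =>
    obtain rfl | ⟨w, hw⟩ := C.eq_empty_or_nonempty
    · simp [val_empty]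
    · rw [val_eq_sum Φ D hw, val_eq_sum Φ D hw]
      refine Finset.sum_congr rfl fun x _ => ?_
      rw [wt_congr hΦ hw hw (fun _ _ => Iff.rfl) h, ih _ (Finset.erase_ssubset hw) fun u hu => ?_]
      obtain rfl | hne := eq_or_ne u w
      · simp
      · obtain ⟨hu1, a, ha, hau⟩ := SimpleGraph.mem_bdry.1 hu
        rw [Function.update_of_ne hne, Function.update_of_ne hne]
        refine h u (SimpleGraph.mem_bdry.2 ⟨fun hu' => hu1 (Finset.mem_erase.2 ⟨hne, hu'⟩), a,
          Finset.mem_of_mem_erase ha, hau⟩)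

/-- If only adjacent vertices interact, then the value is multiplicative. -/
lemma val_union {C₁ C₂ : Finset V} (hd : Disjoint C₁ C₂)
    (hadj : ∀ u ∈ C₁, ∀ v ∈ C₂, ¬ G.Adj u v) (lam : V → ℕ) :
    val Φ D (C₁ ∪ C₂) lam = val Φ D C₁ lam * val Φ D C₂ lam := by
  induction C₁ using Finset.strongInduction generalizing lam with
  | H C₁ ih =>
    obtain rfl | ⟨w, hw⟩ := C₁.eq_empty_or_nonempty
    · simp [val_empty]
    · have hw2 : w ∉ C₂ := Finset.disjoint_left.1 hd hw
      rw [val_eq_sum Φ D (Finset.mem_union_left _ hw), val_eq_sum Φ D hw, Finset.sum_mul]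
      refine Finset.sum_congr rfl fun x _ => ?_
      have herase : (C₁ ∪ C₂).erase w = C₁.erase w ∪ C₂ := by
        rw [Finset.erase_union_distrib, Finset.erase_eq_of_notMem hw2]
      rw [herase, ih _ (Finset.erase_ssubset hw) (hd.mono_left (Finset.erase_subset ..))
        (fun u hu => hadj u (Finset.mem_of_mem_erase hu)), mul_assoc,
        wt_congr hΦ (C' := C₁) (lam' := lam) (Finset.mem_union_left _ hw) hw
          (fun u hwu => by simpa using fun hu => absurd hwu (hadj w hw u hu)) (fun _ _ => rfl),
        val_congr hΦ C₂ (lam := Function.update lam w x) (lam' := lam) fun u hu => ?_]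
      obtain ⟨-, a, ha, hau⟩ := SimpleGraph.mem_bdry.1 hu
      rw [Function.update_of_ne]
      rintro rfl
      exact hadj u hw a ha hau.symm

end PartitionFunction

/-! ### The instance and the weights as functions of the input memory -/

namespace Seating

open RAM

section Defs

variable (k d : ℕ) (M : Memory)

/-- The number of agents, and of seats. -/
def size : ℕ := M.nat 0 0

/-- The seats `u` and `v` are adjacent. -/
def adj (u v : ℕ) : Prop := u < size M ∧ v < size M ∧ M.nat 1 (u * size M + v) ≠ 0

/-- The refined class of agent `a`: the first agent of each class forms a class of its own. The
refined classes of the class with number `i` have the numbers `2 * i` and `2 * i + 1`. -/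
noncomputable def cls (a : ℕ) : ℕ :=
  open Classical in
  2 * M.nat 2 a + if ∃ b < size M, b < a ∧ M.nat 2 b = M.nat 2 a then 1 else 0

/-- The degree of the seat `u`. -/
noncomputable def deg (u : ℕ) : ℕ :=
  open Classical in ∑ w ∈ Finset.range (size M), if adj M u w then 1 else 0

/-- The number of neighbours of the seat `u` that are smaller than `v`. -/
noncomputable def nbrIdx (u v : ℕ) : ℕ :=
  open Classical in ∑ w ∈ Finset.range (size M), if w < v ∧ adj M u w then 1 else 0

/-- The number of labels. A label of a seat is a number with `d + 1` digits in base `2 * k + 1`. The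
digit with index `0` is the refined class of the agent on this seat. The digit with index `i + 1` is
the refined class of the agent on the neighbour with index `i`, and `2 * k` if there is no such
neighbour. -/
def numLabels : ℕ := (2 * k + 1) ^ (d + 1)

/-- A digit of a label. -/
def labDig (x i : ℕ) : ℕ := dig (2 * k + 1) (d + 1) x i

/-- The digits of the label `x` are in the right range for the seat `u`. -/
def LabelOK (u x : ℕ) : Prop :=
  labDig k d x 0 < 2 * k ∧ ∀ i < d, deg M u ≤ i → labDig k d x (i + 1) = 2 * k

/-- The number of statistics of a labelling: the number of occurrences of each label, and the number
of adjacent pairs with each pair of labels. -/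
def numStats : ℕ := numLabels k d + numLabels k d * numLabels k d

/-- The base in which the statistics are encoded. -/
def statBase : ℕ := size M * size M + 1

/-- The binary logarithm of the variable of the generating function of the statistics. The variable
exceeds the number of all assignments of classes to the seats, so that the coefficients are digits
of the value of the function. -/
def logVar : ℕ := numLabels k d * size M + 1

/-- The variable of the generating function of the statistics. -/
def genVar : ℕ := 2 ^ logVar k d M

/-- The factor that counts one unit of the statistic with index `j`: the exponent of the variable of
the generating function is the code of the statistics. The cut-off of `j` bounds the exponent for
arguments that are not indices of statistics. -/
def unitStat (j : ℕ) : ℕ := genVar k d M ^ statBase M ^ min j (numStats k d)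

/-- The weight of the pair of the seats `u` and `v` with the labels `x` and `y`. It is `0` if the
labels contradict each other or the graph, so that only the labellings that come from an assignment
of classes to the seats contribute to the partition function. -/
noncomputable def weight (u v x y : ℕ) : ℕ :=
  open Classical in
  if u = v then if LabelOK k d M u x then unitStat k d M x else 0
  else if adj M u v then
    if labDig k d x (nbrIdx M u v + 1) = labDig k d y 0 then
      unitStat k d M (numLabels k d + x * numLabels k d + y) else 0
  else 1

end Defs

section Poly

variable {k d : ℕ} {Γ : Type} [Ctx Γ] {M : Γ → Memory} {u v x y i : Γ → ℕ}

/-- The function `M` is the input memory. -/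
def IsMem (M : Γ → Memory) : Prop := ∀ γ, M γ = Ctx.mem γ

lemma IsMem.wk (hM : IsMem M) : IsMem fun γ : Γ × ℕ => M γ.1 := fun γ => hM γ.1

lemma IsMem.read (hM : IsMem M) {x : ℕ} (hx : x < 3) (hu : PT u) :
    PT fun γ => (M γ).nat x (u γ) := by
  obtain rfl : M = Ctx.mem := funext hM
  exact PT.read hx hu

lemma IsMem.size (hM : IsMem M) : PB fun γ => size (M γ) :=
  ⟨hM.read (by lia) (.const 0), _, .id, fun γ => by rw [← hM]; rfl⟩

lemma IsMem.adj (hM : IsMem M) (hu : PT u) (hv : PT v) : PTD fun γ => adj (M γ) (u γ) (v γ) :=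
  have hn := hM.size.pt
  (PTD.lt hu hn).and ((PTD.lt hv hn).and
    (PTD.ne (hM.read (by lia) ((hu.mul hn).add hv)) (.const 0)))

lemma IsMem.cls (hM : IsMem M) (hu : PT u) : PT fun γ => cls (M γ) (u γ) :=
  ((PT.const 2).mul (hM.read (by lia) hu)).add
    (PTD.ite (.ex hM.size ((PTD.lt .snd hu.wk).and
      (.eq (hM.wk.read (by lia) .snd) (hM.wk.read (by lia) hu.wk)))) (.const 1) (.const 0))

lemma IsMem.deg (hM : IsMem M) (hu : PT u) : PB fun γ => deg (M γ) (u γ) :=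
  PB.count hM.size (hM.wk.adj hu.wk .snd)

lemma IsMem.nbrIdx (hM : IsMem M) (hu : PT u) (hv : PT v) :
    PB fun γ => nbrIdx (M γ) (u γ) (v γ) :=
  PB.count hM.size ((PTD.lt .snd hv.wk).and (hM.wk.adj hu.wk .snd))

lemma _root_.RAM.PT.labDig (hx : PT x) (hi : PT i) : PT fun γ => labDig k d (x γ) (i γ) :=
  PT.dig (.const _) (.const _) hx hi

lemma IsMem.labelOK (hM : IsMem M) (hu : PT u) (hx : PT x) :
    PTD fun γ => LabelOK k d (M γ) (u γ) (x γ) :=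
  (PTD.lt (.labDig hx (.const 0)) (.const _)).and (PTD.all (.const d)
    ((PTD.le (hM.deg hu).pt.wk .snd).imp
      (.eq (.labDig hx.wk (PT.snd.add (.const 1))) (.const _))))

lemma IsMem.statBase (hM : IsMem M) : PB fun γ => statBase (M γ) :=
  (hM.size.mul hM.size).add (.const 1)

lemma IsMem.logVar (hM : IsMem M) : PB fun γ => logVar k d (M γ) :=
  ((PB.const _).mul hM.size).add (.const 1)

lemma IsMem.genVar (hM : IsMem M) : PT fun γ => genVar k d (M γ) := (PT.const 2).pow hM.logVar

lemma IsMem.unitStat (hM : IsMem M) (hx : PT x) : PT fun γ => unitStat k d (M γ) (x γ) :=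
  hM.genVar.pow (hM.statBase.pow_min hx _)

lemma IsMem.weight (hM : IsMem M) (hu : PT u) (hv : PT v) (hx : PT x) (hy : PT y) :
    PT fun γ => weight k d (M γ) (u γ) (v γ) (x γ) (y γ) :=
  PTD.ite (.eq hu hv) (PTD.ite (hM.labelOK hu hx) (hM.unitStat hx) (.const 0))
    (PTD.ite (hM.adj hu hv)
      (PTD.ite (.eq (.labDig hx ((hM.nbrIdx hu hv).pt.add (.const 1))) (.labDig hy (.const 0)))
        (hM.unitStat (((PT.const _).add (hx.mul (.const _))).add hy)) (.const 0)) (.const 1))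

end Poly

end Seating

/-! ### The dynamic program -/

namespace Seating

open RAM

section Defs

variable (k d t : ℕ) (M : Memory)

/-- The base in which boundaries are encoded. A boundary has `t + 1` slots. A slot is a digit `v * D
+ x`, where `D` is the number of labels; it holds the vertex `v` with the label `x`, and it is empty
if `v = n`. -/
def slotBase : ℕ := (size M + 1) * numLabels k d

/-- A slot of the boundary `c`. -/
def slot (c i : ℕ) : ℕ := dig (slotBase k d M) (t + 1) c i

/-- The vertex in a slot. -/
def slotVertex (c i : ℕ) : ℕ := slot k d t M c i / numLabels k d

/-- The label in a slot. -/
def slotLabel (c i : ℕ) : ℕ := slot k d t M c i % numLabels k d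

/-- The boundary obtained from `c` by writing `a` to the slot with index `i`. -/
def setSlot (c i a : ℕ) : ℕ :=
  undig (slotBase k d M) (t + 1) fun j => if j = i then a else slot k d t M c j

/-- The boundary with empty slots. -/
def noBoundary : ℕ := undig (slotBase k d M) (t + 1) fun _ => size M * numLabels k d

/-- The vertex `u` belongs to the boundary `c`. -/
def OnBoundary (c u : ℕ) : Prop := ∃ i < t + 1, slotVertex k d t M c i = u

/-- The label of the vertex `u` in the boundary `c`; it is `0` if `u` does not belong to `c`. -/
def boundaryLabel (c u : ℕ) : ℕ :=
  ∑ i ∈ Finset.range (t + 1), if slotVertex k d t M c i = u then slotLabel k d t M c i else 0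

/-- The characteristic function of the connected component of `v` in the graph without the boundary
`c`, computed by breadth-first search. -/
noncomputable def compTab (c v : ℕ) : ℕ :=
  open Classical in
  tab 1 (size M) (fun T u => if ¬ OnBoundary k d t M c u ∧
    (u = v ∨ ∃ w < size M, entry 1 (size M) T w = 1 ∧ adj M w u) then 1 else 0) (size M)

/-- The vertex `u` belongs to the component of `v` in the graph without the boundary `c`. -/
def InComp (c v u : ℕ) : Prop := entry 1 (size M) (compTab k d t M c v) u = 1

/-- The vertex `v` is the first vertex of its component. -/
def Leader (c v : ℕ) : Prop := ∀ u < size M, u < v → ¬ InComp k d t M c v u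

/-- The contribution of the vertex `w` with label `x` to the value of the component of `v`. -/
noncomputable def vertexWeight (c v w x : ℕ) : ℕ :=
  open Classical in
  weight k d M w w x x * ∏ u ∈ Finset.range (size M), if InComp k d t M c v u then 1 else
    weight k d M w u x (boundaryLabel k d t M c u) * weight k d M u w (boundaryLabel k d t M c u) x

/-- The number of entries of the table. -/
def tabSize : ℕ := slotBase k d M ^ (t + 1) * size M

/-- The bit length of the entries of the table. It suffices for the number of labellings times a
bound for the product of the weights of all pairs. -/
def logTab : ℕ := numLabels k d * size M +
  size M * size M * (logVar k d M * statBase M ^ numStats k d) + 2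

/-- The entry of the table `T` for the component of `v` in the graph without the boundary `c`. It is
`0` if the component is not solved, and otherwise the value of the component plus one. -/
def compEntry (T c v : ℕ) : ℕ := entry (logTab k d M) (tabSize k d t M) T (c * size M + v)

/-- The product of the values of the components that arise from the component of `v` by deleting
`w`, if the boundary becomes `c'`. -/
noncomputable def subProd (T c' c v w : ℕ) : ℕ :=
  open Classical in
  ∏ u ∈ Finset.range (size M), if InComp k d t M c v u ∧ u ≠ w ∧ Leader k d t M c' u then
    compEntry k d t M T c' u - 1 else 1

/-- The component of `v` can be solved by writing its vertex `w` to the slot with index `i`: the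
vertex in this slot is not adjacent to the component, and the components that arise by deleting `w`
are solved for all labels of `w`. -/
def Solves (T c v i w : ℕ) : Prop :=
  InComp k d t M c v w ∧
  (∀ z < size M, InComp k d t M c v z → ¬ adj M z (slotVertex k d t M c i)) ∧
  ∀ x < numLabels k d, ∀ u < size M, InComp k d t M c v u → u ≠ w →
    compEntry k d t M T (setSlot k d t M c i (w * numLabels k d + x)) u ≠ 0

/-- The value of the component of `v`, computed by writing `w` with all possible labels to the slot
with index `i`. -/
noncomputable def compValue (T c v i w : ℕ) : ℕ :=
  ∑ x ∈ Finset.range (numLabels k d), vertexWeight k d t M c v w x *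
    subProd k d t M T (setSlot k d t M c i (w * numLabels k d + x)) c v w

/-- An entry of the table of the next round. All pairs of a slot and a vertex that solve the
component give the same value, so that their average is this value. -/
noncomputable def nextEntry (T c v : ℕ) : ℕ :=
  open Classical in
  (∑ i ∈ Finset.range (t + 1), ∑ w ∈ Finset.range (size M),
    if Solves k d t M T c v i w then 1 + compValue k d t M T c v i w else 0) /
  (∑ i ∈ Finset.range (t + 1), ∑ w ∈ Finset.range (size M),
    if Solves k d t M T c v i w then 1 else 0)

/-- The table after `j` rounds. -/
noncomputable def compTable (j : ℕ) : ℕ :=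
  tab (logTab k d M) (tabSize k d t M)
    (fun T i => nextEntry k d t M T (i / size M) (i % size M)) j

/-- The partition function of the whole graph. In each round the component of a boundary loses at
least one vertex, so that `n` rounds suffice. -/
noncomputable def partitionFn : ℕ :=
  open Classical in
  ∏ u ∈ Finset.range (size M), if Leader k d t M (noBoundary k d t M) u then
    compEntry k d t M (compTable k d t M (size M)) (noBoundary k d t M) u - 1 else 1

end Defs

section Poly

variable {k d t : ℕ} {Γ : Type} [Ctx Γ] {M : Γ → Memory} {T c c' v w u x i a : Γ → ℕ}

lemma IsMem.slotBase (hM : IsMem M) : PB fun γ => slotBase k d (M γ) :=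
  (hM.size.add (.const 1)).mul (.const _)

lemma IsMem.slot (hM : IsMem M) (hc : PT c) (hi : PT i) :
    PT fun γ => slot k d t (M γ) (c γ) (i γ) :=
  PT.dig hM.slotBase.pt (.const _) hc hi

lemma IsMem.slotVertex (hM : IsMem M) (hc : PT c) (hi : PT i) :
    PT fun γ => slotVertex k d t (M γ) (c γ) (i γ) :=
  (hM.slot hc hi).div (.const _)

lemma IsMem.slotLabel (hM : IsMem M) (hc : PT c) (hi : PT i) :
    PT fun γ => slotLabel k d t (M γ) (c γ) (i γ) :=
  (hM.slot hc hi).mod (.const _)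

lemma IsMem.setSlot (hM : IsMem M) (hc : PT c) (hi : PT i) (ha : PT a) :
    PT fun γ => setSlot k d t (M γ) (c γ) (i γ) (a γ) :=
  PT.undig hM.slotBase.pt (.const _)
    (f := fun γ j => if j = i γ then a γ else Seating.slot k d t (M γ) (c γ) j)
    (PTD.ite (.eq .snd hi.wk) ha.wk (hM.wk.slot hc.wk .snd))

lemma IsMem.noBoundary (hM : IsMem M) : PT fun γ => noBoundary k d t (M γ) :=
  PT.undig hM.slotBase.pt (.const _) (f := fun γ _ => Seating.size (M γ) * numLabels k d)
    (hM.wk.size.pt.mul (.const _))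

lemma IsMem.onBoundary (hM : IsMem M) (hc : PT c) (hu : PT u) :
    PTD fun γ => OnBoundary k d t (M γ) (c γ) (u γ) :=
  PTD.ex (.const _) (.eq (hM.wk.slotVertex hc.wk .snd) hu.wk)

lemma IsMem.boundaryLabel (hM : IsMem M) (hc : PT c) (hu : PT u) :
    PT fun γ => boundaryLabel k d t (M γ) (c γ) (u γ) :=
  PT.sum (.const _) (g := fun γ i => if Seating.slotVertex k d t (M γ) (c γ) i = u γ then
      Seating.slotLabel k d t (M γ) (c γ) i else 0)
    (PTD.ite (.eq (hM.wk.slotVertex hc.wk .snd) hu.wk) (hM.wk.slotLabel hc.wk .snd) (.const 0))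

lemma IsMem.compTab (hM : IsMem M) (hc : PT c) (hv : PT v) :
    PT fun γ => compTab k d t (M γ) (c γ) (v γ) :=
  PT.tab (.const 1) hM.size hM.size (PTD.ite ((hM.wk.wk.onBoundary hc.wk.wk .snd).not.and
    ((PTD.eq .snd hv.wk.wk).or (.ex hM.wk.wk.size ((PTD.eq (.entry (.const 1) hM.wk.wk.wk.size
      PT.snd.wk.wk .snd) (.const 1)).and (hM.wk.wk.wk.adj .snd PT.snd.wk))))) (.const 1) (.const 0))

lemma IsMem.inComp (hM : IsMem M) (hc : PT c) (hv : PT v) (hu : PT u) :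
    PTD fun γ => InComp k d t (M γ) (c γ) (v γ) (u γ) :=
  PTD.eq (.entry (.const 1) hM.size (hM.compTab hc hv) hu) (.const 1)

lemma IsMem.leader (hM : IsMem M) (hc : PT c) (hv : PT v) :
    PTD fun γ => Leader k d t (M γ) (c γ) (v γ) :=
  PTD.all hM.size ((PTD.lt .snd hv.wk).imp (hM.wk.inComp hc.wk hv.wk .snd).not)

lemma IsMem.vertexWeight (hM : IsMem M) (hc : PT c) (hv : PT v) (hw : PT w) (hx : PT x) :
    PT fun γ => vertexWeight k d t (M γ) (c γ) (v γ) (w γ) (x γ) :=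
  (hM.weight hw hw hx hx).mul (PT.prod hM.size (PTD.ite (hM.wk.inComp hc.wk hv.wk .snd) (.const 1)
    ((hM.wk.weight hw.wk .snd hx.wk (hM.wk.boundaryLabel hc.wk .snd)).mul
      (hM.wk.weight .snd hw.wk (hM.wk.boundaryLabel hc.wk .snd) hx.wk))))

lemma IsMem.tabSize (hM : IsMem M) : PB fun γ => tabSize k d t (M γ) :=
  (hM.slotBase.pow _).mul hM.size

lemma IsMem.logTab (hM : IsMem M) : PB fun γ => logTab k d (M γ) :=
  (((PB.const _).mul hM.size).add ((hM.size.mul hM.size).mul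
    (hM.logVar.mul (hM.statBase.pow _)))).add (.const 2)

lemma IsMem.compEntry (hM : IsMem M) (hT : PT T) (hc : PT c) (hv : PT v) :
    PT fun γ => compEntry k d t (M γ) (T γ) (c γ) (v γ) :=
  PT.entry hM.logTab hM.tabSize hT ((hc.mul hM.size.pt).add hv)

lemma IsMem.subProd (hM : IsMem M) (hT : PT T) (hc' : PT c') (hc : PT c) (hv : PT v) (hw : PT w) :
    PT fun γ => subProd k d t (M γ) (T γ) (c' γ) (c γ) (v γ) (w γ) :=
  PT.prod hM.size (PTD.ite ((hM.wk.inComp hc.wk hv.wk .snd).and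
    ((PTD.ne .snd hw.wk).and (hM.wk.leader hc'.wk .snd)))
    ((hM.wk.compEntry hT.wk hc'.wk .snd).sub (.const 1)) (.const 1))

lemma IsMem.solves (hM : IsMem M) (hT : PT T) (hc : PT c) (hv : PT v) (hi : PT i) (hw : PT w) :
    PTD fun γ => Solves k d t (M γ) (T γ) (c γ) (v γ) (i γ) (w γ) :=
  (hM.inComp hc hv hw).and ((PTD.all hM.size ((hM.wk.inComp hc.wk hv.wk .snd).imp
    (hM.wk.adj .snd (hM.wk.slotVertex hc.wk hi.wk)).not)).and
    (.all (.const _) (.all hM.wk.size ((hM.wk.wk.inComp hc.wk.wk hv.wk.wk .snd).imp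
      ((PTD.ne .snd hw.wk.wk).imp (.ne (hM.wk.wk.compEntry hT.wk.wk (hM.wk.wk.setSlot hc.wk.wk
        hi.wk.wk ((hw.wk.wk.mul (.const _)).add PT.snd.wk)) .snd) (.const 0)))))))

lemma IsMem.compValue (hM : IsMem M) (hT : PT T) (hc : PT c) (hv : PT v) (hi : PT i) (hw : PT w) :
    PT fun γ => compValue k d t (M γ) (T γ) (c γ) (v γ) (i γ) (w γ) :=
  PT.sum (.const _) ((hM.wk.vertexWeight hc.wk hv.wk hw.wk .snd).mul (hM.wk.subProd hT.wk
    (hM.wk.setSlot hc.wk hi.wk ((hw.wk.mul (.const _)).add .snd)) hc.wk hv.wk hw.wk))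

lemma IsMem.nextEntry (hM : IsMem M) (hT : PT T) (hc : PT c) (hv : PT v) :
    PT fun γ => nextEntry k d t (M γ) (T γ) (c γ) (v γ) :=
  have hs := hM.wk.wk.solves (k := k) (d := d) (t := t) hT.wk.wk hc.wk.wk hv.wk.wk PT.snd.wk .snd
  (PT.sum (.const _) (.sum hM.wk.size (PTD.ite hs ((PT.const 1).add
    (hM.wk.wk.compValue hT.wk.wk hc.wk.wk hv.wk.wk PT.snd.wk .snd)) (.const 0)))).div
  (PT.sum (.const _) (.sum hM.wk.size (PTD.ite hs (.const 1) (.const 0))))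

lemma IsMem.compTable (hM : IsMem M) {j : Γ → ℕ} (hj : PB j) :
    PT fun γ => compTable k d t (M γ) (j γ) :=
  PT.tab hM.logTab hM.tabSize hj (hM.wk.wk.nextEntry PT.snd.wk
    (PT.snd.div hM.wk.wk.size.pt) (PT.snd.mod hM.wk.wk.size.pt))

lemma IsMem.partitionFn (hM : IsMem M) : PT fun γ => partitionFn k d t (M γ) :=
  PT.prod hM.size (PTD.ite (hM.wk.leader hM.wk.noBoundary .snd)
    ((hM.wk.compEntry (hM.wk.compTable hM.wk.size) hM.wk.noBoundary .snd).sub (.const 1))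
    (.const 1))

end Poly

end Seating

/-! ### Correctness of the dynamic program -/

section Components

open SimpleGraph

variable {V : Type*} [Fintype V] [LinearOrder V] {G : SimpleGraph V} {Φ : V → V → ℕ → ℕ → ℕ} {D : ℕ}

open Classical in
/-- The value of a set that is separated from the other vertices by `S` is the product of the values
of its components. Each component is represented by its first vertex. -/
lemma val_eq_prod (hΦ : ∀ u v, u ≠ v → ¬ G.Adj u v → ∀ x y, Φ u v x y = 1) {S X : Finset V}
    (hX : G.bdry X ⊆ S) (hXS : Disjoint X S) (lam : V → ℕ) :
    val Φ D X lam =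
      ∏ v, if v ∈ X ∧ ∀ u < v, u ∉ G.comp S v then val Φ D (G.comp S v) lam else 1 := by
  induction X using Finset.strongInduction with
  | H X ih =>
    obtain rfl | hne := X.eq_empty_or_nonempty
    · simp [val_empty]
    set v := X.min' hne
    have hv : v ∈ X := X.min'_mem hne
    set C := G.comp S v
    have hCX : C ⊆ X := comp_subset hv hX
    have hvC : v ∈ C := mem_comp_self (Finset.disjoint_left.1 hXS hv)
    have hadj : ∀ a ∈ C, ∀ b ∈ X \ C, ¬ G.Adj a b := fun a ha b hb hab => by
      rw [Finset.mem_sdiff] at hb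
      exact hb.2 (mem_comp_of_adj ha hab (Finset.disjoint_left.1 hXS hb.1))
    have hbdry : G.bdry (X \ C) ⊆ S := fun z hz => by
      obtain ⟨hz, w, hw, hwz⟩ := mem_bdry.1 hz
      by_cases hzX : z ∈ X
      · have hzC : z ∈ C := by simpa [hzX] using hz
        exact absurd hwz.symm (hadj z hzC w hw)
      · exact hX (mem_bdry.2 ⟨hzX, w, (Finset.mem_sdiff.1 hw).1, hwz⟩)
    have hss : X \ C ⊂ X := Finset.sdiff_ssubset hCX ⟨v, hvC⟩
    have hunion := val_union hΦ (D := D) (C₁ := C) (C₂ := X \ C) Finset.disjoint_sdiff hadj lam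
    rw [Finset.union_sdiff_of_subset hCX] at hunion
    rw [hunion, ih _ hss hbdry (hXS.mono_left hss.1),
      ← Fintype.prod_ite_eq' v (fun v => val Φ D (G.comp S v) lam), ← Finset.prod_mul_distrib]
    refine Finset.prod_congr rfl fun u _ => ?_
    -- the only first vertex of a component in `C` is the minimum `v` of `X`
    by_cases huv : u = v
    · subst huv
      have hlead : ∀ u < v, u ∉ G.comp S v := fun u hu huC => (X.min'_le u (hCX huC)).not_gt hu
      rw [if_pos (show v ∈ X ∧ ∀ u < v, u ∉ G.comp S v from ⟨hv, hlead⟩)]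
      simp [hvC, C]
    · by_cases huC : u ∈ C
      · have hlt : v < u := lt_of_le_of_ne (X.min'_le u (hCX huC)) (Ne.symm huv)
        have : ¬ ∀ a < u, a ∉ G.comp S u := fun h => h v hlt (mem_comp_symm huC)
        simp [huv, huC, this]
      · simp [huv, huC]

variable {W : ℕ}

lemma val_le (hD : 0 < D) (hW : ∀ u v x y, Φ u v x y ≤ W) (hW' : 0 < W) (C : Finset V)
    (lam : V → ℕ) :
    val Φ D C lam ≤ D ^ Fintype.card V * W ^ (Fintype.card V * Fintype.card V) := by
  have hcard : (labellings D C lam).card ≤ D ^ Fintype.card V := by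
    rw [labellings, Fintype.card_piFinset, ← Finset.card_univ]
    refine Finset.prod_le_pow_card _ _ _ fun u _ => ?_
    split_ifs
    · simp
    · simpa using Nat.succ_le_of_lt hD
  refine (Finset.sum_le_card_nsmul _ _ (W ^ (Fintype.card V * Fintype.card V)) fun l _ => ?_).trans
    (Nat.mul_le_mul_right _ hcard)
  rw [pow_mul, ← Finset.card_univ]
  refine Finset.prod_le_pow_card _ _ _ fun u _ => Finset.prod_le_pow_card _ _ _ fun v _ => ?_
  split_ifs
  · exact hW ..
  · exact hW'

end Components

namespace Seating

open RAM SimpleGraph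

section

variable {k d t : ℕ} {M : Memory}

lemma numLabels_pos : 0 < numLabels k d := by
  unfold numLabels
  positivity

lemma slotBase_pos : 0 < slotBase k d M := Nat.mul_pos (Nat.succ_pos _) numLabels_pos

lemma slot_digit_lt {w x : ℕ} (hw : w ≤ size M) (hx : x < numLabels k d) :
    w * numLabels k d + x < slotBase k d M := by
  have := Nat.mul_le_mul_right (numLabels k d) hw
  rw [slotBase, add_mul, one_mul]
  lia

lemma setSlot_lt {c i a : ℕ} (ha : a < slotBase k d M) :
    setSlot k d t M c i a < slotBase k d M ^ (t + 1) :=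
  undig_lt fun j _ => by
    split_ifs
    · exact ha
    · exact dig_lt _ _ _ slotBase_pos

lemma slot_setSlot {c i j a : ℕ} (ha : a < slotBase k d M) (hj : j < t + 1) :
    slot k d t M (setSlot k d t M c i a) j = if j = i then a else slot k d t M c j :=
  dig_undig (fun j _ => by
    split_ifs
    · exact ha
    · exact dig_lt _ _ _ slotBase_pos) hj

lemma slotVertex_setSlot {c i j w x : ℕ} (hw : w ≤ size M) (hx : x < numLabels k d)
    (hj : j < t + 1) : slotVertex k d t M (setSlot k d t M c i (w * numLabels k d + x)) j =
      if j = i then w else slotVertex k d t M c j := by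
  rw [slotVertex, slot_setSlot (slot_digit_lt hw hx) hj]
  split_ifs
  · rw [mul_comm, Nat.mul_add_div numLabels_pos, Nat.div_eq_of_lt hx, add_zero]
  · rfl

lemma slotLabel_setSlot {c i j w x : ℕ} (hw : w ≤ size M) (hx : x < numLabels k d)
    (hj : j < t + 1) : slotLabel k d t M (setSlot k d t M c i (w * numLabels k d + x)) j =
      if j = i then x else slotLabel k d t M c j := by
  rw [slotLabel, slot_setSlot (slot_digit_lt hw hx) hj]
  split_ifs
  · rw [Nat.mul_add_mod_self_right, Nat.mod_eq_of_lt hx]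
  · rfl

lemma noBoundary_lt : noBoundary k d t M < slotBase k d M ^ (t + 1) :=
  undig_lt fun _ _ => slot_digit_lt le_rfl numLabels_pos

lemma slotVertex_noBoundary {j : ℕ} (hj : j < t + 1) :
    slotVertex k d t M (noBoundary k d t M) j = size M := by
  rw [slotVertex, slot, noBoundary, dig_undig (fun _ _ => ?_) hj,
    Nat.mul_div_cancel _ numLabels_pos]
  exact slot_digit_lt le_rfl numLabels_pos

variable (k d t) in
open Classical in
/-- The set of the vertices of a boundary. -/
noncomputable def bdrySet (M : Memory) (c : ℕ) : Finset (Fin (size M)) :=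
  {u | OnBoundary k d t M c u}

lemma mem_bdrySet {c : ℕ} {u : Fin (size M)} :
    u ∈ bdrySet k d t M c ↔ OnBoundary k d t M c u := by
  simp [bdrySet]

lemma bdrySet_noBoundary : bdrySet k d t M (noBoundary k d t M) = ∅ := by
  ext u
  rw [mem_bdrySet]
  simp only [Finset.notMem_empty, iff_false]
  rintro ⟨i, hi, h⟩
  rw [slotVertex_noBoundary hi] at h
  exact u.2.ne' h

lemma unitStat_le (j : ℕ) :
    unitStat k d M j ≤ 2 ^ (logVar k d M * statBase M ^ numStats k d) := by
  rw [unitStat, genVar, ← pow_mul]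
  refine Nat.pow_le_pow_right (by lia) (Nat.mul_le_mul_left _ (Nat.pow_le_pow_right ?_ ?_))
  · exact Nat.succ_pos _
  · exact min_le_right ..

lemma weight_le (u v x y : ℕ) :
    weight k d M u v x y ≤ 2 ^ (logVar k d M * statBase M ^ numStats k d) := by
  have : 1 ≤ 2 ^ (logVar k d M * statBase M ^ numStats k d) := Nat.one_le_two_pow
  have := @unitStat_le k d M
  unfold weight
  split_ifs <;> simp_all

end

section

variable {k d t : ℕ} {M : Memory} {G : SimpleGraph (Fin (size M))}
  (hG : ∀ u v : Fin (size M), adj M u v ↔ G.Adj u v)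
include hG

lemma weight_eq_one (u v : Fin (size M)) (huv : u ≠ v) (h : ¬ G.Adj u v) (x y : ℕ) :
    weight k d M u v x y = 1 := by
  rw [weight, if_neg (Fin.val_ne_of_ne huv), if_neg (mt (hG u v).1 h)]

lemma inComp_iff (c : ℕ) (v u : Fin (size M)) :
    InComp k d t M c v u ↔ u ∈ G.comp (bdrySet k d t M c) v := by
  unfold InComp compTab comp
  rw [Fintype.card_fin]
  suffices ∀ j, ∀ u : Fin (size M), entry 1 (size M) (tab 1 (size M) _ j) u = 1 ↔
    u ∈ G.reach (bdrySet k d t M c) v j from this _ u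
  intro j
  induction j with
  | zero => simp [entry_tab_zero, reach]
  | succ j ih =>
    intro u
    rw [entry_tab_succ _ _ _ _ u.2, mem_reach_succ, mem_bdrySet]
    have h : (∃ w < size M, entry 1 (size M) (tab 1 (size M) _ j) w = 1 ∧ adj M w u) ↔
        ∃ w ∈ G.reach (bdrySet k d t M c) v j, G.Adj w u :=
      ⟨fun ⟨w, hw, h, h'⟩ => ⟨⟨w, hw⟩, (ih ⟨w, hw⟩).1 h, (hG ⟨w, hw⟩ u).1 h'⟩,
        fun ⟨w, h, h'⟩ => ⟨w, w.2, (ih w).2 h, (hG w u).2 h'⟩⟩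
    refine Iff.trans ?_ (and_congr_right' (or_congr Fin.val_inj h))
    split_ifs with h'
    · exact iff_of_true rfl h'
    · exact iff_of_false (by simp) h'

lemma leader_iff (c : ℕ) (v : Fin (size M)) :
    Leader k d t M c v ↔ ∀ u < v, u ∉ G.comp (bdrySet k d t M c) v := by
  constructor
  · intro h u hu huc
    exact h u u.2 hu ((inComp_iff hG c v u).2 huc)
  · intro h u hu huv huc
    exact h ⟨u, hu⟩ huv ((inComp_iff hG c v ⟨u, hu⟩).1 huc)

lemma vertexWeight_eq (c : ℕ) (v w : Fin (size M)) (x : ℕ) :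
    vertexWeight k d t M c v w x = wt (fun u v : Fin (size M) => weight k d M u v)
      (G.comp (bdrySet k d t M c) v) (fun u => boundaryLabel k d t M c u) w x := by
  rw [vertexWeight, wt, Finset.prod_range]
  congr 1
  refine Finset.prod_congr rfl fun u _ => ?_
  simp only [inComp_iff hG c v u]

end

section

variable {k d t : ℕ} {M : Memory} {G : SimpleGraph (Fin (size M))}

variable (k d t) in
/-- The value of the component of `v` in the graph without the boundary `c`. -/
noncomputable def compVal (G : SimpleGraph (Fin (size M))) (c : ℕ) (v : Fin (size M)) : ℕ :=
  val (fun u v : Fin (size M) => weight k d M u v) (numLabels k d)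
    (G.comp (bdrySet k d t M c) v) fun u => boundaryLabel k d t M c u

variable (k d t) in
/-- The entries of solved components are correct. -/
def Sound (G : SimpleGraph (Fin (size M))) (T : ℕ) : Prop :=
  ∀ c < slotBase k d M ^ (t + 1), ∀ v : Fin (size M), compEntry k d t M T c v ≠ 0 →
    compEntry k d t M T c v = 1 + compVal k d t G c v

lemma compVal_lt (c : ℕ) (v : Fin (size M)) : 1 + compVal k d t G c v < 2 ^ logTab k d M := by
  have h := val_le (D := numLabels k d) (Φ := fun u v : Fin (size M) => weight k d M u v)
    numLabels_pos (fun u v => weight_le (u : ℕ) v) (by positivity) (G.comp (bdrySet k d t M c) v)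
    fun u => boundaryLabel k d t M c u
  rw [Fintype.card_fin] at h
  have h' : numLabels k d ^ size M ≤ 2 ^ (numLabels k d * size M) := by
    rw [pow_mul]
    exact Nat.pow_le_pow_left Nat.lt_two_pow_self.le _
  have h1 := h.trans (Nat.mul_le_mul_right _ h')
  rw [← pow_mul, ← pow_add, mul_comm (logVar k d M * _)] at h1
  have h2 : 1 ≤ 2 ^ (numLabels k d * size M +
    size M * size M * (logVar k d M * statBase M ^ numStats k d)) := Nat.one_le_two_pow
  unfold compVal logTab
  rw [pow_add]
  lia

/-- A step of the decomposition: the vertex `w` of the component of `v` replaces a vertex that is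
not adjacent to the component. -/
structure Replaces (G : SimpleGraph (Fin (size M))) (k d t c : ℕ) (v : Fin (size M)) (i : ℕ)
    (w : Fin (size M)) : Prop where
  lt : i < t + 1
  mem : w ∈ G.comp (bdrySet k d t M c) v
  free : ∀ z ∈ G.bdry (G.comp (bdrySet k d t M c) v), slotVertex k d t M c i ≠ z

namespace Replaces

variable {c i x : ℕ} {v w : Fin (size M)} (h : Replaces G k d t c v i w) (hx : x < numLabels k d)
include h hx

omit hx in
lemma slotVertex_ne {j : ℕ} (hj : j < t + 1) : slotVertex k d t M c j ≠ w := fun hw =>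
  notMem_of_mem_comp h.mem (mem_bdrySet.2 ⟨j, hj, hw⟩)

lemma bdry_subset : G.bdry ((G.comp (bdrySet k d t M c) v).erase w) ⊆
    bdrySet k d t M (setSlot k d t M c i (w * numLabels k d + x)) := fun z hz => by
  obtain ⟨hz, a, ha, haz⟩ := mem_bdry.1 hz
  rw [mem_bdrySet]
  by_cases hzw : z = w
  · exact ⟨i, h.lt, by rw [slotVertex_setSlot w.2.le hx h.lt, if_pos rfl, hzw]⟩
  · have hz' : z ∈ G.bdry (G.comp (bdrySet k d t M c) v) :=
      mem_bdry.2 ⟨fun h => hz (Finset.mem_erase.2 ⟨hzw, h⟩), a, Finset.mem_of_mem_erase ha, haz⟩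
    obtain ⟨j, hj, hjz⟩ := mem_bdrySet.1 (bdry_comp_subset hz')
    refine ⟨j, hj, ?_⟩
    rw [slotVertex_setSlot w.2.le hx hj, if_neg ?_, hjz]
    rintro rfl
    exact h.free z hz' hjz

omit h in
lemma disjoint : Disjoint ((G.comp (bdrySet k d t M c) v).erase w)
    (bdrySet k d t M (setSlot k d t M c i (w * numLabels k d + x))) := by
  refine Finset.disjoint_left.2 fun u hu hu' => ?_
  obtain ⟨hne, hu⟩ := Finset.mem_erase.1 hu
  obtain ⟨j, hj, hju⟩ := mem_bdrySet.1 hu'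
  rw [slotVertex_setSlot w.2.le hx hj] at hju
  split_ifs at hju
  · exact hne (Fin.ext hju.symm)
  · exact notMem_of_mem_comp hu (mem_bdrySet.2 ⟨j, hj, hju⟩)

lemma boundaryLabel_self :
    boundaryLabel k d t M (setSlot k d t M c i (w * numLabels k d + x)) w = x := by
  rw [boundaryLabel, Finset.sum_eq_single i]
  · rw [slotVertex_setSlot w.2.le hx h.lt, slotLabel_setSlot w.2.le hx h.lt]
    simp
  · intro j hj hji
    rw [Finset.mem_range] at hj
    rw [slotVertex_setSlot w.2.le hx hj, if_neg hji, if_neg (h.slotVertex_ne hj)]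
  · simp [h.lt]

lemma boundaryLabel_of_ne {u : Fin (size M)} (hu : slotVertex k d t M c i ≠ u) (huw : u ≠ w) :
    boundaryLabel k d t M (setSlot k d t M c i (w * numLabels k d + x)) u =
      boundaryLabel k d t M c u := by
  refine Finset.sum_congr rfl fun j hj => ?_
  rw [Finset.mem_range] at hj
  rw [slotVertex_setSlot w.2.le hx hj, slotLabel_setSlot w.2.le hx hj]
  by_cases hji : j = i
  · subst hji
    rw [if_pos rfl, if_neg (Fin.val_ne_of_ne huw.symm), if_neg hu]
  · simp only [if_neg hji]

variable (hG : ∀ u v : Fin (size M), adj M u v ↔ G.Adj u v)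
include hG

/-- The product of the entries of the smaller components is the value of the component of `v`
without `w`, where `w` has the label `x`. -/
lemma subProd_eq {T : ℕ} (hT : Sound k d t G T) (hs : ∀ u ∈ G.comp (bdrySet k d t M c) v, u ≠ w →
      compEntry k d t M T (setSlot k d t M c i (w * numLabels k d + x)) u ≠ 0) :
    subProd k d t M T (setSlot k d t M c i (w * numLabels k d + x)) c v w =
      val (fun u v : Fin (size M) => weight k d M u v) (numLabels k d)
        ((G.comp (bdrySet k d t M c) v).erase w)
        (Function.update (fun u => boundaryLabel k d t M c u) w x) := by
  have hΦ := weight_eq_one (k := k) (d := d) hG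
  rw [val_congr hΦ _ (lam' := fun u : Fin (size M) =>
      boundaryLabel k d t M (setSlot k d t M c i (w * numLabels k d + x)) u) fun u hu => ?_,
    val_eq_prod hΦ (h.bdry_subset hx) (Replaces.disjoint hx), subProd, Finset.prod_range]
  · refine Finset.prod_congr rfl fun u _ => ?_
    refine @if_ctx_congr _ _ _ (_) (_) _ _ _ _ ?_ (fun hu => ?_) fun _ => rfl
    · rw [inComp_iff hG, leader_iff hG, Finset.mem_erase, ← Fin.val_ne_iff]
      tauto
    · obtain ⟨hu1, hu2⟩ := Finset.mem_erase.1 hu.1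
      rw [hT _ (setSlot_lt (slot_digit_lt w.2.le hx)) u (hs u hu2 hu1), Nat.add_sub_cancel_left]
      rfl
  · by_cases huw : u = w
    · rw [huw, Function.update_self, h.boundaryLabel_self hx]
    · obtain ⟨hu, a, ha, hau⟩ := mem_bdry.1 hu
      rw [Function.update_of_ne huw, h.boundaryLabel_of_ne hx (h.free u (mem_bdry.2
        ⟨fun h => hu (Finset.mem_erase.2 ⟨huw, h⟩), a, Finset.mem_of_mem_erase ha, hau⟩)) huw]

end Replaces

variable (hG : ∀ u v : Fin (size M), adj M u v ↔ G.Adj u v)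
include hG

lemma solves_iff {T c i : ℕ} {v w : Fin (size M)} (hi : i < t + 1) :
    Solves k d t M T c v i w ↔ Replaces G k d t c v i w ∧ ∀ x < numLabels k d,
      ∀ u ∈ G.comp (bdrySet k d t M c) v, u ≠ w →
        compEntry k d t M T (setSlot k d t M c i (w * numLabels k d + x)) u ≠ 0 := by
  constructor
  · rintro ⟨h1, h2, h3⟩
    refine ⟨⟨hi, (inComp_iff hG ..).1 h1, fun z hz hzi => ?_⟩, fun x hx u hu huw =>
      h3 x hx u u.2 ((inComp_iff hG ..).2 hu) (Fin.val_ne_of_ne huw)⟩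
    obtain ⟨-, a, ha, haz⟩ := mem_bdry.1 hz
    refine h2 a a.2 ((inComp_iff hG ..).2 ha) ?_
    rw [hzi]
    exact (hG a z).2 haz
  · rintro ⟨h, h3⟩
    refine ⟨(inComp_iff hG ..).2 h.mem, fun z hz hzC hadj => ?_, fun x hx u hu huC huw =>
      h3 x hx ⟨u, hu⟩ ((inComp_iff hG c v ⟨u, hu⟩).1 huC) fun h => huw (congrArg Fin.val h)⟩
    have hzC' := (inComp_iff hG c v ⟨z, hz⟩).1 hzC
    have hadj' := (hG ⟨z, hz⟩ ⟨_, hadj.2.1⟩).1 hadj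
    refine h.free ⟨_, hadj.2.1⟩ (mem_bdry.2 ⟨fun h' => ?_, _, hzC', hadj'⟩) rfl
    exact notMem_of_mem_comp h' (mem_bdrySet.2 ⟨i, hi, rfl⟩)

lemma compValue_eq {T c i : ℕ} {v w : Fin (size M)} (hT : Sound k d t G T) (hi : i < t + 1)
    (h : Solves k d t M T c v i w) : compValue k d t M T c v i w = compVal k d t G c v := by
  obtain ⟨hr, hs⟩ := (solves_iff hG hi).1 h
  rw [compVal, val_eq_sum _ _ hr.mem, compValue]
  refine Finset.sum_congr rfl fun x hx => ?_
  rw [Finset.mem_range] at hx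
  rw [vertexWeight_eq hG, hr.subProd_eq hx hG hT (hs x hx)]

open Classical in
lemma nextEntry_eq {T c : ℕ} {v : Fin (size M)} (hT : Sound k d t G T) :
    nextEntry k d t M T c v = if ∃ i < t + 1, ∃ w : Fin (size M), Solves k d t M T c v i w then
      1 + compVal k d t G c v else 0 := by
  have h : (∑ i ∈ Finset.range (t + 1), ∑ w ∈ Finset.range (size M),
      if Solves k d t M T c v i w then 1 + compValue k d t M T c v i w else 0) =
      (∑ i ∈ Finset.range (t + 1), ∑ w ∈ Finset.range (size M),
        if Solves k d t M T c v i w then 1 else 0) * (1 + compVal k d t G c v) := by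
    simp only [Finset.sum_mul]
    refine Finset.sum_congr rfl fun i hi => Finset.sum_congr rfl fun w hw => ?_
    rw [Finset.mem_range] at hi hw
    split_ifs with h
    · rw [compValue_eq hG (w := ⟨w, hw⟩) hT hi h, one_mul]
    · rw [zero_mul]
  rw [nextEntry, h]
  split_ifs with hs
  · obtain ⟨i, hi, w, hw⟩ := hs
    refine Nat.mul_div_cancel_left _ (Nat.pos_of_ne_zero fun h0 => ?_)
    have := Finset.sum_eq_zero_iff.1 (Finset.sum_eq_zero_iff.1 h0 i (Finset.mem_range.2 hi)) w
      (Finset.mem_range.2 w.2)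
    simp [hw] at this
  · rw [Finset.sum_eq_zero, zero_mul, Nat.zero_div]
    intro i hi
    refine Finset.sum_eq_zero fun w hw => if_neg fun h => hs ?_
    exact ⟨i, Finset.mem_range.1 hi, ⟨w, Finset.mem_range.1 hw⟩, h⟩

omit hG in
lemma compEntry_zero (c v : ℕ) : compEntry k d t M (compTable k d t M 0) c v = 0 :=
  entry_tab_zero ..

omit hG in
lemma compEntry_succ {j c : ℕ} (hc : c < slotBase k d M ^ (t + 1)) (v : Fin (size M)) :
    compEntry k d t M (compTable k d t M (j + 1)) c v =
      nextEntry k d t M (compTable k d t M j) c v % 2 ^ logTab k d M := by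
  have hn : 0 < size M := v.pos
  have hlt : c * size M + v < tabSize k d t M := by
    have := Nat.mul_le_mul_right (size M) (Nat.succ_le_of_lt hc)
    rw [Nat.succ_mul] at this
    exact (Nat.add_lt_add_left v.2 _).trans_le this
  rw [compEntry, compTable, entry_tab_succ _ _ _ _ hlt, mul_comm, Nat.mul_add_div hn,
    Nat.div_eq_of_lt v.2, add_zero, Nat.mul_add_mod_self_left, Nat.mod_eq_of_lt v.2]
  rfl

lemma sound_compTable (j : ℕ) : Sound k d t G (compTable k d t M j) := by
  induction j with
  | zero => exact fun c _ v h => absurd (compEntry_zero c v) h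
  | succ j ih =>
    intro c hc v h
    rw [compEntry_succ hc, nextEntry_eq hG ih] at h ⊢
    split_ifs at h ⊢
    · exact Nat.mod_eq_of_lt (compVal_lt c v)
    · simp at h

variable (k d t) in
omit hG in
/-- No vertex occupies two slots of the boundary `c`. -/
def NoDup (M : Memory) (c : ℕ) : Prop :=
  ∀ i < t + 1, ∀ j < t + 1, slotVertex k d t M c i = slotVertex k d t M c j →
    slotVertex k d t M c i < size M → i = j

/-- Completeness: after `j` rounds, all components with at most `j` vertices whose neighbours belong
to a common bag are solved. A bag of a tree decomposition shows which vertex to write, but the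
program does not need to know the decomposition. -/
lemma compEntry_ne_zero (T : TreeDecomposition G) (hT : ∀ u, (T.bag u).encard ≤ t + 1) (j : ℕ) :
    ∀ c < slotBase k d M ^ (t + 1), NoDup k d t M c → ∀ v ∉ bdrySet k d t M c,
      (G.comp (bdrySet k d t M c) v).card ≤ j →
      (∃ b, ∀ z ∈ G.bdry (G.comp (bdrySet k d t M c) v), z ∈ T.bag b) →
      compEntry k d t M (compTable k d t M j) c v ≠ 0 := by
  induction j with
  | zero =>
    intro c _ _ v hv h
    exact absurd h (Finset.card_pos.2 ⟨v, mem_comp_self hv⟩).not_ge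
  | succ j ih =>
    rintro c hc hdup v hv hcard ⟨b, hb⟩
    rw [compEntry_succ hc, nextEntry_eq hG (sound_compTable hG j), if_pos ?_,
      Nat.mod_eq_of_lt (compVal_lt c v)]
    · lia
    obtain ⟨g, w, hw, hwg, hg⟩ := T.exists_bag hv hb
    set C := G.comp (bdrySet k d t M c) v
    have hins : (insert w (G.bdry C)).card ≤ t + 1 := by
      have h : ((insert w (G.bdry C) : Finset _) : Set (Fin (size M))) ⊆ T.bag g := by
        intro z hz
        obtain rfl | hz := Finset.mem_insert.1 hz
        · exact hwg
        · exact hg z hz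
      have h' := (Set.encard_le_encard h).trans (hT g)
      rw [Set.encard_coe_eq_coe_finsetCard] at h'
      exact_mod_cast h'
    rw [Finset.card_insert_of_notMem fun h => (mem_bdry.1 h).1 hw] at hins
    -- since the boundary of `C` has at most `t` vertices, there is a slot without such a vertex
    obtain ⟨i, hi, hfree⟩ : ∃ i < t + 1, ∀ z ∈ G.bdry C, slotVertex k d t M c i ≠ z := by
      by_contra! hcon
      have h := Finset.card_le_card_of_injOn (s := Finset.range (t + 1))
        (t := (G.bdry C).image Fin.val) (slotVertex k d t M c) (fun i hi => by
          obtain ⟨z, hz, hiz⟩ := hcon i (by simpa using hi)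
          exact Finset.mem_coe.2 (Finset.mem_image.2 ⟨z, hz, hiz.symm⟩)) (fun i hi i' hi' h => by
          obtain ⟨z, hz, hiz⟩ := hcon i (by simpa using hi)
          exact hdup i (by simpa using hi) i' (by simpa using hi') h (hiz ▸ z.2))
      rw [Finset.card_range] at h
      have := h.trans Finset.card_image_le
      lia
    have hr : Replaces G k d t c v i w := ⟨hi, hw, hfree⟩
    refine ⟨i, hi, w, (solves_iff hG hi).2 ⟨hr, fun x hx u hu huw => ?_⟩⟩
    have hu' : u ∈ C.erase w := Finset.mem_erase.2 ⟨huw, hu⟩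
    refine ih _ (setSlot_lt (slot_digit_lt w.2.le hx)) ?_ u
      (Finset.disjoint_left.1 (Replaces.disjoint hx) hu') ?_ ⟨g, fun z hz => ?_⟩
    · intro i₁ h₁ i₂ h₂ heq hlt
      rw [slotVertex_setSlot w.2.le hx h₁] at heq hlt
      rw [slotVertex_setSlot w.2.le hx h₂] at heq
      split_ifs at heq hlt with h3 h4 h4
      · rw [h3, h4]
      · exact absurd heq.symm (hr.slotVertex_ne h₂)
      · exact absurd heq (hr.slotVertex_ne h₁)
      · exact hdup i₁ h₁ i₂ h₂ heq hlt
    · have h := Finset.card_le_card (comp_subset hu' (hr.bdry_subset hx))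
      rw [Finset.card_erase_of_mem hw] at h
      lia
    · obtain ⟨hzC, a, ha, haz⟩ := mem_bdry.1
        (bdry_comp_subset_bdry hu' (hr.bdry_subset hx) (Replaces.disjoint hx) hz)
      by_cases hzw : z = w
      · exact hzw ▸ hwg
      · exact hg z (mem_bdry.2 ⟨fun h => hzC (Finset.mem_erase.2 ⟨hzw, h⟩), a,
          Finset.mem_of_mem_erase ha, haz⟩)

/-- The dynamic program computes the partition function of graphs of treewidth at most `t`. -/
theorem partitionFn_eq (ht : treewidth G ≤ t) (lam : Fin (size M) → ℕ) : partitionFn k d t M =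
    val (fun u v : Fin (size M) => weight k d M u v) (numLabels k d) Finset.univ lam := by
  obtain ⟨T, hT⟩ := exists_treeDecomposition ht
  have hΦ := weight_eq_one (k := k) (d := d) hG
  have hbdry : G.bdry Finset.univ ⊆ (∅ : Finset (Fin (size M))) := fun z hz => by
    simp [mem_bdry] at hz
  rw [val_congr hΦ _ (lam' := fun u : Fin (size M) =>
      boundaryLabel k d t M (noBoundary k d t M) u) fun u hu => absurd (hbdry hu) (by simp),
    val_eq_prod hΦ hbdry (by simp), partitionFn, Finset.prod_range]
  refine Finset.prod_congr rfl fun u _ => ?_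
  simp only [leader_iff hG, bdrySet_noBoundary, Finset.mem_univ, true_and]
  refine if_congr Iff.rfl ?_ rfl
  obtain ⟨b, -⟩ := T.exists_mem_bag u
  have h := compEntry_ne_zero hG T hT (size M) _ noBoundary_lt (k := k) (d := d) ?_ u
    (by simp [bdrySet_noBoundary]) ((Finset.card_le_univ _).trans (by simp)) ⟨b, fun z hz => ?_⟩
  · rw [sound_compTable hG _ _ noBoundary_lt u h, Nat.add_sub_cancel_left, compVal,
      bdrySet_noBoundary]
  · intro i hi _ _ _ hlt
    rw [slotVertex_noBoundary hi] at hlt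
    exact absurd hlt (lt_irrefl _)
  · have := bdry_comp_subset hz
    simp [bdrySet_noBoundary] at this

end

end Seating

/-! ### Evaluating the statistics -/

namespace Seating

open RAM

section Defs

variable (k d t : ℕ) (sym : Prop) (M : Memory)

/-- The number `i` encodes a pair of different agents of the refined classes `x` and `y`. -/
def IsPair (x y i : ℕ) : Prop :=
  i / size M ≠ i % size M ∧ cls M (i / size M) = x ∧ cls M (i % size M) = y

/-- The first code of a pair of different agents of the refined classes `x` and `y`; it is `n * n`
if there is no such pair. -/
noncomputable def firstPair (x y : ℕ) : ℕ :=
  open Classical in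
  ∑ i ∈ Finset.range (size M * size M),
    if ∀ j < size M * size M, j ≤ i → ¬ IsPair M x y j then 1 else 0

/-- The preference of the agents of class `x` for the other agents of class `y`. If there is no pair
of such agents, then the cell that is read lies behind the matrix of preferences and holds `0`. -/
noncomputable def classPref (x y : ℕ) : ℝ := M.real 0 (firstPair M x y)

/-- The sum of the preferences of the agents on seats with label `x` for the classes that occur in
the label `y`, beginning with the digit with index `s`. -/
noncomputable def labSum (s x y : ℕ) : ℝ :=
  ∑ i ∈ Finset.range (d + 1 - s), classPref M (labDig k d x 0) (labDig k d y (i + s))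

/-- The agent `a` on a seat with label `x` envies the agent `b` on another seat with label `y`. The
number `s` is `0` if the two seats are adjacent, and `1` otherwise. After a swap on adjacent
seats, `a` has the former neighbours of `b`, except that `b` takes the place of `a` itself; hence
the preference for the class of `b`, the first digit of `y`, has to be added to the sum over the
neighbours of `b`, and the preference for the class of `a`, the first digit of `x`, has to be
subtracted. The latter is added to the other side of the inequality instead. -/
def EnvyLab (s x y : ℕ) : Prop := labSum k d M s x x < labSum k d M s x y

/-- The labels `x` and `y` are not allowed together: there is envy, and, if `sym` is true, it is
mutual. -/
def BadLab (s x y : ℕ) : Prop := EnvyLab k d M s x y ∧ (sym → EnvyLab k d M s y x)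

/-- The statistic with index `j` of a labelling with code `c`. -/
def stat (c j : ℕ) : ℕ := dig (statBase M) (numStats k d) c j

/-- The number of agents in the refined class `i`. -/
noncomputable def classSize (i : ℕ) : ℕ := ∑ a ∈ Finset.range (size M), if cls M a = i then 1 else 0

/-- The statistics encoded by `c` are those of labellings that place the right number of agents of
each class, and have no forbidden pair of labels. If two labels are forbidden on nonadjacent seats,
then all pairs of seats with these labels have to be adjacent or equal. -/
def GoodCode (c : ℕ) : Prop :=
  (∀ x < numLabels k d, ∀ y < numLabels k d,
    (BadLab k d sym M 0 x y → stat k d M c (numLabels k d + x * numLabels k d + y) = 0) ∧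
    (BadLab k d sym M 1 x y → stat k d M c x * stat k d M c y =
      stat k d M c (numLabels k d + x * numLabels k d + y) + if x = y then stat k d M c x else 0)) ∧
  ∀ i < 2 * k, (∑ x ∈ Finset.range (numLabels k d),
    if labDig k d x 0 = i then stat k d M c x else 0) = classSize M i

/-- The number of arrangements without a forbidden pair: the number of allowed assignments of
classes to the seats, times the number of ways to distribute the agents of each class. -/
noncomputable def answer : ℕ :=
  open Classical in
  (∏ i ∈ Finset.range (2 * k), ∏ j ∈ Finset.range (size M),
    if j < classSize M i then j + 1 else 1) *
  ∑ c ∈ Finset.range (statBase M ^ numStats k d), if GoodCode k d sym M c then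
    dig (genVar k d M) (statBase M ^ numStats k d) (partitionFn k d t M) c else 0

end Defs

section Poly

variable {k d t : ℕ} {sym : Prop} {Γ : Type} [Ctx Γ] {M : Γ → Memory} {c x y i j : Γ → ℕ}

lemma IsMem.isPair (hM : IsMem M) (hx : PT x) (hy : PT y) (hi : PT i) :
    PTD fun γ => IsPair (M γ) (x γ) (y γ) (i γ) :=
  have hn := hM.size.pt
  (PTD.ne (hi.div hn) (hi.mod hn)).and ((PTD.eq (hM.cls (hi.div hn)) hx).and
    (.eq (hM.cls (hi.mod hn)) hy))

lemma IsMem.firstPair (hM : IsMem M) (hx : PT x) (hy : PT y) :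
    PB fun γ => firstPair (M γ) (x γ) (y γ) :=
  PB.count (hM.size.mul hM.size) (PTD.all (hM.wk.size.mul hM.wk.size)
    ((PTD.le .snd PT.snd.wk).imp (hM.wk.wk.isPair hx.wk.wk hy.wk.wk .snd).not))

lemma IsMem.classPref (hM : IsMem M) (hx : PT x) (hy : PT y) :
    PTR fun γ => classPref (M γ) (x γ) (y γ) := by
  have h := hM.firstPair hx hy
  obtain rfl : M = Ctx.mem := funext hM
  exact PTR.read h.pt

lemma IsMem.labSum (hM : IsMem M) (s : ℕ) (hx : PT x) (hy : PT y) :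
    PTR fun γ => labSum k d (M γ) s (x γ) (y γ) :=
  PTR.sum _ fun i => hM.classPref (.labDig hx (.const 0)) (.labDig hy (.const (i + s)))

lemma IsMem.badLab (hM : IsMem M) (s : ℕ) (hx : PT x) (hy : PT y) :
    PTD fun γ => BadLab k d sym (M γ) s (x γ) (y γ) :=
  (PTD.real_lt (hM.labSum s hx hx) (hM.labSum s hx hy)).and
    ((PTD.const sym).imp (PTD.real_lt (hM.labSum s hy hy) (hM.labSum s hy hx)))

lemma IsMem.stat (hM : IsMem M) (hc : PT c) (hj : PT j) :
    PT fun γ => stat k d (M γ) (c γ) (j γ) :=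
  PT.dig hM.statBase.pt (.const _) hc hj

lemma IsMem.classSize (hM : IsMem M) (hi : PT i) : PT fun γ => classSize (M γ) (i γ) :=
  PT.sum hM.size (PTD.ite (.eq (hM.wk.cls .snd) hi.wk) (.const 1) (.const 0))

lemma IsMem.goodCode (hM : IsMem M) (hc : PT c) : PTD fun γ => GoodCode k d sym (M γ) (c γ) :=
  have hst {j : (Γ × ℕ) × ℕ → ℕ} (hj : PT j) := hM.wk.wk.stat (k := k) (d := d) hc.wk.wk hj
  have hx := (PT.snd (Γ := Γ)).wk
  have hy := PT.snd (Γ := Γ × ℕ)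
  have hxy := hst (((PT.const (numLabels k d)).add (hx.mul (.const (numLabels k d)))).add hy)
  (PTD.all (.const _) (.all (.const _)
    (((hM.wk.wk.badLab 0 hx hy).imp (.eq hxy (.const 0))).and ((hM.wk.wk.badLab 1 hx hy).imp
      (.eq ((hst hx).mul (hst hy)) (hxy.add (PTD.ite (.eq hx hy) (hst hx) (.const 0)))))))).and
  (.all (.const _) (.eq (.sum (.const _)
    (PTD.ite (.eq (.labDig hy (.const 0)) hx) (hst hy) (.const 0))) (hM.wk.classSize .snd)))

lemma IsMem.answer (hM : IsMem M) : PT fun γ => answer k d t sym (M γ) :=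
  (PT.prod (.const _) (.prod hM.wk.size (PTD.ite (.lt .snd (hM.wk.wk.classSize PT.snd.wk))
    (PT.snd.add (.const 1)) (.const 1)))).mul
  (PT.sum (hM.statBase.pow _) (PTD.ite (hM.wk.goodCode .snd)
    (.dig hM.wk.genVar (hM.wk.statBase.pow _) hM.wk.partitionFn .snd) (.const 0)))

end Poly

end Seating

/-! ### Labellings that come from assignments of classes -/

namespace RAM

lemma undig_dig {b : ℕ} (M : ℕ) (c : ℕ) : undig b M (dig b M c) = c % b ^ M := by
  suffices ∀ N ≤ M, ∑ i ∈ Finset.range N, dig b M c i * b ^ i = c % b ^ N from this M le_rfl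
  intro N hN
  induction N with
  | zero => simp [Nat.mod_one]
  | succ N ih =>
    rw [Finset.sum_range_succ, ih (by lia), dig, min_eq_left (by lia), Nat.mod_pow_succ, mul_comm]

end RAM

namespace Seating

open RAM

section

variable {k d : ℕ} {M : Memory} {G : SimpleGraph (Fin (size M))}

variable (k) in
open Classical in
/-- A digit of the label of the seat `u` if the seats are assigned classes by `f`. -/
noncomputable def viewDig (f : Fin (size M) → ℕ) (u : Fin (size M)) : ℕ → ℕ
  | 0 => f u
  | i + 1 => if h : ∃ v : Fin (size M), adj M u v ∧ nbrIdx M u v = i then f h.choose else 2 * k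

variable (k d) in
/-- The label of the seat `u` if the seats are assigned classes by `f`: it lists the class of `u`
and the classes of the neighbours of `u`. -/
noncomputable def view (f : Fin (size M) → ℕ) (u : Fin (size M)) : ℕ :=
  undig (2 * k + 1) (d + 1) (viewDig k f u)

lemma viewDig_lt {f : Fin (size M) → ℕ} (hf : ∀ u, f u < 2 * k) (u : Fin (size M)) (i : ℕ) :
    viewDig k f u i < 2 * k + 1 := by
  cases i with
  | zero => exact (hf u).trans (by lia)
  | succ i =>
    rw [viewDig]
    split_ifs
    · exact (hf _).trans (by lia)
    · lia

lemma view_lt {f : Fin (size M) → ℕ} (hf : ∀ u, f u < 2 * k) (u : Fin (size M)) :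
    view k d f u < numLabels k d :=
  undig_lt fun i _ => viewDig_lt hf u i

lemma labDig_view {f : Fin (size M) → ℕ} (hf : ∀ u, f u < 2 * k) (u : Fin (size M)) {i : ℕ}
    (hi : i < d + 1) : labDig k d (view k d f u) i = viewDig k f u i :=
  dig_undig (fun i _ => viewDig_lt hf u i) hi

lemma labDig_ext {x y : ℕ} (hx : x < numLabels k d) (hy : y < numLabels k d)
    (h : ∀ i < d + 1, labDig k d x i = labDig k d y i) : x = y := by
  rw [← Nat.mod_eq_of_lt hx, ← Nat.mod_eq_of_lt hy, numLabels, ← undig_dig, ← undig_dig]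
  exact Finset.sum_congr rfl fun i hi => congrArg (· * _) (h i (Finset.mem_range.1 hi))

/-! ### The numbering of the neighbours of a seat -/

open Classical in
lemma nbrIdx_eq_card (u v : ℕ) :
    nbrIdx M u v = ((Finset.range (size M)).filter fun w => w < v ∧ adj M u w).card := by
  rw [nbrIdx, Finset.card_filter]

lemma nbrIdx_lt_nbrIdx {u v w : ℕ} (hv : adj M u v) (hvw : v < w) :
    nbrIdx M u v < nbrIdx M u w := by
  rw [nbrIdx_eq_card, nbrIdx_eq_card]
  refine Finset.card_lt_card (Finset.ssubset_iff_of_subset (fun a ha => ?_) |>.2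
    ⟨v, by simp [hv, hvw, hv.2.1], by simp⟩)
  simp only [Finset.mem_filter] at ha ⊢
  exact ⟨ha.1, ha.2.1.trans hvw, ha.2.2⟩

lemma nbrIdx_inj {u v w : ℕ} (hv : adj M u v) (hw : adj M u w)
    (h : nbrIdx M u v = nbrIdx M u w) : v = w := by
  by_contra hne
  obtain hlt | hlt := Nat.lt_or_gt_of_ne hne
  · exact (nbrIdx_lt_nbrIdx hv hlt).ne h
  · exact (nbrIdx_lt_nbrIdx hw hlt).ne' h

lemma nbrIdx_lt_deg {u v : ℕ} (hv : adj M u v) : nbrIdx M u v < deg M u := by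
  have h : deg M u = nbrIdx M u (size M) := by
    rw [nbrIdx_eq_card, deg, ← Finset.card_filter]
    congr 1
    ext w
    simp +contextual
  rw [h]
  exact nbrIdx_lt_nbrIdx hv hv.2.1

lemma exists_nbrIdx_eq {u i : ℕ} (hi : i < deg M u) :
    ∃ v : Fin (size M), adj M u v ∧ nbrIdx M u v = i := by
  classical
  have h := Finset.surjOn_of_injOn_of_card_le (s := (Finset.range (size M)).filter (adj M u))
    (t := Finset.range (deg M u)) (nbrIdx M u) (fun v hv => by
      simpa using nbrIdx_lt_deg (Finset.mem_filter.1 hv).2) (fun v hv w hw h =>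
        nbrIdx_inj (Finset.mem_filter.1 hv).2 (Finset.mem_filter.1 hw).2 h) (by
      rw [Finset.card_range, deg, Finset.card_filter])
  obtain ⟨v, hv, hvi⟩ := h (by simpa using hi)
  obtain ⟨hv1, hv2⟩ := Finset.mem_filter.1 hv
  exact ⟨⟨v, Finset.mem_range.1 hv1⟩, hv2, hvi⟩

lemma viewDig_nbrIdx (f : Fin (size M) → ℕ) {u v : Fin (size M)} (h : adj M u v) :
    viewDig k f u (nbrIdx M u v + 1) = f v := by
  have hex : ∃ w : Fin (size M), adj M u w ∧ nbrIdx M u w = nbrIdx M u v := ⟨v, h, rfl⟩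
  rw [viewDig, dif_pos hex]
  exact congrArg f (Fin.ext (nbrIdx_inj hex.choose_spec.1 h hex.choose_spec.2))

lemma viewDig_of_deg_le (f : Fin (size M) → ℕ) {u : Fin (size M)} {i : ℕ} (h : deg M u ≤ i) :
    viewDig k f u (i + 1) = 2 * k := by
  rw [viewDig, dif_neg]
  rintro ⟨v, hv, rfl⟩
  exact (nbrIdx_lt_deg hv).not_ge h

/-- A sum over the neighbours of a seat is a sum over the digits of its label. -/
lemma sum_labDig_view {f : Fin (size M) → ℕ} (hf : ∀ u, f u < 2 * k)
    (hG : ∀ u v : Fin (size M), adj M u v ↔ G.Adj u v) (hd : ∀ u, deg M u ≤ d) [DecidableRel G.Adj]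
    (u : Fin (size M)) {g : ℕ → ℝ} (hg : g (2 * k) = 0) :
    ∑ i ∈ Finset.range d, g (labDig k d (view k d f u) (i + 1)) =
      ∑ v ∈ G.neighborFinset u, g (f v) := by
  symm
  refine Finset.sum_of_injOn (fun v => nbrIdx M u v) (fun v hv w hw h => ?_) (fun v hv => ?_)
    (fun i hi hi' => ?_) fun v hv => ?_
  · simp only [SimpleGraph.coe_neighborFinset, SimpleGraph.mem_neighborSet, ← hG] at hv hw
    exact Fin.ext (nbrIdx_inj hv hw h)
  · simp only [SimpleGraph.coe_neighborFinset, SimpleGraph.mem_neighborSet, ← hG] at hv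
    simpa using (nbrIdx_lt_deg hv).trans_le (hd u)
  · rw [labDig_view hf u (by simpa using hi), viewDig_of_deg_le, hg]
    by_contra! h
    obtain ⟨v, hv, hvi⟩ := exists_nbrIdx_eq h
    exact hi' ⟨v, by simpa [← hG] using hv, hvi⟩
  · rw [SimpleGraph.mem_neighborFinset, ← hG] at hv
    rw [labDig_view hf u, viewDig_nbrIdx f hv]
    exact Nat.succ_lt_succ ((nbrIdx_lt_deg hv).trans_le (hd u))

/-! ### The generating function of the statistics -/

variable (k d) in
/-- The index of the statistic that counts the pair of the seats `q.1` and `q.2`, if these seats are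
equal or adjacent. -/
def pairIdx (l : Fin (size M) → ℕ) (q : Fin (size M) × Fin (size M)) : ℕ :=
  if q.1 = q.2 then l q.1 else numLabels k d + l q.1 * numLabels k d + l q.2

open Classical in
/-- The pairs of seats that are equal or adjacent. -/
noncomputable def closePairs (M : Memory) : Finset (Fin (size M) × Fin (size M)) :=
  {q | q.1 = q.2 ∨ adj M q.1 q.2}

variable (k d) in
/-- The statistics of the labelling `l`. -/
noncomputable def statOf (l : Fin (size M) → ℕ) (j : ℕ) : ℕ :=
  ((closePairs M).filter fun q => pairIdx k d l q = j).card

variable (k d) in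
/-- The code of the statistics of the labelling `l`. -/
noncomputable def codeOf (l : Fin (size M) → ℕ) : ℕ :=
  undig (statBase M) (numStats k d) (statOf k d l)

lemma mem_closePairs {q : Fin (size M) × Fin (size M)} :
    q ∈ closePairs M ↔ q.1 = q.2 ∨ adj M q.1 q.2 := by
  simp [closePairs]

lemma statOf_lt (l : Fin (size M) → ℕ) (j : ℕ) : statOf k d l j < statBase M := by
  refine Nat.lt_succ_of_le ((Finset.card_le_univ _).trans ?_)
  simp

lemma pairLab_lt {x y : ℕ} (hx : x < numLabels k d) (hy : y < numLabels k d) :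
    numLabels k d + x * numLabels k d + y < numStats k d := by
  have := Nat.mul_le_mul_right (numLabels k d) (Nat.succ_le_of_lt hx)
  rw [Nat.succ_mul] at this
  rw [numStats]
  lia

lemma pairIdx_lt {l : Fin (size M) → ℕ} (hl : ∀ u, l u < numLabels k d)
    (q : Fin (size M) × Fin (size M)) : pairIdx k d l q < numStats k d := by
  unfold pairIdx
  split_ifs
  · exact (hl _).trans_le (Nat.le_add_right ..)
  · exact pairLab_lt (hl _) (hl _)

lemma codeOf_eq_sum {l : Fin (size M) → ℕ} (hl : ∀ u, l u < numLabels k d) :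
    codeOf k d l = ∑ q ∈ closePairs M, statBase M ^ pairIdx k d l q := by
  rw [codeOf, undig, ← Finset.sum_fiberwise_of_maps_to (t := Finset.range (numStats k d))
    (g := pairIdx k d l) fun q _ => Finset.mem_range.2 (pairIdx_lt hl q)]
  refine Finset.sum_congr rfl fun j _ => ?_
  rw [Finset.sum_congr rfl fun q hq => by rw [(Finset.mem_filter.1 hq).2], Finset.sum_const,
    smul_eq_mul, statOf]

lemma codeOf_lt (l : Fin (size M) → ℕ) : codeOf k d l < statBase M ^ numStats k d :=
  undig_lt fun _ _ => statOf_lt _ _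

lemma stat_codeOf (l : Fin (size M) → ℕ) {j : ℕ} (hj : j < numStats k d) :
    stat k d M (codeOf k d l) j = statOf k d l j :=
  dig_undig (fun _ _ => statOf_lt _ _) hj

lemma weight_view {f : Fin (size M) → ℕ} (hf : ∀ u, f u < 2 * k) (hd : ∀ u, deg M u ≤ d)
    (u v : Fin (size M)) : weight k d M u v (view k d f u) (view k d f v) =
      if (u, v) ∈ closePairs M then
        genVar k d M ^ statBase M ^ pairIdx k d (view k d f) (u, v) else 1 := by
  have hlt := pairIdx_lt (view_lt (d := d) hf) (u, v)
  rw [weight]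
  by_cases huv : u = v
  · subst huv
    rw [if_pos rfl, if_pos, if_pos (mem_closePairs.2 (.inl rfl)), unitStat]
    · rw [pairIdx, if_pos rfl] at hlt ⊢
      rw [min_eq_left hlt.le]
    · refine ⟨?_, fun i hi hdeg => ?_⟩
      · rw [labDig_view hf u (by lia)]
        exact hf u
      · rw [labDig_view hf u (by lia), viewDig_of_deg_le f hdeg]
  · rw [if_neg (Fin.val_ne_of_ne huv)]
    by_cases hadj : adj M u v
    · rw [if_pos hadj, if_pos, if_pos (mem_closePairs.2 (.inr hadj)), unitStat]
      · rw [pairIdx, if_neg huv] at hlt ⊢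
        rw [min_eq_left hlt.le]
      · rw [labDig_view hf u, viewDig_nbrIdx f hadj, labDig_view hf v (by lia), viewDig]
        exact Nat.succ_lt_succ ((nbrIdx_lt_deg hadj).trans_le (hd u))
    · rw [if_neg hadj, if_neg]
      simp [mem_closePairs, huv, hadj]

/-- A labelling with nonzero weight comes from an assignment of classes to the seats. -/
lemma exists_eq_view (hG : ∀ u v : Fin (size M), adj M u v ↔ G.Adj u v) {l : Fin (size M) → ℕ}
    (hl : ∀ u, l u < numLabels k d)
    (h : ∀ u v : Fin (size M), weight k d M u v (l u) (l v) ≠ 0) :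
    (∀ u, labDig k d (l u) 0 < 2 * k) ∧ l = view k d fun u => labDig k d (l u) 0 := by
  have hok (u : Fin (size M)) : LabelOK k d M u (l u) := by
    by_contra hcon
    exact h u u (by rw [weight, if_pos rfl, if_neg hcon])
  have hf : ∀ u, labDig k d (l u) 0 < 2 * k := fun u => (hok u).1
  refine ⟨hf, funext fun u => labDig_ext (hl u) (view_lt hf u) fun i hi => ?_⟩
  rw [labDig_view hf u hi]
  obtain _ | i := i
  · rfl
  obtain hdeg | hdeg := le_or_gt (deg M u) i
  · rw [viewDig_of_deg_le _ hdeg, (hok u).2 i (by lia) hdeg]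
  · obtain ⟨v, hv, rfl⟩ := exists_nbrIdx_eq hdeg
    rw [viewDig_nbrIdx _ hv]
    by_contra hcon
    refine h u v ?_
    rw [weight, if_neg (Fin.val_ne_of_ne ((hG u v).1 hv).ne), if_pos hv, if_neg hcon]

variable (k) in
/-- The assignments of refined classes to the seats. -/
def assignments (M : Memory) : Finset (Fin (size M) → ℕ) :=
  Fintype.piFinset fun _ => Finset.range (2 * k)

lemma mem_assignments {f : Fin (size M) → ℕ} : f ∈ assignments k M ↔ ∀ u, f u < 2 * k := by
  simp [assignments]

lemma view_injective {f g : Fin (size M) → ℕ} (hf : ∀ u, f u < 2 * k) (hg : ∀ u, g u < 2 * k)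
    (h : view k d f = view k d g) : f = g := funext fun u => by
  have := congrArg (fun l => labDig k d (l u) 0) h
  simpa only [labDig_view hf u (Nat.succ_pos d), labDig_view hg u (Nat.succ_pos d), viewDig]
    using this

/-- The partition function is the value of the generating function of the statistics of all
assignments of classes to the seats. -/
lemma val_eq_generating (hG : ∀ u v : Fin (size M), adj M u v ↔ G.Adj u v) (hd : ∀ u, deg M u ≤ d) :
    val (fun u v : Fin (size M) => weight k d M u v) (numLabels k d) Finset.univ 0 =
      ∑ f ∈ assignments k M, genVar k d M ^ codeOf k d (view k d f) := by
  have hmem {l : Fin (size M) → ℕ} : l ∈ labellings (numLabels k d) Finset.univ 0 ↔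
      ∀ u, l u < numLabels k d := by simp [labellings]
  symm
  refine Finset.sum_of_injOn (view k d) (fun f hf g hg h => ?_) (fun f hf => ?_)
    (fun l hl hl' => ?_) fun f hf => ?_
  · exact view_injective (mem_assignments.1 hf) (mem_assignments.1 hg) h
  · exact hmem.2 (view_lt (mem_assignments.1 hf))
  · by_contra hne
    refine hl' ?_
    have h (u v : Fin (size M)) : weight k d M u v (l u) (l v) ≠ 0 := by
      have := Finset.prod_ne_zero_iff.1 (Finset.prod_ne_zero_iff.1 hne u (Finset.mem_univ u)) v
        (Finset.mem_univ v)
      simpa using this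
    obtain ⟨h1, h2⟩ := exists_eq_view hG (hmem.1 hl) h
    exact ⟨_, Finset.mem_coe.2 (mem_assignments.2 h1), h2.symm⟩
  · rw [mem_assignments] at hf
    simp only [weight_view hf hd, Finset.mem_univ, true_or, if_true]
    rw [codeOf_eq_sum (view_lt hf), ← Finset.prod_pow_eq_pow_sum, ← Fintype.prod_prod_type']
    exact (Fintype.prod_ite_mem ..).symm

/-- The digits of the partition function count the assignments with given statistics. -/
lemma dig_partitionFn {t : ℕ} (hG : ∀ u v : Fin (size M), adj M u v ↔ G.Adj u v)
    (hd : ∀ u, deg M u ≤ d) (ht : treewidth G ≤ t) {c : ℕ}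
    (hc : c < statBase M ^ numStats k d) :
    dig (genVar k d M) (statBase M ^ numStats k d) (partitionFn k d t M) c =
      ((assignments k M).filter fun f => codeOf k d (view k d f) = c).card := by
  have h : partitionFn k d t M = undig (genVar k d M) (statBase M ^ numStats k d) fun c =>
      ((assignments k M).filter fun f => codeOf k d (view k d f) = c).card := by
    rw [partitionFn_eq hG ht 0, val_eq_generating hG hd, undig,
      ← Finset.sum_fiberwise_of_maps_to (t := Finset.range (statBase M ^ numStats k d))
        (g := fun f => codeOf k d (view k d f)) fun f _ => Finset.mem_range.2 (codeOf_lt _)]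
    refine Finset.sum_congr rfl fun j _ => ?_
    rw [Finset.sum_congr rfl fun q hq => by rw [(Finset.mem_filter.1 hq).2], Finset.sum_const,
      smul_eq_mul]
  rw [h]
  refine dig_undig (fun c _ => ?_) hc
  refine (Finset.card_filter_le _ _).trans_lt ?_
  have hk : 2 * k ≤ numLabels k d := by
    rw [numLabels, pow_succ]
    exact (Nat.le_succ _).trans (Nat.le_mul_of_pos_left _ (by positivity))
  calc (assignments k M).card = (2 * k) ^ size M := by simp [assignments]
    _ ≤ numLabels k d ^ size M := Nat.pow_le_pow_left hk _
    _ ≤ (2 ^ numLabels k d) ^ size M := Nat.pow_le_pow_left Nat.lt_two_pow_self.le _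
    _ = 2 ^ (numLabels k d * size M) := (pow_mul ..).symm
    _ < genVar k d M := Nat.pow_lt_pow_right (by lia) (Nat.lt_succ_self _)

end

end Seating

/-! ### Counting arrangements by their assignments of classes -/

section Perm

variable {α : Type*} [Fintype α] [DecidableEq α]

/-- The number of arrangements that induce a given assignment of classes. -/
lemma card_perm_comp_symm_eq {m : ℕ} {K f : α → ℕ} (hK : ∀ a, K a < m)
    (h : ∀ i < m, (Finset.univ.filter fun u => f u = i).card =
      (Finset.univ.filter fun a => K a = i).card) (hf : ∀ u, f u < m) :
    Fintype.card {π : Equiv.Perm α // K ∘ π.symm = f} =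
      ∏ i ∈ Finset.range m, (Finset.univ.filter fun a => K a = i).card.factorial := by
  have hfib (i : ℕ) : Nonempty ({a // K a = i} ≃ {u // f u = i}) := by
    rw [← Fintype.card_eq, Fintype.card_subtype, Fintype.card_subtype]
    by_cases hi : i < m
    · exact (h i hi).symm
    · rw [Finset.filter_false_of_mem, Finset.filter_false_of_mem]
      · intro u _ hu
        exact hi (hu ▸ hf u)
      · intro a _ ha
        exact hi (ha ▸ hK a)
  let e : Equiv.Perm α := Equiv.ofFiberEquiv fun i => (hfib i).some
  have he (a : α) : f (e a) = K a := Equiv.ofFiberEquiv_map _ a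
  let K' : α → Fin m := fun a => ⟨K a, hK a⟩
  have key : Fintype.card {π : Equiv.Perm α // K ∘ π.symm = f} =
      Fintype.card {g : Equiv.Perm α // K' ∘ g = K'} := by
    refine Fintype.card_congr (Equiv.subtypeEquiv ⟨fun π => e.trans π.symm, fun g => g.symm.trans e,
      fun π => ?_, fun g => ?_⟩ fun π => ?_)
    · ext a
      simp
    · ext a
      simp
    · simp only [funext_iff, Function.comp_apply, Equiv.coe_fn_mk, Equiv.trans_apply, K',
        Fin.mk.injEq]
      exact ⟨fun h a => by rw [h, he], fun h u => by
        simpa [← he] using h (e.symm u)⟩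
  rw [key, DomMulAct.stabilizer_card, Finset.prod_range]
  refine Finset.prod_congr rfl fun i _ => ?_
  rw [Fintype.card_subtype]
  simp only [K', Fin.ext_iff]

open Classical in
/-- If a property of arrangements depends only on the assignments of classes, then the arrangements
with this property are counted by the assignments with this property. -/
lemma card_perm_of_comp_symm {m : ℕ} {K : α → ℕ} (hK : ∀ a, K a < m) (Q : (α → ℕ) → Prop) :
    Nat.card {π : Equiv.Perm α // Q (K ∘ π.symm)} =
      (∏ i ∈ Finset.range m, (Finset.univ.filter fun a => K a = i).card.factorial) *
      ((Fintype.piFinset fun _ : α => Finset.range m).filter fun f => Q f ∧ ∀ i < m,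
        (Finset.univ.filter fun u => f u = i).card =
          (Finset.univ.filter fun a => K a = i).card).card := by
  rw [Nat.card_eq_fintype_card, Fintype.card_subtype, Finset.card_eq_sum_card_fiberwise
    (f := fun π : Equiv.Perm α => K ∘ π.symm) (t := (Fintype.piFinset fun _ : α =>
      Finset.range m).filter fun f => Q f ∧ ∀ i < m, (Finset.univ.filter fun u => f u = i).card =
        (Finset.univ.filter fun a => K a = i).card), Finset.sum_congr rfl fun f hf => ?_,
    Finset.sum_const, smul_eq_mul, mul_comm]
  · obtain ⟨h1, h2, h3⟩ := Finset.mem_filter.1 hf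
    rw [← card_perm_comp_symm_eq hK h3 (by simpa using h1), Fintype.card_subtype,
      Finset.filter_filter]
    congr 1
    refine Finset.filter_congr fun π _ => and_iff_right_of_imp ?_
    rintro rfl
    exact h2
  · intro π hπ
    refine Finset.mem_coe.2 (Finset.mem_filter.2 ⟨by simpa using fun a => hK _,
      (Finset.mem_filter.1 hπ).2, fun i _ => ?_⟩)
    refine Finset.card_equiv π.symm fun u => by simp

end Perm

namespace Seating

open RAM

section

variable {k d : ℕ} {sym : Prop} {M : Memory} {G : SimpleGraph (Fin (size M))}

/-! ### The meaning of the statistics -/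

lemma statOf_label {l : Fin (size M) → ℕ} {x : ℕ} (hx : x < numLabels k d) :
    statOf k d l x = (Finset.univ.filter fun u => l u = x).card := by
  symm
  refine Finset.card_bij (fun u _ => (u, u)) (fun u hu => ?_) (fun u _ v _ h => ?_) fun q hq => ?_
  · rw [Finset.mem_filter] at hu ⊢
    exact ⟨mem_closePairs.2 (.inl rfl), by rw [pairIdx, if_pos rfl, hu.2]⟩
  · exact congrArg Prod.fst h
  · obtain ⟨u, v⟩ := q
    rw [Finset.mem_filter, pairIdx] at hq
    obtain ⟨-, hq⟩ := hq
    split_ifs at hq with huv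
    · obtain rfl : u = v := huv
      exact ⟨u, by simpa using hq, rfl⟩
    · lia

lemma pairLab_inj {D x y x' y' : ℕ} (hy : y < D) (hy' : y' < D)
    (h : D + x * D + y = D + x' * D + y') : x = x' ∧ y = y' := by
  have hD : 0 < D := by lia
  have h' : D * x + y = D * x' + y' := by
    rw [mul_comm D, mul_comm D]
    lia
  have h1 := congrArg (· / D) h'
  have h2 := congrArg (· % D) h'
  simpa [Nat.mul_add_div hD, Nat.div_eq_of_lt, Nat.mod_eq_of_lt, hy, hy'] using And.intro h1 h2

open Classical in
lemma statOf_pair (hG : ∀ u v : Fin (size M), adj M u v ↔ G.Adj u v) {l : Fin (size M) → ℕ}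
    (hl : ∀ u, l u < numLabels k d) {x y : ℕ} (hy : y < numLabels k d) :
    statOf k d l (numLabels k d + x * numLabels k d + y) = (Finset.univ.filter
      fun q : Fin (size M) × Fin (size M) => G.Adj q.1 q.2 ∧ l q.1 = x ∧ l q.2 = y).card := by
  unfold statOf
  congr 1
  ext q
  rw [Finset.mem_filter, Finset.mem_filter, mem_closePairs, hG, pairIdx]
  simp only [Finset.mem_univ, true_and]
  split_ifs with hq
  · have := hl q.1
    have h1 : l q.1 ≠ numLabels k d + x * numLabels k d + y := by lia
    simp [hq, hq ▸ h1]
  · simp only [hq, false_or]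
    refine and_congr_right fun _ => ⟨fun h => pairLab_inj (hl _) hy h, ?_⟩
    rintro ⟨rfl, rfl⟩
    rfl

open Classical in
/-- The pairs of seats with labels `x` and `y` are adjacent, equal, or neither. -/
lemma card_mul_card_eq (l : Fin (size M) → ℕ) (x y : ℕ) :
    (Finset.univ.filter fun u => l u = x).card * (Finset.univ.filter fun u => l u = y).card =
      ((Finset.univ.filter fun q : Fin (size M) × Fin (size M) =>
        G.Adj q.1 q.2 ∧ l q.1 = x ∧ l q.2 = y).card +
      if x = y then (Finset.univ.filter fun u => l u = x).card else 0) +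
      (Finset.univ.filter fun q : Fin (size M) × Fin (size M) =>
        (q.1 ≠ q.2 ∧ ¬ G.Adj q.1 q.2) ∧ l q.1 = x ∧ l q.2 = y).card := by
  have hdiag : (if x = y then (Finset.univ.filter fun u => l u = x).card else 0) =
      (Finset.univ.filter fun q : Fin (size M) × Fin (size M) =>
        q.1 = q.2 ∧ l q.1 = x ∧ l q.2 = y).card := by
    symm
    split_ifs with hxy
    · subst hxy
      refine Finset.card_bij (fun q _ => q.1) (fun q hq => ?_) (fun q hq q' hq' h => ?_)
        fun u hu => ⟨(u, u), by simpa using hu, rfl⟩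
      · simp only [Finset.mem_filter] at hq ⊢
        exact ⟨Finset.mem_univ _, hq.2.2.1⟩
      · simp only [Finset.mem_filter] at hq hq'
        exact Prod.ext h (by rw [← hq.2.1, ← hq'.2.1, h])
    · rw [Finset.card_eq_zero, Finset.filter_eq_empty_iff]
      rintro q - ⟨h1, h2, h3⟩
      exact hxy (by rw [← h2, ← h3, h1])
  rw [hdiag, ← Finset.card_product, ← Finset.card_union_of_disjoint,
    ← Finset.card_union_of_disjoint]
  · congr 1
    ext q
    simp only [Finset.mem_product, Finset.mem_union, Finset.mem_filter, Finset.mem_univ, true_and]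
    tauto
  · refine Finset.disjoint_left.2 fun q hq hq' => ?_
    simp only [Finset.mem_union, Finset.mem_filter] at hq hq'
    tauto
  · refine Finset.disjoint_left.2 fun q hq hq' => ?_
    simp only [Finset.mem_filter] at hq hq'
    exact hq.2.1.ne hq'.2.1

variable (k d sym) in
open Classical in
/-- There is no forbidden pair of labels if the seats are assigned classes by `f`. -/
def Allowed (f : Fin (size M) → ℕ) : Prop :=
  ∀ u v : Fin (size M), u ≠ v →
    ¬ BadLab k d sym M (if adj M u v then 0 else 1) (view k d f u) (view k d f v)

lemma classSize_eq (i : ℕ) : classSize M i =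
    (Finset.univ.filter fun a : Fin (size M) => cls M a = i).card := by
  rw [classSize, Finset.sum_range, Finset.card_filter]

/-- A code is good if and only if it belongs to allowed assignments of classes that can be induced
by arrangements. -/
lemma goodCode_iff (hG : ∀ u v : Fin (size M), adj M u v ↔ G.Adj u v) {f : Fin (size M) → ℕ}
    (hf : ∀ u, f u < 2 * k) : GoodCode k d sym M (codeOf k d (view k d f)) ↔
      Allowed k d sym f ∧ ∀ i < 2 * k, (Finset.univ.filter fun u => f u = i).card =
        (Finset.univ.filter fun a : Fin (size M) => cls M a = i).card := by
  classical
  have hl := view_lt (d := d) hf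
  have hlt {x : ℕ} (hx : x < numLabels k d) : x < numStats k d :=
    hx.trans_le (Nat.le_add_right ..)
  refine and_congr ?_ (forall₂_congr fun i _ => ?_)
  · constructor
    · intro h u v huv hbad
      obtain ⟨h0, h1⟩ := h _ (hl u) _ (hl v)
      split_ifs at hbad with hadj
      · have := h0 hbad
        rw [stat_codeOf _ (pairLab_lt (hl u) (hl v)), statOf_pair hG hl (hl v),
          Finset.card_eq_zero, Finset.filter_eq_empty_iff] at this
        exact this (Finset.mem_univ (u, v)) ⟨(hG u v).1 hadj, rfl, rfl⟩
      · have := h1 hbad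
        rw [stat_codeOf _ (pairLab_lt (hl u) (hl v)), statOf_pair hG hl (hl v),
          stat_codeOf _ (hlt (hl u)), stat_codeOf _ (hlt (hl v)), statOf_label (hl u),
          statOf_label (hl v), card_mul_card_eq (G := G), Nat.add_eq_left,
          Finset.card_eq_zero, Finset.filter_eq_empty_iff] at this
        exact this (Finset.mem_univ (u, v)) ⟨⟨huv, mt (hG u v).2 hadj⟩, rfl, rfl⟩
    · intro h x hx y hy
      rw [stat_codeOf _ (pairLab_lt hx hy), statOf_pair hG hl hy, stat_codeOf _ (hlt hx),
        stat_codeOf _ (hlt hy), statOf_label hx, statOf_label hy, card_mul_card_eq (G := G),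
        Nat.add_eq_left, Finset.card_eq_zero, Finset.filter_eq_empty_iff, Finset.card_eq_zero,
        Finset.filter_eq_empty_iff]
      constructor
      · rintro hbad ⟨u, v⟩ - ⟨hadj, rfl, rfl⟩
        refine h u v hadj.ne ?_
        rwa [if_pos ((hG u v).2 hadj)]
      · rintro hbad ⟨u, v⟩ - ⟨⟨huv, hadj⟩, rfl, rfl⟩
        refine h u v huv ?_
        rwa [if_neg (mt (hG u v).1 hadj)]
  · rw [← classSize_eq]
    refine Eq.congr_left ?_
    rw [Finset.card_eq_sum_card_fiberwise (f := view k d f) (t := Finset.range (numLabels k d))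
      fun u _ => Finset.mem_coe.2 (Finset.mem_range.2 (hl u))]
    refine Finset.sum_congr rfl fun x hx => ?_
    rw [Finset.mem_range] at hx
    rw [stat_codeOf _ (hlt hx), statOf_label hx, Finset.filter_filter]
    have h (u : Fin (size M)) (hu : view k d f u = x) : labDig k d x 0 = f u := by
      rw [← hu, labDig_view hf u (Nat.succ_pos d), viewDig]
    split_ifs with hxi
    · congr 1
      refine Finset.filter_congr fun u _ => ?_
      exact ⟨fun hu => ⟨by rw [← h u hu, hxi], hu⟩, fun hu => hu.2⟩
    · symm
      rw [Finset.card_eq_zero, Finset.filter_eq_empty_iff]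
      rintro u - ⟨h1, h2⟩
      exact hxi (by rw [h u h2, h1])

lemma prod_eq_factorial {s n : ℕ} (h : s ≤ n) :
    ∏ j ∈ Finset.range n, (if j < s then j + 1 else 1) = s.factorial := by
  rw [← Finset.prod_range_add_one_eq_factorial, ← Finset.prod_filter]
  congr 1
  ext j
  simp only [Finset.mem_filter, Finset.mem_range]
  lia

open Classical in
/-- The computed number is the number of arrangements that induce an allowed assignment of
classes. -/
lemma answer_eq {t : ℕ} (hG : ∀ u v : Fin (size M), adj M u v ↔ G.Adj u v)
    (hd : ∀ u, deg M u ≤ d) (ht : treewidth G ≤ t)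
    (hcls : ∀ a : Fin (size M), cls M a < 2 * k) : answer k d t sym M =
      Nat.card {π : Equiv.Perm (Fin (size M)) // Allowed k d sym fun u => cls M (π.symm u)} := by
  refine Eq.trans ?_ (card_perm_of_comp_symm (K := fun a : Fin (size M) => cls M a) hcls
    (Allowed k d sym)).symm
  rw [answer]
  congr 1
  · refine Finset.prod_congr rfl fun i _ => ?_
    rw [prod_eq_factorial, classSize_eq]
    rw [classSize_eq]
    exact (Finset.card_le_univ _).trans (by simp)
  · have h : (assignments k M).filter (fun f => Allowed k d sym f ∧ ∀ i < 2 * k,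
        (Finset.univ.filter fun u => f u = i).card =
          (Finset.univ.filter fun a : Fin (size M) => cls M a = i).card) =
        (assignments k M).filter fun f => GoodCode k d sym M (codeOf k d (view k d f)) :=
      Finset.filter_congr fun f hf => (goodCode_iff hG (mem_assignments.1 hf)).symm
    refine Eq.trans ?_ (congrArg Finset.card h).symm
    rw [Finset.card_eq_sum_card_fiberwise (f := fun f => codeOf k d (view k d f))
      (t := Finset.range (statBase M ^ numStats k d))
      fun f _ => Finset.mem_coe.2 (Finset.mem_range.2 (codeOf_lt _))]
    refine Finset.sum_congr rfl fun c hc => ?_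
    rw [dig_partitionFn hG hd ht (Finset.mem_range.1 hc), Finset.filter_filter]
    split_ifs with hgood
    · congr 1
      refine Finset.filter_congr fun f _ => ⟨fun h => ⟨h ▸ hgood, h⟩, fun h => h.2⟩
    · symm
      rw [Finset.card_eq_zero, Finset.filter_eq_empty_iff]
      rintro f - ⟨h1, h2⟩
      exact hgood (h2 ▸ h1)

/-! ### Envy in terms of labels -/

section Envy

variable {p : Fin (size M) → Fin (size M) → ℝ} [DecidableRel G.Adj]
  (hG : ∀ u v : Fin (size M), adj M u v ↔ G.Adj u v) (hd : ∀ u, deg M u ≤ d)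
  (hcls : ∀ a : Fin (size M), cls M a < 2 * k)
  (hp : ∀ a b : Fin (size M), a ≠ b → p a b = classPref M (cls M a) (cls M b))
  (h₀ : ∀ x, classPref M x (2 * k) = 0) (π : Equiv.Perm (Fin (size M)))
include hG hd hcls h₀

lemma labSum_one (u v : Fin (size M)) :
    labSum k d M 1 (view k d (fun u => cls M (π.symm u)) u) (view k d (fun u => cls M (π.symm u)) v)
      = ∑ w ∈ G.neighborFinset v, classPref M (cls M (π.symm u)) (cls M (π.symm w)) := by
  have hf : ∀ u, (fun u => cls M (π.symm u)) u < 2 * k := fun u => hcls _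
  rw [labSum, labDig_view hf u (Nat.succ_pos d), viewDig, Nat.add_sub_cancel]
  exact sum_labDig_view hf hG hd v (h₀ _)

/-- Beginning with the digit with index `0`, the class of the seat itself counts as well. -/
lemma labSum_zero (u v : Fin (size M)) :
    labSum k d M 0 (view k d (fun u => cls M (π.symm u)) u) (view k d (fun u => cls M (π.symm u)) v)
      = ∑ w ∈ G.neighborFinset v, classPref M (cls M (π.symm u)) (cls M (π.symm w)) +
        classPref M (cls M (π.symm u)) (cls M (π.symm v)) := by
  have hf : ∀ u, (fun u => cls M (π.symm u)) u < 2 * k := fun u => hcls _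
  rw [← labSum_one hG hd hcls h₀, labSum, labSum, Nat.sub_zero, Nat.add_sub_cancel,
    Finset.sum_range_succ', zero_add, labDig_view hf v (Nat.succ_pos d),
    labDig_view hf u (Nat.succ_pos d)]
  rfl

include hp

open Classical in
/-- Envy depends only on the labels of the two seats, and on whether these seats are adjacent. -/
lemma envies_iff {a b : Fin (size M)} (hab : a ≠ b) :
    Envies G p π a b ↔ EnvyLab k d M (if adj M (π a) (π b) then 0 else 1)
      (view k d (fun u => cls M (π.symm u)) (π a))
      (view k d (fun u => cls M (π.symm u)) (π b)) := by
  have hu : utility G p π a =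
      ∑ w ∈ G.neighborFinset (π a), classPref M (cls M a) (cls M (π.symm w)) := by
    refine Finset.sum_congr rfl fun w hw => hp _ _ ?_
    rintro rfl
    simp at hw
  have hsw : ∀ w ∈ G.neighborFinset (π b), w ≠ π a → p a ((swapped π a b).symm w) =
      classPref M (cls M a) (cls M (π.symm w)) := fun w hw hwa => by
    have h1 : π.symm w ≠ a := fun h => hwa (by rw [← h, Equiv.apply_symm_apply])
    have h2 : π.symm w ≠ b := by
      rintro rfl
      simp at hw
    rw [← hp a _ h1.symm]
    simp [swapped, Equiv.swap_apply_of_ne_of_ne h1 h2]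
  have hswa : p a ((swapped π a b).symm (π a)) = classPref M (cls M a) (cls M b) := by
    rw [← hp a b hab]
    simp [swapped]
  have hb : swapped π a b a = π b := by simp [swapped]
  unfold Envies EnvyLab
  rw [hu, utility, hb]
  split_ifs with hadj
  · have hmem : π a ∈ G.neighborFinset (π b) := by
      rw [SimpleGraph.mem_neighborFinset]
      exact ((hG _ _).1 hadj).symm
    have hrest := Finset.sum_congr (rfl : (G.neighborFinset (π b)).erase (π a) = _) fun w hw =>
      hsw w (Finset.mem_of_mem_erase hw) (Finset.ne_of_mem_erase hw)
    rw [labSum_zero hG hd hcls h₀, labSum_zero hG hd hcls h₀, ← Finset.add_sum_erase _ _ hmem,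
      ← Finset.add_sum_erase (G.neighborFinset (π b)) (fun w => classPref M _ _) hmem, hrest, hswa]
    simp only [Equiv.symm_apply_apply]
    constructor <;> intro h <;> linarith
  · rw [labSum_one hG hd hcls h₀, labSum_one hG hd hcls h₀]
    simp only [Equiv.symm_apply_apply]
    rw [Finset.sum_congr rfl fun w hw => hsw w hw ?_]
    rintro rfl
    rw [SimpleGraph.mem_neighborFinset] at hw
    exact hadj ((hG _ _).2 hw.symm)

omit hG hd hcls hp h₀ in
lemma not_envies_self (a : Fin (size M)) : ¬ Envies G p π a a := by
  have : swapped π a a = π := by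
    ext
    simp [swapped]
  simp [Envies, this]

lemma isStable_iff : IsStable G p π ↔ Allowed k d True fun u => cls M (π.symm u) := by
  constructor
  · intro h u v huv hbad
    obtain ⟨a, rfl⟩ := π.surjective u
    obtain ⟨b, rfl⟩ := π.surjective v
    have hab : a ≠ b := fun h => huv (congrArg π h)
    refine h a b ⟨(envies_iff hG hd hcls hp h₀ π hab).2 hbad.1,
      (envies_iff hG hd hcls hp h₀ π hab.symm).2 ?_⟩
    have := hbad.2 trivial
    rwa [show adj M (π a) (π b) = adj M (π b) (π a) by
      rw [hG, hG, SimpleGraph.adj_comm]] at this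
  · rintro h a b ⟨h1, h2⟩
    obtain rfl | hab := eq_or_ne a b
    · exact not_envies_self π a h1
    · have h2' := (envies_iff hG hd hcls hp h₀ π hab.symm).1 h2
      rw [show adj M (π b) (π a) = adj M (π a) (π b) by
        rw [hG, hG, SimpleGraph.adj_comm]] at h2'
      exact h _ _ (π.injective.ne hab)
        ⟨(envies_iff hG hd hcls hp h₀ π hab).1 h1, fun _ => h2'⟩

lemma isEnvyFree_iff : IsEnvyFree G p π ↔ Allowed k d False fun u => cls M (π.symm u) := by
  constructor
  · intro h u v huv hbad
    obtain ⟨a, rfl⟩ := π.surjective u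
    obtain ⟨b, rfl⟩ := π.surjective v
    have hab : a ≠ b := fun h => huv (congrArg π h)
    exact h a b ((envies_iff hG hd hcls hp h₀ π hab).2 hbad.1)
  · intro h a b hab
    obtain rfl | hne := eq_or_ne a b
    · exact not_envies_self π a hab
    · exact h _ _ (π.injective.ne hne)
        ⟨(envies_iff hG hd hcls hp h₀ π hne).1 hab, fun h => h.elim⟩

end Envy

end

end Seating

/-! ### The input -/

namespace Seating

open RAM

open Classical in
/-- Counting the indices before the first index with a property gives this first index. -/
lemma count_eq_find (N : ℕ) (P : ℕ → Prop) :
    (∑ i ∈ Finset.range N, if ∀ j < N, j ≤ i → ¬ P j then 1 else 0) =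
      if h : ∃ j, j < N ∧ P j then Nat.find h else N := by
  rw [← Finset.card_filter]
  split_ifs with h
  · have hlt := (Nat.find_spec h).1
    have : (Finset.range N).filter (fun i => ∀ j < N, j ≤ i → ¬ P j) =
        Finset.range (Nat.find h) := by
      ext i
      simp only [Finset.mem_filter, Finset.mem_range]
      constructor
      · rintro ⟨-, h'⟩
        by_contra hi
        exact h' _ hlt (by lia) (Nat.find_spec h).2
      · intro hi
        exact ⟨hi.trans hlt, fun j hj hji hPj => Nat.find_min h (hji.trans_lt hi) ⟨hj, hPj⟩⟩
    rw [this, Finset.card_range]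
  · rw [Finset.filter_true_of_mem, Finset.card_range]
    exact fun i _ j hj _ hP => h ⟨j, hj, hP⟩

section

variable {n k : ℕ} (G : SimpleGraph (Fin n)) [DecidableRel G.Adj] (p : Fin n → Fin n → ℝ)
  (K : Fin n → Fin k)

lemma size_input : size (input G p K) = n := rfl

lemma lt_mul_self (u v : Fin n) : (u : ℕ) * n + v < n * n := by
  have := Nat.mul_le_mul_right n (Nat.succ_le_of_lt u.2)
  rw [Nat.succ_mul] at this
  lia

lemma divNat_pair (u v : Fin n) : Fin.divNat ⟨u * n + v, lt_mul_self u v⟩ = u := by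
  ext
  change ((u : ℕ) * n + v) / n = u
  rw [mul_comm, Nat.mul_add_div u.pos, Nat.div_eq_of_lt v.2, add_zero]

lemma modNat_pair (u v : Fin n) : Fin.modNat ⟨u * n + v, lt_mul_self u v⟩ = v := by
  ext
  rw [Fin.coe_modNat, Nat.mul_add_mod_self_right, Nat.mod_eq_of_lt v.2]

lemma adj_input (u v : Fin n) : adj (input G p K) u v ↔ G.Adj u v := by
  have h : (input G p K).nat 1 (u * n + v) = if G.Adj u v then 1 else 0 := by
    change (if h : _ then _ else _) = _
    rw [dif_pos (lt_mul_self u v), divNat_pair, modNat_pair]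
  rw [adj, size_input, h]
  simp

lemma class_input (a : Fin n) : (input G p K).nat 2 a = K a := by
  change (if h : _ then _ else _) = _
  rw [dif_pos a.2]

lemma real_input (a b : Fin n) : (input G p K).real 0 (a * n + b) = p a b := by
  change (if h : _ then _ else _) = _
  rw [dif_pos (lt_mul_self a b), divNat_pair, modNat_pair]

lemma real_input_self : (input G p K).real 0 (n * n) = 0 := by
  change (if h : _ then _ else _) = _
  rw [dif_neg (lt_irrefl _)]

open Classical in
lemma cls_input (a : Fin n) :
    cls (input G p K) a = 2 * K a + if ∃ b < a, K b = K a then 1 else 0 := by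
  rw [cls, class_input, size_input]
  congr 1
  refine if_congr ⟨?_, ?_⟩ rfl rfl
  · rintro ⟨b, hb, hba, h⟩
    rw [class_input G p K ⟨b, hb⟩, Fin.val_inj] at h
    exact ⟨⟨b, hb⟩, hba, h⟩
  · rintro ⟨b, hba, h⟩
    exact ⟨b, b.2, hba, by rw [class_input, h]⟩

lemma cls_input_lt (a : Fin n) : cls (input G p K) a < 2 * k := by
  have := (K a).2
  rw [cls_input]
  split_ifs <;> lia

variable {p K} in
/-- The preferences depend only on the refined classes. Two agents of a class need not have the same
preference for each other if the class has no other member; but they are in different refined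
classes. -/
lemma pref_eq (hK : IsClassPartition p K) {a b a' b' : Fin n} (hab : a ≠ b) (hab' : a' ≠ b')
    (ha : cls (input G p K) a = cls (input G p K) a')
    (hb : cls (input G p K) b = cls (input G p K) b') : p a b = p a' b' := by
  have hcls {x y : Fin n} (h : cls (input G p K) x = cls (input G p K) y) :
      K x = K y ∧ ((∃ z < x, K z = K x) ↔ ∃ z < y, K z = K y) := by
    rw [cls_input, cls_input] at h
    split_ifs at h with h1 h2 h2
    · exact ⟨Fin.ext (by lia), iff_of_true h1 h2⟩
    · lia
    · lia
    · exact ⟨Fin.ext (by lia), iff_of_false h1 h2⟩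
  have h1 {a b c : Fin n} (hb : b ≠ a) (hc : c ≠ a) (h : K b = K c) : p a b = p a c :=
    hK.indistinguishable a b c hb hc h
  have h2 {a a' b : Fin n} (hb : b ≠ a) (hb' : b ≠ a') (h : K a = K a') : p a b = p a' b := by
    obtain ⟨q, hq⟩ := hK.common (K a)
    rw [hq a rfl b hb, hq a' h.symm b hb']
  by_cases hb'a : b' = a
  · by_cases hba' : b = a'
    · subst hb'a hba'
      -- both agents are not the first of their class, so that there is a third agent
      obtain ⟨hKab, hfirst⟩ := hcls ha
      obtain ⟨z, hz, hzK⟩ : ∃ z < b', K z = K b' := by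
        by_contra h
        have h' := mt hfirst.2 h
        push Not at h h'
        obtain hlt | hlt := hab.lt_or_gt
        · exact h' b' hlt hKab
        · exact h b hlt hKab.symm
      obtain ⟨z', hz', hzK'⟩ := hfirst.1 ⟨z, hz, hzK⟩
      obtain ⟨c, hcb', hcb, hc⟩ : ∃ c, c ≠ b' ∧ c ≠ b ∧ K c = K b := by
        obtain hlt | hlt := hab.lt_or_gt
        · exact ⟨z, hz.ne, (hz.trans hlt).ne, hzK.trans hKab⟩
        · exact ⟨z', (hz'.trans hlt).ne, hz'.ne, hzK'⟩
      rw [h1 hab.symm hcb' hc.symm, h2 hcb' hcb hKab, h1 hcb hab (hc.trans hKab.symm)]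
    · rw [h2 hab.symm hba' (hcls ha).1, h1 hba' hab'.symm (hcls hb).1]
  · rw [h1 hab.symm hb'a (hcls hb).1, h2 hb'a hab'.symm (hcls ha).1]

lemma isPair_input (x y : ℕ) {i : ℕ} (hi : i < n * n) :
    IsPair (input G p K) x y i ↔ ∃ a b : Fin n, a ≠ b ∧ i = a * n + b ∧
      cls (input G p K) a = x ∧ cls (input G p K) b = y := by
  have hn : 0 < n := Nat.pos_of_mul_pos_left (Nat.zero_lt_of_lt hi)
  rw [IsPair, size_input]
  constructor
  · rintro ⟨h1, h2, h3⟩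
    refine ⟨⟨i / n, Nat.div_lt_of_lt_mul hi⟩, ⟨i % n, Nat.mod_lt _ hn⟩, fun h => h1 ?_, ?_, h2, h3⟩
    · exact congrArg Fin.val h
    · exact (Nat.div_add_mod' i n).symm
  · rintro ⟨a, b, hab, rfl, h1, h2⟩
    rw [mul_comm, Nat.mul_add_div hn, Nat.div_eq_of_lt b.2, add_zero, Nat.mul_add_mod_self_left,
      Nat.mod_eq_of_lt b.2]
    exact ⟨Fin.val_ne_of_ne hab, h1, h2⟩

variable {p K} in
lemma pref_eq_classPref (hK : IsClassPartition p K) {a b : Fin n} (hab : a ≠ b) :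
    p a b = classPref (input G p K) (cls (input G p K) a) (cls (input G p K) b) := by
  classical
  have h : ∃ j, j < n * n ∧ IsPair (input G p K) (cls (input G p K) a) (cls (input G p K) b) j :=
    ⟨a * n + b, lt_mul_self a b, (isPair_input G p K _ _ (lt_mul_self a b)).2
      ⟨a, b, hab, rfl, rfl, rfl⟩⟩
  rw [classPref, firstPair, size_input, count_eq_find, dif_pos h]
  obtain ⟨a', b', hab', heq, ha, hb⟩ :=
    (isPair_input G p K _ _ (Nat.find_spec h).1).1 (Nat.find_spec h).2
  rw [heq, real_input]
  exact pref_eq G hK hab hab' ha.symm hb.symm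

/-- There is no agent of class `2 * k`, the digit for missing neighbours. -/
lemma classPref_absent (x : ℕ) : classPref (input G p K) x (2 * k) = 0 := by
  classical
  rw [classPref, firstPair, size_input, count_eq_find, dif_neg, real_input_self]
  rintro ⟨j, hj, h⟩
  obtain ⟨-, b, -, -, -, hb⟩ := (isPair_input G p K _ _ hj).1 h
  exact (cls_input_lt G p K b).ne hb

lemma deg_input_le {d : ℕ} (hd : G.maxDegree ≤ d) (u : ℕ) : deg (input G p K) u ≤ d := by
  classical
  by_cases hu : u < n
  · refine le_trans (le_of_eq ?_) ((G.degree_le_maxDegree ⟨u, hu⟩).trans hd)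
    rw [deg, size_input, Finset.sum_range, ← Finset.card_filter, ← G.card_neighborFinset_eq_degree]
    congr 1
    ext v
    simp [adj_input G p K ⟨u, hu⟩ v]
  · have h (w : ℕ) : ¬ adj (input G p K) u w := fun h => hu h.1
    simp [deg, h]

lemma size_input_le {x : ℕ} (hx : x < 3) (i : ℕ) :
    ((input G p K).nat x i).size ≤ n + k + 1 := by
  refine (size_le_self _).trans ?_
  obtain _ | _ | _ | x := x
  · cases i with
    | zero => exact (Nat.le_add_right n k).trans (Nat.le_succ _)
    | succ i => exact Nat.zero_le _
  · change (if h : _ then _ else _) ≤ _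
    split_ifs <;> lia
  · change (if h : _ then _ else _) ≤ _
    split_ifs
    · exact (K _).2.le.trans (by lia)
    · exact Nat.zero_le _
  · lia

variable {p K} in
lemma answer_input_eq_numStable (hK : IsClassPartition p K) {d t : ℕ} (hd : G.maxDegree ≤ d)
    (ht : treewidth G ≤ t) : answer k d t True (input G p K) = numStable G p :=
  letI : DecidableRel (SimpleGraph.Adj (V := Fin (size (input G p K))) G) :=
    inferInstanceAs (DecidableRel G.Adj)
  (answer_eq (M := input G p K) (G := G) (adj_input G p K) (deg_input_le G p K hd) ht
    (cls_input_lt G p K)).trans <| Nat.card_congr <| Equiv.subtypeEquivRight fun π =>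
      (isStable_iff (M := input G p K) (G := G) (adj_input G p K) (deg_input_le G p K hd)
        (cls_input_lt G p K) (fun _ _ => pref_eq_classPref G hK) (classPref_absent G p K) π).symm

variable {p K} in
lemma answer_input_eq_numEnvyFree (hK : IsClassPartition p K) {d t : ℕ} (hd : G.maxDegree ≤ d)
    (ht : treewidth G ≤ t) : answer k d t False (input G p K) = numEnvyFree G p :=
  letI : DecidableRel (SimpleGraph.Adj (V := Fin (size (input G p K))) G) :=
    inferInstanceAs (DecidableRel G.Adj)
  (answer_eq (M := input G p K) (G := G) (adj_input G p K) (deg_input_le G p K hd) ht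
    (cls_input_lt G p K)).trans <| Nat.card_congr <| Equiv.subtypeEquivRight fun π =>
      (isEnvyFree_iff (M := input G p K) (G := G) (adj_input G p K) (deg_input_le G p K hd)
        (cls_input_lt G p K) (fun _ _ => pref_eq_classPref G hK) (classPref_absent G p K) π).symm

end

/-! ### The machine -/

/-- The instances of the counting problems. The program halts in polynomial time on all of them,
and the conditions on the graph and on the classes are needed only for its result to be correct. -/
structure Instance (k : ℕ) where
  n : ℕ
  G : SimpleGraph (Fin n)
  dec : DecidableRel G.Adj
  p : Fin n → Fin n → ℝ
  K : Fin n → Fin k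

instance {k : ℕ} (I : Instance k) : DecidableRel I.G.Adj := I.dec

/-- The context of the instances: there are no variables, and the memory holds the input. -/
noncomputable instance {k : ℕ} : Ctx (Instance k) where
  Idx := Empty
  mem I := input I.G I.p I.K
  var i := i.elim

/-- A function of the instances that is computable in polynomial time is computed by a program whose
running time is bounded by a polynomial in the number of agents. -/
lemma exists_prog {k : ℕ} {f : Instance k → ℕ} (hf : PT f) :
    ∃ (P : Prog) (B : Polynomial ℕ), ∀ I : Instance k,
      P.Returns (input I.G I.p I.K) (f I) (B.eval I.n) := by
  obtain ⟨P, B, hB, hP⟩ := hf.establishes (fun i => i.elim) 3 le_rfl fun i => i.elim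
  obtain ⟨q, hq⟩ := (hB.comp (IsPoly.id.add (.const (k + 1)))).add (.const 4)
  refine ⟨.seq P (.setNat 0 (.lit 0) (.get 3 (.lit 0))), q, fun I => ?_⟩
  obtain ⟨T, m', h1, h2, -, h4⟩ := hP I (I.n + (k + 1)) (input I.G I.p I.K)
    ⟨Nat.le_add_right _ _, fun x hx i => size_input_le I.G I.p I.K hx i, fun i => i.elim⟩
    ⟨.refl _ _, fun i => i.elim⟩
  refine ⟨_, _, .seq h1 (.setNat ..), ?_, ?_⟩
  · rw [hq]
    simp only [NExpr.cost]
    lia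
  · simp only [NExpr.eval, Memory.writeNat_same, h4]

end Seating

theorem mainTheorem3 (k d t : ℕ) :
    (∃ (P : RAM.Prog) (B : Polynomial ℕ), ∀ (n : ℕ) (G : SimpleGraph (Fin n)) [DecidableRel G.Adj]
      (p : Fin n → Fin n → ℝ) (K : Fin n → Fin k), Seating.IsClassPartition p K →
      G.maxDegree ≤ d → treewidth G ≤ t →
      P.Returns (Seating.input G p K) (Seating.numStable G p) (B.eval n)) ∧
    (∃ (P : RAM.Prog) (B : Polynomial ℕ), ∀ (n : ℕ) (G : SimpleGraph (Fin n)) [DecidableRel G.Adj]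
      (p : Fin n → Fin n → ℝ) (K : Fin n → Fin k), Seating.IsClassPartition p K →
      G.maxDegree ≤ d → treewidth G ≤ t →
      P.Returns (Seating.input G p K) (Seating.numEnvyFree G p) (B.eval n)) := by
  have hpt (sym : Prop) := Seating.IsMem.answer (k := k) (d := d) (t := t) (sym := sym)
    (M := RAM.Ctx.mem (Γ := Seating.Instance k)) fun _ => rfl
  obtain ⟨P, B, h⟩ := Seating.exists_prog (hpt True)
  obtain ⟨P', B', h'⟩ := Seating.exists_prog (hpt False)
  refine ⟨⟨P, B, fun n G _ p K hK hd ht => ?_⟩, ⟨P', B', fun n G _ p K hK hd ht => ?_⟩⟩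
  · rw [← Seating.answer_input_eq_numStable G hK hd ht]
    exact h ⟨n, G, inferInstance, p, K⟩
  · rw [← Seating.answer_input_eq_numEnvyFree G hK hd ht]
    exact h' ⟨n, G, inferInstance, p, K⟩
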